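/- Let $n\ge 0$ and let $\Sigma$ be a Cantor set (a compact, totally disconnected metrizable space without isolated points) with a free, minimal, continuous action of $\mathbb Z^n$ and an invariant Borel probability measure $\mu$. Let $X=\Sigma\times_{\mathbb Z^n}\mathbb R^n$ be the suspension, i.e. the quotient of $\Sigma\times\mathbb R^n$ by the diagonal action of $\mathbb Z^n$, with the action $[x,w]\cdot v=[x,w+v]$ of $\mathbb R^n$. Let $C(X)\rtimes\mathbb R^n$ be the crossed product C*-algebra, the completion of $C_c(\mathbb R^n,C(X))$ in the universal norm over all covariant representations, with product $(a*b)(y,s)=\int_{\mathbb R^n} a(y,r)\,b(y\cdot(-r),s-r)\,dr$ and $a^*(y,s)=\overline{a(y\cdot(-s),-s)}$. Let $\tilde\tau_\mu$ be the trace, with values in $[0,\infty]$ on positive elements of $C(X)\rtimes\mathbb R^n$, given by the invariant transverse measure $\mu$: $$\tilde\tau_\mu(a)=\int_\Sigma \operatorname{Tr}\bigl(1_{[0,1)^n}\,\pi_x(a)\,1_{[0,1)^n}\bigr)\,d\mu(x),$$ where $\pi_x$ is the regular representation on $L^2(\mathbb R^n)$ along the orbit of $[x,0]$, $(\pi_x(a)\xi)(t)=\int_{\mathbb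 R^n} a([x,t],t-s)\,\xi(s)\,ds$; for a positive element $a$ given by a function in $C_c(\mathbb R^n,C(X))$ this is $\int_\Sigma\int_{[0,1]^n}a([x,t],0)\,dt\,d\mu(x)$. Put $c=(\tfrac12,\dots,\tfrac12)$ and let $f:\mathbb R^n\to\mathbb R$ be continuous, supported in the cube of side $\tfrac14$ centered at $0$, with $\int_{\mathbb R^n} f(t)^2\,dt=1$. Then: 1. For every clopen $U\subseteq\Sigma$ the function $$e_U([x,t],s)=\chi_U(x)\,f(t-c)\,f(t-c-s),\qquad x\in\Sigma,\ t\in[0,1]^n,\ s\in\mathbb R^n,$$ is well defined and belongs to $C_c(\mathbb R^n,C(X))$, and it is a projection $e_U=e_U^2=e_U^*$ in $C(X)\rtimes\mathbb R^n$ with $\tilde\tau_\mu(e_U)=\mu(U)$. 2. The trace $\tilde\tau_\mu$ induces a homomorphism $\tilde\tau_\mu:K_0(C(X)\rtimes\mathbb R^n)\to\mathbb R$: every class can be written as $[p]-[s(p)]$, where $p$ is a projection in matrices over the unitization with scalar part $s(p)$ and $p-s(p)$ is a difference $a-b$ of positive matrices over $C(X)\rtimes\mathbb R^n$ with $\tilde\tau_\mu(a),\tilde\tau_\mu(b)<\infty$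 ($\tilde\tau_\mu$ summed over the diagonal), and $\tilde\tau_\mu([p]-[s(p)])=\tilde\tau_\mu(a)-\tilde\tau_\mu(b)$ for every such representation. In particular $\tilde\tau_\mu([e_U])=\mu(U)$. 3. There is a unique homomorphism $\alpha:K_0(C(\Sigma))\to K_0(C(X)\rtimes\mathbb R^n)$ with $\alpha([\chi_U])=[e_U]$ for every clopen $U\subseteq\Sigma$, and $\tilde\tau_\mu\circ\alpha=\mu$, where $\mu:K_0(C(\Sigma))\to\mathbb R$ is the homomorphism induced by the trace $g\mapsto\int_\Sigma g\,d\mu$ on $C(\Sigma)$. -/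

import Mathlib

open MeasureTheory Matrix
open scoped ENNReal CompactlySupported

set_option linter.unusedSectionVars false

noncomputable section

/-! ### K-theory of C*-algebras -/

namespace KTheory

section Unital

variable {B : Type*} [Ring B] [StarRing B]

/-- Murray–von Neumann equivalence of projections in matrix algebras of possibly different sizes:
`p = v* v` and `q = v v*` for a rectangular matrix `v`. -/
def MvN {ι κ : Type*} [Fintype ι] [Fintype κ] (p : Matrix ι ι B) (q : Matrix κ κ B) : Prop :=
  ∃ v : Matrix κ ι B, vᴴ * v = p ∧ v * vᴴ = q

section MvN

variable {ι κ l m : Type*} [Fintype ι] [Fintype κ] [Fintype l] [Fintype m]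
  {p : Matrix ι ι B} {q : Matrix κ κ B} {r : Matrix l l B} {s : Matrix m m B}

theorem MvN.refl (hp : IsStarProjection p) : MvN p p := by
  have h : pᴴ = p := hp.isSelfAdjoint
  have h' : p * p = p := hp.isIdempotentElem
  exact ⟨p, by rw [h, h'], by rw [h, h']⟩

theorem MvN.symm (h : MvN p q) : MvN q p := by
  obtain ⟨v, h1, h2⟩ := h
  exact ⟨vᴴ, by rw [conjTranspose_conjTranspose, h2], by rw [conjTranspose_conjTranspose, h1]⟩

theorem MvN.trans (hp : IsStarProjection p) (hr : IsStarProjection r) (h : MvN p q)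
    (h' : MvN q r) : MvN p r := by
  obtain ⟨v, h1, h2⟩ := h
  obtain ⟨w, h3, h4⟩ := h'
  refine ⟨w * v, ?_, ?_⟩
  · calc (w * v)ᴴ * (w * v) = vᴴ * (wᴴ * w) * v := by
          rw [conjTranspose_mul]; simp only [Matrix.mul_assoc]
      _ = (vᴴ * v) * (vᴴ * v) := by rw [h3, ← h2]; simp only [Matrix.mul_assoc]
      _ = p := by rw [h1]; exact hp.isIdempotentElem
  · calc (w * v) * (w * v)ᴴ = w * (v * vᴴ) * wᴴ := by
          rw [conjTranspose_mul]; simp only [Matrix.mul_assoc]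
      _ = (w * wᴴ) * (w * wᴴ) := by rw [h2, ← h3]; simp only [Matrix.mul_assoc]
      _ = r := by rw [h4]; exact hr.isIdempotentElem

theorem MvN.submatrix (hp : IsStarProjection p) (e : κ ≃ ι) : MvN p (p.submatrix e e) := by
  have h : pᴴ = p := hp.isSelfAdjoint
  have h' : p * p = p := hp.isIdempotentElem
  refine ⟨p.submatrix e id, ?_, ?_⟩
  · rw [conjTranspose_submatrix, submatrix_mul_equiv, h, h', submatrix_id_id]
  · rw [conjTranspose_submatrix, h, ← submatrix_mul _ _ _ _ _ Function.bijective_id, h']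

theorem MvN.fromBlocks (h : MvN p q) (h' : MvN r s) :
    MvN (fromBlocks p 0 0 r) (fromBlocks q 0 0 s) := by
  obtain ⟨v, h1, h2⟩ := h
  obtain ⟨w, h3, h4⟩ := h'
  refine ⟨Matrix.fromBlocks v 0 0 w, ?_, ?_⟩
  · rw [fromBlocks_conjTranspose, fromBlocks_multiply]
    simp [h1, h3]
  · rw [fromBlocks_conjTranspose, fromBlocks_multiply]
    simp [h2, h4]

theorem isStarProjection_fromBlocks (hp : IsStarProjection p) (hq : IsStarProjection q) :
    IsStarProjection (fromBlocks p 0 0 q) := by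
  have hp1 : pᴴ = p := hp.isSelfAdjoint
  have hp2 : p * p = p := hp.isIdempotentElem
  have hq1 : qᴴ = q := hq.isSelfAdjoint
  have hq2 : q * q = q := hq.isIdempotentElem
  refine ⟨?_, ?_⟩
  · rw [IsIdempotentElem, fromBlocks_multiply]
    simp [hp2, hq2]
  · rw [IsSelfAdjoint, star_eq_conjTranspose, fromBlocks_conjTranspose]
    simp [hp1, hq1]

theorem isStarProjection_submatrix (hp : IsStarProjection p) (e : κ ≃ ι) :
    IsStarProjection (p.submatrix e e) := by
  have h : pᴴ = p := hp.isSelfAdjoint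
  have h' : p * p = p := hp.isIdempotentElem
  refine ⟨?_, ?_⟩
  · rw [IsIdempotentElem, submatrix_mul_equiv, h']
  · rw [IsSelfAdjoint, star_eq_conjTranspose, conjTranspose_submatrix, h]

end MvN

variable (B) in
/-- A projection in the matrix algebra `M_k(B)`, for some `k`. -/
structure Proj where
  size : ℕ
  mat : Matrix (Fin size) (Fin size) B
  isProj : IsStarProjection mat

variable (B) in
/-- Murray–von Neumann equivalence on the projections in matrices over `B`. -/
instance Proj.setoid : Setoid (Proj B) where
  r p q := MvN p.mat q.mat
  iseqv := ⟨fun p => MvN.refl p.isProj, MvN.symm, fun {p _ r} => MvN.trans p.isProj r.isProj⟩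

/-- The block sum `p ⊕ q`. -/
def Proj.sum (p q : Proj B) : Proj B where
  size := p.size + q.size
  mat := (fromBlocks p.mat 0 0 q.mat).submatrix finSumFinEquiv.symm finSumFinEquiv.symm
  isProj := isStarProjection_submatrix (isStarProjection_fromBlocks p.isProj q.isProj) _

/-- The projection of size zero. -/
def Proj.zero : Proj B := ⟨0, 0, IsStarProjection.zero _⟩

theorem Proj.sum_mvN (p q : Proj B) : MvN (fromBlocks p.mat 0 0 q.mat) (p.sum q).mat :=
  MvN.submatrix (isStarProjection_fromBlocks p.isProj q.isProj) _

variable (B) in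
/-- The set `V(B)` of Murray–von Neumann classes of projections in matrices over `B`. -/
def ProjClass : Type _ := Quotient (Proj.setoid B)

/-- The class of a projection in `V(B)`. -/
def ProjClass.mk (p : Proj B) : ProjClass B := Quotient.mk _ p

theorem ProjClass.sound {p q : Proj B} (h : MvN p.mat q.mat) : mk p = mk q := Quotient.sound h

theorem Proj.sum_congr {p p' q q' : Proj B} (h : MvN p.mat p'.mat) (h' : MvN q.mat q'.mat) :
    MvN (p.sum q).mat (p'.sum q').mat :=
  have hpq := isStarProjection_fromBlocks p.isProj q.isProj
  MvN.trans (p.sum q).isProj (p'.sum q').isProj (p.sum_mvN q).symm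
    (MvN.trans hpq (p'.sum q').isProj (MvN.fromBlocks h h') (p'.sum_mvN q'))

theorem Proj.sum_comm (p q : Proj B) : MvN (p.sum q).mat (q.sum p).mat := by
  have hpq := isStarProjection_fromBlocks p.isProj q.isProj
  refine MvN.trans (p.sum q).isProj (q.sum p).isProj (p.sum_mvN q).symm
    (MvN.trans hpq (q.sum p).isProj ?_ (q.sum_mvN p))
  have := MvN.submatrix hpq (Equiv.sumComm (Fin q.size) (Fin p.size))
  simpa [fromBlocks_submatrix_sum_swap_sum_swap] using this

theorem Proj.sum_zero (p : Proj B) : MvN (p.sum Proj.zero).mat p.mat := by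
  refine MvN.trans (p.sum _).isProj p.isProj (p.sum_mvN _).symm ?_
  refine ⟨fromCols p.mat 0, ?_, ?_⟩
  · have h : p.matᴴ = p.mat := p.isProj.isSelfAdjoint
    have h' : p.mat * p.mat = p.mat := p.isProj.isIdempotentElem
    ext i j
    rcases i with i | i
    · rcases j with j | j
      · simpa [conjTranspose_fromCols_eq_fromRows_conjTranspose, h] using congrFun₂ h' i j
      · exact j.elim0
    · exact i.elim0
  · have h : p.matᴴ = p.mat := p.isProj.isSelfAdjoint
    have h' : p.mat * p.mat = p.mat := p.isProj.isIdempotentElem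
    rw [conjTranspose_fromCols_eq_fromRows_conjTranspose, fromCols_mul_fromRows]
    simp [h, h']

theorem Proj.sum_assoc (p q r : Proj B) :
    MvN ((p.sum q).sum r).mat (p.sum (q.sum r)).mat := by
  have hpq := isStarProjection_fromBlocks p.isProj q.isProj
  have hqr := isStarProjection_fromBlocks q.isProj r.isProj
  have h1 : MvN ((p.sum q).sum r).mat (fromBlocks (fromBlocks p.mat 0 0 q.mat) 0 0 r.mat) :=
    MvN.trans (Proj.isProj _) (isStarProjection_fromBlocks hpq r.isProj)
      ((p.sum q).sum_mvN r).symm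
      (MvN.fromBlocks (p.sum_mvN q).symm (MvN.refl r.isProj))
  have h2 : MvN (fromBlocks p.mat 0 0 (fromBlocks q.mat 0 0 r.mat)) (p.sum (q.sum r)).mat :=
    MvN.trans (isStarProjection_fromBlocks p.isProj hqr) (Proj.isProj _)
      (MvN.fromBlocks (MvN.refl p.isProj) (q.sum_mvN r)) (p.sum_mvN (q.sum r))
  have h3 : MvN (fromBlocks (fromBlocks p.mat 0 0 q.mat) 0 0 r.mat)
      (fromBlocks p.mat 0 0 (fromBlocks q.mat 0 0 r.mat)) := by
    have := MvN.submatrix (isStarProjection_fromBlocks hpq r.isProj)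
      (Equiv.sumAssoc (Fin p.size) (Fin q.size) (Fin r.size)).symm
    convert this using 1
    ext i j
    rcases i with i | i | i <;> rcases j with j | j | j <;> rfl
  exact MvN.trans (Proj.isProj _) (Proj.isProj _) h1
    (MvN.trans (isStarProjection_fromBlocks hpq r.isProj) (Proj.isProj _) h3 h2)

instance : Add (ProjClass B) where
  add := Quotient.map₂ Proj.sum fun _ _ h _ _ h' => Proj.sum_congr h h'

instance : Zero (ProjClass B) where
  zero := ProjClass.mk Proj.zero

theorem ProjClass.mk_sum (p q : Proj B) : mk (p.sum q) = mk p + mk q := rfl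

theorem ProjClass.mk_zero : mk (Proj.zero : Proj B) = 0 := rfl

theorem ProjClass.ind {P : ProjClass B → Prop} (h : ∀ p, P (mk p)) (x : ProjClass B) : P x :=
  Quotient.ind h x

instance : AddCommMonoid (ProjClass B) where
  add_assoc a b c := by
    induction a using ProjClass.ind
    induction b using ProjClass.ind
    induction c using ProjClass.ind
    exact ProjClass.sound (Proj.sum_assoc _ _ _)
  add_comm a b := by
    induction a using ProjClass.ind
    induction b using ProjClass.ind
    exact ProjClass.sound (Proj.sum_comm _ _)
  zero_add a := by
    induction a using ProjClass.ind with | h p =>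
    exact (ProjClass.sound (Proj.sum_comm _ _)).trans (ProjClass.sound p.sum_zero)
  add_zero a := by
    induction a using ProjClass.ind with | h p =>
    exact ProjClass.sound p.sum_zero
  nsmul := nsmulRec

variable (B) in
/-- `K₀` of a unital C*-algebra: the Grothendieck group of `V(B)`. -/
abbrev K0 : Type _ := Algebra.GrothendieckAddGroup (ProjClass B)

/-- The class `[p]` in `K₀(B)` of a projection `p` over `B`. -/
def K0.cls (p : Proj B) : K0 B := Algebra.GrothendieckAddGroup.of (ProjClass.mk p)

theorem K0.cls_eq {p q : Proj B} (h : MvN p.mat q.mat) : K0.cls p = K0.cls q :=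
  congrArg Algebra.GrothendieckAddGroup.of (ProjClass.sound h)

theorem K0.cls_sum (p q : Proj B) : K0.cls (p.sum q) = K0.cls p + K0.cls q :=
  map_add Algebra.GrothendieckAddGroup.of (ProjClass.mk p) (ProjClass.mk q)

theorem K0.cls_zero : K0.cls (Proj.zero : Proj B) = 0 :=
  map_zero Algebra.GrothendieckAddGroup.of

/-- The universal property of `K₀(B)`: additive invariants of Murray–von Neumann equivalence
extend uniquely. -/
def K0.lift {G : Type*} [AddCommGroup G] (F : Proj B → G)
    (hF : ∀ p q : Proj B, MvN p.mat q.mat → F p = F q) (h0 : F Proj.zero = 0)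
    (hadd : ∀ p q, F (p.sum q) = F p + F q) : K0 B →+ G :=
  Algebra.GrothendieckAddGroup.lift
    { toFun := Quotient.lift F hF
      map_zero' := h0
      map_add' := fun a b => by
        induction a using ProjClass.ind
        induction b using ProjClass.ind
        exact hadd _ _ }

theorem K0.lift_cls {G : Type*} [AddCommGroup G] (F : Proj B → G)
    (hF : ∀ p q : Proj B, MvN p.mat q.mat → F p = F q) (h0 : F Proj.zero = 0)
    (hadd : ∀ p q, F (p.sum q) = F p + F q) (p : Proj B) :
    K0.lift F hF h0 hadd (K0.cls p) = F p :=
  DFunLike.congr_fun (Algebra.GrothendieckAddGroup.lift.symm_apply_apply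
    ({ toFun := Quotient.lift F hF
       map_zero' := h0
       map_add' := fun a b => by
        induction a using ProjClass.ind
        induction b using ProjClass.ind
        exact hadd _ _ } : ProjClass B →+ G)) (ProjClass.mk p)

/-- A projection of `B` as a `1 × 1` matrix. -/
def Proj.single (b : B) (hb : IsStarProjection b) : Proj B where
  size := 1
  mat := Matrix.of fun _ _ => b
  isProj := by
    refine ⟨?_, ?_⟩
    · ext i j
      simpa [Matrix.mul_apply] using hb.isIdempotentElem.eq
    · ext i j
      simpa [Matrix.star_apply] using hb.isSelfAdjoint.star_eq

/-- The homomorphism `K₀(B) → ℝ`, `[p] ↦ ∑ i, φ (p i i)`, induced by a bounded trace `φ`. -/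
def K0.ofTrace (φ : B →+ ℝ) (hφ : ∀ a b, φ (a * b) = φ (b * a)) : K0 B →+ ℝ :=
  K0.lift (fun p => ∑ i, φ (p.mat i i))
    (by
      rintro p q ⟨v, h1, h2⟩
      simp only [← h1, ← h2, Matrix.mul_apply, map_sum, conjTranspose_apply]
      rw [Finset.sum_comm]
      exact Finset.sum_congr rfl fun i _ => Finset.sum_congr rfl fun j _ => hφ _ _)
    (Finset.sum_empty (ι := Fin 0))
    (fun p q => by
      change ∑ i : Fin (p.size + q.size), φ (((fromBlocks p.mat 0 0 q.mat).submatrix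
        finSumFinEquiv.symm finSumFinEquiv.symm) i i) = _
      rw [← finSumFinEquiv.sum_comp, Fintype.sum_sum_type]
      simp only [submatrix_apply, Equiv.symm_apply_apply, fromBlocks_apply₁₁, fromBlocks_apply₂₂])

theorem K0.ofTrace_cls (φ : B →+ ℝ) (hφ : ∀ a b, φ (a * b) = φ (b * a)) (p : Proj B) :
    K0.ofTrace φ hφ (K0.cls p) = ∑ i, φ (p.mat i i) :=
  K0.lift_cls _ _ _ _ p

variable [Algebra ℂ B] {C : Type*} [Ring C] [StarRing C] [Algebra ℂ C]

/-- The image of a projection under a *-homomorphism, applied entrywise. -/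
def Proj.map (φ : B →⋆ₐ[ℂ] C) (p : Proj B) : Proj C where
  size := p.size
  mat := p.mat.map φ
  isProj := by
    have h : p.matᴴ = p.mat := p.isProj.isSelfAdjoint
    have h' : p.mat * p.mat = p.mat := p.isProj.isIdempotentElem
    refine ⟨?_, ?_⟩
    · rw [IsIdempotentElem, ← Matrix.map_mul, h']
    · rw [IsSelfAdjoint, star_eq_conjTranspose, ← Matrix.conjTranspose_map _ (map_star φ), h]

theorem MvN.map {ι κ : Type*} [Fintype ι] [Fintype κ] {p : Matrix ι ι B} {q : Matrix κ κ B}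
    (h : MvN p q) (φ : B →⋆ₐ[ℂ] C) : MvN (p.map φ) (q.map φ) := by
  obtain ⟨v, h1, h2⟩ := h
  refine ⟨v.map φ, ?_, ?_⟩
  · rw [← Matrix.conjTranspose_map _ (map_star φ), ← Matrix.map_mul, h1]
  · rw [← Matrix.conjTranspose_map _ (map_star φ), ← Matrix.map_mul, h2]

/-- Functoriality of `K₀` on unital *-homomorphisms. -/
def K0.map (φ : B →⋆ₐ[ℂ] C) : K0 B →+ K0 C :=
  K0.lift (fun p => K0.cls (p.map φ))
    (fun _ _ h => K0.cls_eq (h.map φ))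
    (by
      rw [← K0.cls_zero]
      refine congrArg K0.cls ?_
      simp only [Proj.map, Proj.zero, Proj.mk.injEq, heq_eq_eq, true_and]
      ext i
      exact i.elim0)
    (fun p q => by
      rw [← K0.cls_sum]
      refine congrArg K0.cls ?_
      simp only [Proj.map, Proj.sum, Proj.mk.injEq, heq_eq_eq, true_and]
      rw [← Matrix.submatrix_map, fromBlocks_map, Matrix.map_zero _ (map_zero φ),
        Matrix.map_zero _ (map_zero φ)]
      rfl)

theorem K0.map_cls (φ : B →⋆ₐ[ℂ] C) (p : Proj B) : K0.map φ (K0.cls p) = K0.cls (p.map φ) :=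
  K0.lift_cls _ _ _ _ p

end Unital

section NonUnital

variable (A : Type*) [NonUnitalCStarAlgebra A]

/-- The scalar quotient map `A⁺ → ℂ`, `z + a ↦ z`, of the unitization. -/
def scalarMap : Unitization ℂ A →⋆ₐ[ℂ] ℂ where
  __ := Unitization.fstHom ℂ A
  map_star' := fun _ => rfl

/-- `K₀` of a (not necessarily unital) C*-algebra: the kernel of `K₀(A⁺) → K₀(ℂ)`. -/
def K0NonUnital : AddSubgroup (K0 (Unitization ℂ A)) := (K0.map (scalarMap A)).ker

variable {A}

/-- The scalar part `s(p)` of a projection `p` over `A⁺`, again viewed over `A⁺`. -/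
def scalarPart (p : Proj (Unitization ℂ A)) : Proj (Unitization ℂ A) where
  size := p.size
  mat := p.mat.map fun z => Unitization.inl z.fst
  isProj := ((p.map (scalarMap A)).map (StarAlgHom.ofId ℂ (Unitization ℂ A))).isProj

/-- The class `[e] ∈ K₀(A)` of a projection `e` of `A`. -/
def K0NonUnital.ofProj (e : A) (he : IsStarProjection e) : K0NonUnital A :=
  ⟨K0.cls (Proj.single (e : Unitization ℂ A) (he.map (Unitization.inrNonUnitalStarAlgHom ℂ A))), by
    rw [K0NonUnital, AddMonoidHom.mem_ker, K0.map_cls, ← K0.cls_zero]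
    refine K0.cls_eq ⟨0, ?_, ?_⟩
    · rw [Matrix.mul_zero]
      ext i j
      exact (Unitization.fst_inr ℂ e).symm
    · ext i j
      exact i.elim0⟩

/-- For a trace `τ` on the positive cone of `A`, with values in `[0, ∞]`, `IsTraceOf τ x r` says
that `τ` assigns the number `r` to `x ∈ K₀(A)`: for some representation `x = [p] - [s(p)]`, the
self-adjoint matrix `p - s(p)` over `A` is a difference `c* c - d* d` of positive matrices of
finite trace and `r = τ(c* c) - τ(d* d)`, where `τ` is summed over the diagonal. -/
def IsTraceOf (τ : A → ℝ≥0∞) (x : K0NonUnital A) (r : ℝ) : Prop :=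
  ∃ (p : Proj (Unitization ℂ A)) (c d : Matrix (Fin p.size) (Fin p.size) A),
    (x : K0 (Unitization ℂ A)) = K0.cls p - K0.cls (scalarPart p) ∧
    (p.mat = p.mat.map (fun z => Unitization.inl z.fst) +
      (cᴴ * c - dᴴ * d).map (fun a => (a : Unitization ℂ A))) ∧
    ∑ i, τ ((cᴴ * c) i i) ≠ ∞ ∧ ∑ i, τ ((dᴴ * d) i i) ≠ ∞ ∧
    r = (∑ i, τ ((cᴴ * c) i i)).toReal - (∑ i, τ ((dᴴ * d) i i)).toReal

end NonUnital

end KTheory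

/-! ### The crossed product `C(X) ⋊ ℝⁿ` -/

namespace CrossedProduct

/-- The group `ℝⁿ`. -/
abbrev Euc (n : ℕ) : Type := EuclideanSpace ℝ (Fin n)

section General

variable (n : ℕ) (X : Type*) [TopologicalSpace X] [CompactSpace X] [AddAction (Euc n) X]
  [ContinuousVAdd (Euc n) X]

variable {n X} in
/-- The induced action on functions, `(λ_r g)(y) = g(-r + y)`. -/
def shift (r : Euc n) (g : C(X, ℂ)) : C(X, ℂ) :=
  g.comp ⟨fun y => -r +ᵥ y, continuous_const_vadd (-r)⟩

/-- A covariant representation of `(C(X), ℝⁿ)` on a Hilbert space: a unital *-representation of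
`C(X)` and a strongly continuous unitary representation of `ℝⁿ` with `U_r ρ(g) U_r* = ρ(λ_r g)`. -/
structure CovariantRep where
  /-- As `X` is second countable in all uses below, separable Hilbert spaces suffice to compute the
  universal norm, so that the lowest universe is no restriction. -/
  H : Type
  [normed : NormedAddCommGroup H]
  [inner : InnerProductSpace ℂ H]
  [complete : CompleteSpace H]
  ρ : C(X, ℂ) →⋆ₐ[ℂ] (H →L[ℂ] H)
  U : Euc n → H →ₗᵢ[ℂ] H
  U_zero : ∀ ξ, U 0 ξ = ξ
  U_add : ∀ r s ξ, U (r + s) ξ = U r (U s ξ)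
  U_cont : ∀ ξ, Continuous fun r => U r ξ
  covariant : ∀ r g ξ, U r (ρ g ξ) = ρ (shift r g) (U r ξ)

attribute [instance] CovariantRep.normed CovariantRep.inner CovariantRep.complete

variable {n X}

theorem CovariantRep.continuous_ρ (π : CovariantRep n X) : Continuous π.ρ :=
  AddMonoidHomClass.continuous_of_bound π.ρ 1 fun g => by
    simpa using NonUnitalStarAlgHom.norm_apply_le π.ρ g

theorem CovariantRep.norm_integrand_le (π : CovariantRep n X) (a : C_c(Euc n, C(X, ℂ))) (ξ : π.H)
    (s : Euc n) : ‖π.ρ (a s) (π.U s ξ)‖ ≤ ‖a s‖ * ‖ξ‖ :=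
  calc ‖π.ρ (a s) (π.U s ξ)‖ ≤ ‖π.ρ (a s)‖ * ‖π.U s ξ‖ := ContinuousLinearMap.le_opNorm _ _
    _ ≤ ‖a s‖ * ‖ξ‖ := by
      rw [LinearIsometry.norm_map]
      gcongr
      exact NonUnitalStarAlgHom.norm_apply_le π.ρ (a s)

theorem integrable_norm (a : C_c(Euc n, C(X, ℂ))) : Integrable fun s => ‖a s‖ :=
  a.continuous.norm.integrable_of_hasCompactSupport a.hasCompactSupport.norm

theorem CovariantRep.integrable (π : CovariantRep n X) (a : C_c(Euc n, C(X, ℂ))) (ξ : π.H) :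
    Integrable fun s => π.ρ (a s) (π.U s ξ) := by
  refine Continuous.integrable_of_hasCompactSupport
    ((π.continuous_ρ.comp a.continuous).clm_apply (π.U_cont ξ)) ?_
  refine a.hasCompactSupport.mono fun s hs => ?_
  contrapose! hs
  simp only [Function.mem_support, not_not] at hs ⊢
  simp [hs]

/-- The integrated form `(ρ ⋊ U)(a) = ∫ ρ(a(s)) U_s ds` of a covariant representation. -/
def CovariantRep.integrated (π : CovariantRep n X) (a : C_c(Euc n, C(X, ℂ))) :
    π.H →L[ℂ] π.H :=
  LinearMap.mkContinuous
    { toFun := fun ξ => ∫ s, π.ρ (a s) (π.U s ξ)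
      map_add' := fun ξ η => by
        simp only [map_add]
        exact integral_add (π.integrable a ξ) (π.integrable a η)
      map_smul' := fun c ξ => by
        simp only [map_smul, RingHom.id_apply]
        exact integral_smul _ _ }
    (∫ s, ‖a s‖) fun ξ => by
      change ‖∫ s, π.ρ (a s) (π.U s ξ)‖ ≤ _
      rw [← integral_mul_const]
      exact norm_integral_le_of_norm_le ((integrable_norm a).mul_const _)
        (.of_forall (π.norm_integrand_le a ξ))

variable (n X) in
/-- The C*-algebra of bounded families of operators, indexed by the covariant representations. -/
abbrev BoundedFamilies : Type _ := lp (fun π : CovariantRep n X => π.H →L[ℂ] π.H) ∞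

/-- The family of all integrated forms of `a ∈ C_c(ℝⁿ, C(X))`. -/
def universal (a : C_c(Euc n, C(X, ℂ))) : BoundedFamilies n X :=
  ⟨fun π => π.integrated a, memℓp_infty ⟨∫ s, ‖a s‖, by
    rintro _ ⟨π, rfl⟩
    exact LinearMap.mkContinuous_norm_le _ (integral_nonneg fun _ => norm_nonneg _) _⟩⟩

variable (n X) in
/-- The closed *-subalgebra of `BoundedFamilies n X` generated by the image of `C_c(ℝⁿ, C(X))`. -/
def universalClosure : NonUnitalStarSubalgebra ℂ (BoundedFamilies n X) :=
  (NonUnitalStarAlgebra.adjoin ℂ (Set.range (universal (n := n) (X := X)))).topologicalClosure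

variable (n X) in
/-- The crossed product C*-algebra `C(X) ⋊ ℝⁿ`: the completion of (the image of) `C_c(ℝⁿ, C(X))`
in the universal norm `‖a‖ = sup ‖(ρ ⋊ U)(a)‖` over all covariant representations. -/
def CStarCrossed : Type _ := universalClosure n X

instance : NonUnitalCStarAlgebra (CStarCrossed n X) :=
  haveI : IsClosed ((universalClosure n X : NonUnitalStarSubalgebra ℂ (BoundedFamilies n X)) :
      Set (BoundedFamilies n X)) := NonUnitalStarSubalgebra.isClosed_topologicalClosure _
  NonUnitalStarSubalgebra.nonUnitalCStarAlgebra (universalClosure n X)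

/-- The inclusion of `C(X) ⋊ ℝⁿ` in the bounded families. -/
def CStarCrossed.toFamily (a : CStarCrossed n X) : BoundedFamilies n X := a.1

/-- The element of `C(X) ⋊ ℝⁿ` given by `a ∈ C_c(ℝⁿ, C(X))`. -/
def ofCc (a : C_c(Euc n, C(X, ℂ))) : CStarCrossed n X :=
  ⟨universal a, NonUnitalStarSubalgebra.le_topologicalClosure _
    (NonUnitalStarAlgebra.subset_adjoin ℂ _ ⟨a, rfl⟩)⟩

/-! ### The regular representation along an orbit -/

variable (n) in
/-- The Hilbert space `L²(ℝⁿ)`. -/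
abbrev L2 : Type := Lp ℂ 2 (volume : Measure (Euc n))

/-- Multiplication by a bounded function on `L²(ℝⁿ)`. -/
def mulOp (h : Euc n → ℂ) (hh : MemLp h ∞ volume) : L2 n →L[ℂ] L2 n :=
  (ContinuousLinearMap.mul ℂ ℂ).holderL volume ∞ 2 2 (hh.toLp h)

theorem coeFn_mulOp (h : Euc n → ℂ) (hh : MemLp h ∞ volume) (ξ : L2 n) :
    mulOp h hh ξ =ᵐ[volume] fun t => h t * ξ t := by
  filter_upwards [(ContinuousLinearMap.mul ℂ ℂ).coeFn_holder (r := 2) (hh.toLp h) ξ,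
    hh.coeFn_toLp] with t h1 h2
  rw [← h2]
  exact h1

/-- Translation `(U_r ξ)(t) = ξ(t - r)` on `L²(ℝⁿ)`. -/
def translation (r : Euc n) : L2 n →ₗᵢ[ℂ] L2 n :=
  Lp.compMeasurePreservingₗᵢ ℂ (fun t => t - r) (measurePreserving_sub_right volume r)

theorem coeFn_translation (r : Euc n) (ξ : L2 n) :
    translation r ξ =ᵐ[volume] fun t => ξ (t - r) :=
  Lp.coeFn_compMeasurePreserving ξ (measurePreserving_sub_right volume r)

theorem continuous_orbit (g : C(X, ℂ)) (y : X) : Continuous fun t : Euc n => g (t +ᵥ y) :=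
  g.continuous.comp (continuous_id.vadd continuous_const)

theorem memLp_orbit (g : C(X, ℂ)) (y : X) :
    MemLp (fun t : Euc n => g (t +ᵥ y)) ∞ volume :=
  memLp_top_of_bound (continuous_orbit g y).aestronglyMeasurable ‖g‖
    (.of_forall fun _ => g.norm_coe_le_norm _)

theorem mulOp_ext {T : L2 n →L[ℂ] L2 n} (h : Euc n → ℂ) (hh : MemLp h ∞ volume)
    (H : ∀ ξ, T ξ =ᵐ[volume] fun t => h t * ξ t) : mulOp h hh = T :=
  ContinuousLinearMap.ext fun ξ => Lp.ext ((coeFn_mulOp h hh ξ).trans (H ξ).symm)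

/-- The regular representation along the orbit of `y`, on `L²(ℝⁿ)`:
`(ρ(g) ξ)(t) = g(t + y) ξ(t)` and `(U_r ξ)(t) = ξ(t - r)`. -/
def regularRep (y : X) : CovariantRep n X where
  H := L2 n
  ρ :=
    { toFun := fun g => mulOp (fun t => g (t +ᵥ y)) (memLp_orbit g y)
      map_one' := mulOp_ext _ _ fun ξ => .of_forall fun t => by simp
      map_mul' := fun g g' => mulOp_ext _ _ fun ξ => by
        filter_upwards [coeFn_mulOp _ (memLp_orbit g y) (mulOp _ (memLp_orbit g' y) ξ),
          coeFn_mulOp _ (memLp_orbit g' y) ξ] with t h1 h2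
        rw [mul_apply_eq_comp, h1, h2, ContinuousMap.mul_apply, mul_assoc]
      map_zero' := mulOp_ext _ _ fun ξ => by
        filter_upwards [Lp.coeFn_zero ℂ 2 (volume : Measure (Euc n))] with t h1
        exact h1.trans (by simp)
      map_add' := fun g g' => mulOp_ext _ _ fun ξ => by
        filter_upwards [coeFn_mulOp _ (memLp_orbit g y) ξ, coeFn_mulOp _ (memLp_orbit g' y) ξ,
          Lp.coeFn_add (mulOp _ (memLp_orbit g y) ξ) (mulOp _ (memLp_orbit g' y) ξ)] with t h1 h2 h3
        rw [_root_.add_apply, h3, Pi.add_apply, h1, h2, ContinuousMap.add_apply,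
          add_mul]
      commutes' := fun c => mulOp_ext _ _ fun ξ => by
        filter_upwards [Lp.coeFn_smul c ξ] with t h1
        simpa [Algebra.algebraMap_eq_smul_one] using h1
      map_star' := fun g => mulOp_ext _ _ fun ξ => by
        have key : mulOp _ (memLp_orbit (star g) y) =
            star (mulOp (n := n) _ (memLp_orbit g y)) := by
          rw [ContinuousLinearMap.star_eq_adjoint, ContinuousLinearMap.eq_adjoint_iff]
          intro ξ η
          rw [L2.inner_def, L2.inner_def]
          refine integral_congr_ae ?_
          filter_upwards [coeFn_mulOp _ (memLp_orbit (star g) y) ξ,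
            coeFn_mulOp _ (memLp_orbit g y) η] with t h1 h2
          rw [h1, h2]
          simp
          ring
        rw [← key]
        exact coeFn_mulOp _ _ ξ }
  U := translation
  U_zero := fun ξ => Lp.ext <| by
    simpa using coeFn_translation 0 ξ
  U_add := fun r s ξ => Lp.ext <| by
    have h := (measurePreserving_sub_right (volume : Measure (Euc n)) r).quasiMeasurePreserving
      |>.ae_eq_comp (coeFn_translation s ξ)
    filter_upwards [coeFn_translation (r + s) ξ, coeFn_translation r (translation s ξ), h]
      with t h1 h2 h3
    rw [h1, h2]
    simp only [Function.comp_apply] at h3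
    rw [h3, sub_sub]
  U_cont := fun ξ => by
    have hc : Continuous fun r : Euc n => (⟨fun t => t - r, by fun_prop⟩ : C(Euc n, Euc n)) :=
      ContinuousMap.continuous_of_continuous_uncurry _ (by
        change Continuous fun p : Euc n × Euc n => p.2 - p.1
        fun_prop)
    exact (continuous_const (y := ξ)).compMeasurePreservingLp hc
      (fun r => measurePreserving_sub_right volume r) (by simp)
  covariant := fun r g ξ => Lp.ext <| by
    have h := (measurePreserving_sub_right (volume : Measure (Euc n)) r).quasiMeasurePreserving
      |>.ae_eq_comp (coeFn_mulOp _ (memLp_orbit g y) ξ)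
    filter_upwards [coeFn_translation r (mulOp _ (memLp_orbit g y) ξ), h, coeFn_translation r ξ,
      coeFn_mulOp _ (memLp_orbit (shift r g) y) (translation r ξ)] with t h1 h2 h3 h4
    refine h1.trans (Eq.trans ?_ h4.symm)
    simp only [Function.comp_apply] at h2
    rw [h2, h3]
    simp [shift, vadd_vadd, sub_eq_neg_add]

/-- The operator on `L²(ℝⁿ)` by which an element of `C(X) ⋊ ℝⁿ` acts along the orbit of `y`. -/
def orbitOp (a : CStarCrossed n X) (y : X) : L2 n →L[ℂ] L2 n :=
  a.toFamily (regularRep y)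

/-- The trace `∑ ⟪b i, T (b i)⟫ ∈ [0, ∞]` of a positive operator, for a Hilbert basis `b`. -/
def posTrace {H : Type*} [NormedAddCommGroup H] [InnerProductSpace ℂ H] [CompleteSpace H]
    (T : H →L[ℂ] H) : ℝ≥0∞ :=
  ∑' i, ENNReal.ofReal (RCLike.re (inner ℂ ((exists_hilbertBasis ℂ H).choose_spec.choose i)
    (T ((exists_hilbertBasis ℂ H).choose_spec.choose i))))

variable (n) in
/-- The half-open unit cube `[0,1)ⁿ`. -/
def unitCube : Set (Euc n) := {t | ∀ i, t i ∈ Set.Ico (0 : ℝ) 1}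

variable (n) in
theorem memLp_cube : MemLp ((unitCube n).indicator fun _ => (1 : ℂ)) ∞ volume := by
  have hm : MeasurableSet (unitCube n) := by
    have : unitCube n = ⋂ i, (fun t : Euc n => t i) ⁻¹' Set.Ico (0 : ℝ) 1 := by
      ext t; simp [unitCube]
    rw [this]
    exact MeasurableSet.iInter fun i =>
      (by fun_prop : Continuous fun t : Euc n => t i).measurable measurableSet_Ico
  exact (memLp_top_const (1 : ℂ)).indicator hm

variable (n) in
/-- The orthogonal projection of `L²(ℝⁿ)` onto `L²([0,1)ⁿ)`. -/
def cubeProj : L2 n →L[ℂ] L2 n := mulOp _ (memLp_cube n)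

end General

/-! ### The suspension of a `ℤⁿ`-action -/

section Suspension

variable (n : ℕ)

/-- `ℤⁿ` acts on `ℝⁿ` by translations. -/
instance : AddAction (Fin n → ℤ) (Euc n) where
  vadd m t := WithLp.toLp 2 (fun i => (m i : ℝ)) + t
  zero_vadd t := by
    change WithLp.toLp 2 (fun i => (((0 : Fin n → ℤ) i : ℤ) : ℝ)) + t = t
    ext i
    simp
  add_vadd m m' t := by
    change WithLp.toLp 2 (fun i => (((m + m') i : ℤ) : ℝ)) + t =
      WithLp.toLp 2 (fun i => (m i : ℝ)) + (WithLp.toLp 2 (fun i => (m' i : ℝ)) + t)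
    ext i
    simp [add_assoc]

variable {n} in
theorem int_vadd_def (m : Fin n → ℤ) (t : Euc n) :
    m +ᵥ t = WithLp.toLp 2 (fun i => (m i : ℝ)) + t := rfl

instance : ContinuousConstVAdd (Fin n → ℤ) (Euc n) :=
  ⟨fun m => by simp only [int_vadd_def]; fun_prop⟩

variable (S : Type*) [TopologicalSpace S] [AddAction (Fin n → ℤ) S]

/-- The suspension `Σ ×_{ℤⁿ} ℝⁿ`: the quotient of `Σ × ℝⁿ` by the diagonal action of `ℤⁿ`. -/
def Suspension : Type _ := AddAction.orbitRel.Quotient (Fin n → ℤ) (S × Euc n)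

instance : TopologicalSpace (Suspension n S) :=
  inferInstanceAs (TopologicalSpace (Quotient _))

variable {n S}

/-- The point `[x, t]` of the suspension. -/
def Suspension.mk (x : S) (t : Euc n) : Suspension n S := Quotient.mk _ (x, t)

theorem Suspension.continuous_mk : Continuous fun p : S × Euc n => Suspension.mk p.1 p.2 :=
  continuous_quotient_mk'

theorem Suspension.mk_vadd (m : Fin n → ℤ) (x : S) (t : Euc n) :
    Suspension.mk (m +ᵥ x) (m +ᵥ t) = Suspension.mk x t :=
  Quotient.sound ⟨m, rfl⟩

theorem Suspension.exists_mk (y : Suspension n S) : ∃ x t, t ∈ unitCube n ∧ mk x t = y := by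
  induction y using Quotient.inductionOn with | h p =>
  obtain ⟨x, t⟩ := p
  refine ⟨(fun i => -⌊t i⌋) +ᵥ x, (fun i => -⌊t i⌋ : Fin n → ℤ) +ᵥ t, fun i => ?_, mk_vadd _ _ _⟩
  have : ((fun i => -⌊t i⌋ : Fin n → ℤ) +ᵥ t) i = Int.fract (t i) := by
    rw [int_vadd_def, PiLp.add_apply, Int.fract]
    push_cast
    ring
  rw [this]
  exact ⟨Int.fract_nonneg _, Int.fract_lt_one _⟩

instance [CompactSpace S] : CompactSpace (Suspension n S) := by
  have hK : IsCompact {t : Euc n | ∀ i, t i ∈ Set.Icc (0 : ℝ) 1} := by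
    have : {t : Euc n | ∀ i, t i ∈ Set.Icc (0 : ℝ) 1} =
        (EuclideanSpace.equiv (Fin n) ℝ).toHomeomorph ⁻¹' (Set.univ.pi fun _ => Set.Icc 0 1) := by
      ext t
      exact ⟨fun h i _ => h i, fun h i => h i trivial⟩
    rw [this, Homeomorph.isCompact_preimage]
    exact isCompact_univ_pi fun _ => isCompact_Icc
  refine ⟨?_⟩
  convert ((isCompact_univ (X := S)).prod hK).image Suspension.continuous_mk
  refine (Set.eq_univ_of_forall fun y => ?_).symm
  obtain ⟨x, t, ht, rfl⟩ := y.exists_mk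
  exact ⟨(x, t), ⟨trivial, fun i => Set.Ico_subset_Icc_self (ht i)⟩, rfl⟩

/-- The action of `ℝⁿ` on the suspension, `v + [x, t] = [x, t + v]`. -/
instance : AddAction (Euc n) (Suspension n S) where
  vadd v := Quotient.map (fun p => (p.1, p.2 + v)) (by
    rintro _ ⟨x, t⟩ ⟨m, rfl⟩
    exact ⟨m, Prod.ext rfl (by simp [int_vadd_def, add_assoc])⟩)
  zero_vadd y := by
    induction y using Quotient.inductionOn with | h p =>
    exact congrArg (Quotient.mk _) (Prod.ext rfl (add_zero _))
  add_vadd v w y := by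
    induction y using Quotient.inductionOn with | h p =>
    exact congrArg (Quotient.mk _) (Prod.ext rfl (by
      change p.2 + (v + w) = p.2 + w + v
      abel))

theorem Suspension.vadd_mk (v : Euc n) (x : S) (t : Euc n) : v +ᵥ mk x t = mk x (t + v) := rfl

instance [ContinuousConstVAdd (Fin n → ℤ) S] : ContinuousVAdd (Euc n) (Suspension n S) where
  continuous_vadd := by
    have hq : IsOpenQuotientMap fun p : S × Euc n => Suspension.mk p.1 p.2 :=
      AddAction.isOpenQuotientMap_quotientMk
    have := (IsOpenQuotientMap.id (X := Euc n)).prodMap hq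
    rw [this.isQuotientMap.continuous_iff]
    change Continuous fun p : Euc n × (S × Euc n) => Suspension.mk p.2.1 (p.2.2 + p.1)
    exact Suspension.continuous_mk.comp (by fun_prop : Continuous fun p : Euc n × (S × Euc n) =>
      (p.2.1, p.2.2 + p.1))

variable [CompactSpace S] [ContinuousConstVAdd (Fin n → ℤ) S] [MeasurableSpace S]

/-- The trace `τ̃_μ` on positive elements `a` of `C(X) ⋊ ℝⁿ`, `X` the suspension of `Σ`, defined by
the transverse measure `μ`: the integral over `x ∈ Σ` of the local trace of `a`, along the orbit
of `[x, 0]`, on the unit cube. If the positive element `a` is given by a function in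
`C_c(ℝⁿ, C(X))`, this is `∫_Σ ∫_{[0,1]ⁿ} a([x, t], 0) dt dμ(x)`. -/
def suspensionTrace (μ : Measure S) (a : CStarCrossed n (Suspension n S)) : ℝ≥0∞ :=
  ∫⁻ x, posTrace (cubeProj n * orbitOp a (Suspension.mk x 0) * cubeProj n) ∂μ

end Suspension

end CrossedProduct

/-! ### K-theory of `C(Σ)` -/

namespace KTheory

variable {S : Type*} [TopologicalSpace S] [CompactSpace S]

/-- The characteristic function of a clopen set. -/
def clopenIndicator (U : TopologicalSpace.Clopens S) : C(S, ℂ) where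
  toFun := (U : Set S).indicator fun _ => 1
  continuous_toFun := continuous_const.indicator fun x hx => by
    simp [U.isClopen.frontier_eq] at hx

theorem isStarProjection_clopenIndicator (U : TopologicalSpace.Clopens S) :
    IsStarProjection (clopenIndicator U) := by
  refine ⟨?_, ?_⟩
  · ext x
    by_cases hx : x ∈ (U : Set S) <;> simp [clopenIndicator, hx]
  · ext x
    by_cases hx : x ∈ (U : Set S) <;> simp [clopenIndicator, hx]

/-- The class `[χ_U] ∈ K₀(C(Σ))` of a clopen set `U`. -/
def K0.clopen (U : TopologicalSpace.Clopens S) : K0 C(S, ℂ) :=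
  K0.cls (Proj.single (clopenIndicator U) (isStarProjection_clopenIndicator U))

variable [MeasurableSpace S] [OpensMeasurableSpace S]

/-- The homomorphism `K₀(C(Σ)) → ℝ` induced by the trace `g ↦ ∫ g dμ` on `C(Σ)`. -/
def K0.ofMeasure (μ : Measure S) [IsFiniteMeasure μ] : K0 C(S, ℂ) →+ ℝ :=
  K0.ofTrace
    { toFun := fun g => (∫ x, g x ∂μ).re
      map_zero' := by simp
      map_add' := fun g h => by
        simp only [ContinuousMap.add_apply]
        rw [integral_add (g.continuous.integrable_of_hasCompactSupport
          (HasCompactSupport.of_compactSpace _)) (h.continuous.integrable_of_hasCompactSupport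
          (HasCompactSupport.of_compactSpace _)), Complex.add_re] }
    fun a b => by rw [mul_comm]

end KTheory

end

noncomputable section

/-! ### Perturbation of projections in C*-algebras -/

namespace CStarAlgebra

variable {D : Type*} [CStarAlgebra D]

/-! The formula for `e_U` extends from characteristic functions to all `g ∈ C(Σ)`. Along the orbit
of `[x, 0]` the resulting `e_g` acts on `L²(ℝⁿ)` as `∑ₖ g(-k + x) ⟨fₖ, ·⟩ fₖ`, where `fₖ(t) = f(t -
c - k)`, `k ∈ ℤⁿ`. The support of `f` is so small that the `fₖ` have disjoint supports, and `∫ f² =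
1` makes them orthonormal. Hence `g ↦ e_g` is a *-homomorphism (`bumpHom`), each `e_U` is a
projection, and `α` is the induced map on `K₀`.

Uniqueness of `α`, and `τ̃ ∘ α = μ` once it is known on clopen sets, follow because the clopen
classes generate `K₀(C(Σ))`: a projection over `C(Σ)` is equivalent to a nearby locally constant
one, which can be diagonalized fibrewise (`K0.exists_cls_eq_sum_clopen`).

The trace `τ̃` of `c* c` is an integral over `Σ` of Hilbert–Schmidt norms of `c` restricted to the
unit cube. Splitting these norms over the integer translates of the cube and using invariance of `μ`
gives `τ̃(c* c) = τ̃(c c*)` (`suspensionTrace_mul_star_self`). For `e_U` the kernel on the cube has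
rank at most one, and its norm integrates to `μ(U)`.

As `τ̃` is unbounded, its passage to `K₀` needs an argument. The elements with `τ̃(c* c) < ∞` form a
dense ideal `n`; call a matrix over the unitization smooth if its non-scalar part has entries in the
span of `n* n`. Every projection is equivalent to a smooth one (`exists_smooth_mvN`), and equivalent
smooth projections have the same trace (`matTrace_eq_of_mvN`), because the equivalence can be
replaced by a factorization `p = AB`, `q = BA` through smooth matrices. This yields the homomorphism
`k0`, and `isTraceOf_iff` identifies it with the value computed from any admissible representation.
-/

theorem norm_two_mul_sub_one_le {q : D} (hq : IsStarProjection q) : ‖2 * q - 1‖ ≤ 1 := by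
  have h : star (2 * q - 1) * (2 * q - 1) = 1 := by
    have h1 : star q = q := hq.isSelfAdjoint
    have h2 : q * q = q := hq.isIdempotentElem
    have h3 : star (2 * q - 1) = 2 * q - 1 := by
      rw [two_mul, star_sub, star_add, h1, star_one]
    rw [h3, two_mul]
    simp only [sub_mul, mul_sub, add_mul, mul_add, h2, one_mul, mul_one]
    abel
  have h' := CStarRing.norm_star_mul_self (x := 2 * q - 1)
  rw [h] at h'
  nontriviality D
  rw [CStarRing.norm_one] at h'
  nlinarith [norm_nonneg (2 * q - 1)]

/-- The polar decomposition of an invertible element. -/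
theorem exists_polar {z : D} (hz : IsUnit z) : ∃ k : D, star (z * k) * (z * k) = 1 ∧
    z * k * star (z * k) = 1 ∧ ∀ p, Commute (star z * z) p → Commute k p := by
  set h : D := star z * z with hh
  have hsa : IsSelfAdjoint h := IsSelfAdjoint.star_mul_self z
  have hu : IsUnit h := hz.star.mul hz
  have hpos : ∀ t ∈ spectrum ℝ h, 0 < t := fun t ht =>
    lt_of_le_of_ne (spectrum_star_mul_self_nonneg t ht) fun h0 =>
      spectrum.zero_notMem ℝ hu (h0 ▸ ht)
  have hcont : ContinuousOn (fun t : ℝ => (√t)⁻¹) (spectrum ℝ h) := by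
    refine ContinuousOn.inv₀ (by fun_prop) fun t ht => ?_
    exact (Real.sqrt_pos.2 (hpos t ht)).ne'
  -- This is `(z* z)^(-1/2)`; the spectrum of `z* z` is strictly positive because `z` is invertible.
  set k : D := cfc (fun t : ℝ => (√t)⁻¹) h with hk
  have hksa : star k = k := (cfc_predicate (fun t : ℝ => (√t)⁻¹) h : IsSelfAdjoint k)
  have hkhk : k * h * k = 1 := by
    have : h = cfc (fun t : ℝ => t) h := (cfc_id' ℝ h).symm
    conv_lhs => rw [this]
    rw [hk, ← cfc_mul _ _ h hcont (by fun_prop),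
      ← cfc_mul (fun t : ℝ => (√t)⁻¹ * t) _ h (hcont.mul (by fun_prop)) hcont,
      ← cfc_one ℝ h]
    refine cfc_congr fun t ht => ?_
    have := hpos t ht
    have h2 := Real.sqrt_pos.2 this
    have h3 := Real.mul_self_sqrt this.le
    simp only [Pi.one_apply]
    field_simp
    nlinarith
  have h1 : star (z * k) * (z * k) = 1 := by
    rw [star_mul, hksa, ← hkhk, hh]
    simp only [mul_assoc]
  have hcomm : ∀ p, Commute h p → Commute k p := fun p hp => by
    exact hp.cfc_real _
  have hku : IsUnit k := by
    have hc : Commute k h := (hcomm h (Commute.refl h))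
    exact ⟨⟨k, h * k, by rw [← mul_assoc, hkhk], by rw [← hc.eq, hkhk]⟩, rfl⟩
  have hzk : IsUnit (z * k) := hz.mul hku
  refine ⟨k, h1, ?_, hcomm⟩
  -- An invertible isometry is unitary: its adjoint, being a left inverse, is the inverse.
  obtain ⟨u, hu'⟩ := hzk
  rw [← hu'] at h1 ⊢
  have : star (u : D) = (↑u⁻¹ : D) := by
    rw [← mul_one (star (u : D)), ← u.mul_inv, ← mul_assoc, h1, one_mul]
  rw [this, u.mul_inv]

/-- Projections at distance less than one are Murray–von Neumann equivalent. -/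
theorem exists_partialIsometry_of_norm_sub_lt_one {p q : D} (hp : IsStarProjection p)
    (hq : IsStarProjection q) (h : ‖p - q‖ < 1) : ∃ v : D, star v * v = p ∧ v * star v = q := by
  have hp1 : star p = p := hp.isSelfAdjoint
  have hp2 : p * p = p := hp.isIdempotentElem
  have hq1 : star q = q := hq.isSelfAdjoint
  have hq2 : q * q = q := hq.isIdempotentElem
  -- This element intertwines `p` and `q`, and `1 - z = (2q - 1)(q - p)` has norm below one, so `z`
  -- is invertible. Its unitary polar part conjugates `p` to `q`, since `z* z` commutes with `p`.
  set z : D := q * p + (1 - q) * (1 - p) with hz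
  have hz1 : 1 - z = (2 * q - 1) * (q - p) := by
    rw [hz, two_mul]
    simp only [sub_mul, mul_sub, add_mul, hq2, one_mul, mul_one]
    abel
  have hzu : IsUnit z := by
    have : ‖1 - z‖ < 1 := by
      rw [hz1]
      calc _ ≤ ‖2 * q - 1‖ * ‖q - p‖ := norm_mul_le _ _
        _ ≤ 1 * ‖q - p‖ := by gcongr; exact norm_two_mul_sub_one_le hq
        _ < 1 := by rwa [one_mul, norm_sub_rev]
    simpa using isUnit_one_sub_of_norm_lt_one this
  have hzp : z * p = q * z := by
    rw [hz]
    simp only [sub_mul, mul_sub, add_mul, mul_add, one_mul, mul_one, mul_assoc, hp2]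
    simp only [← mul_assoc, hq2]
    abel
  have hcomm : Commute (star z * z) p := by
    have h1 : p * star z = star z * q := by
      have := congrArg star hzp
      rwa [star_mul, star_mul, hp1, hq1] at this
    rw [commute_iff_eq, mul_assoc, hzp, ← mul_assoc, ← h1, mul_assoc]
  obtain ⟨k, hk1, hk2, hk3⟩ := exists_polar hzu
  have hkp : k * p = p * k := hk3 p hcomm
  have huq : z * k * p = q * (z * k) := by
    rw [mul_assoc, hkp, ← mul_assoc, hzp, mul_assoc]
  refine ⟨z * k * p, ?_, ?_⟩
  · calc star (z * k * p) * (z * k * p) = p * (star (z * k) * (z * k)) * p := by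
          rw [star_mul _ p, hp1]; simp only [mul_assoc]
      _ = p := by rw [hk1, mul_one, hp2]
  · rw [huq]
    calc q * (z * k) * star (q * (z * k)) = q * (z * k * star (z * k)) * q := by
          rw [star_mul q, hq1]; simp only [mul_assoc]
      _ = q := by rw [hk2, mul_one, hq2]

/-- An almost idempotent self-adjoint element is close to a projection, from which it differs by a
multiple of its defect. -/
theorem exists_isStarProjection_of_norm_sq_sub_lt {x : D} (hx : IsSelfAdjoint x)
    (h : ‖x * x - x‖ < 2 / 9) :
    ∃ q g : D, IsStarProjection q ∧ ‖q - x‖ ≤ 1 / 3 ∧ q = x + (x * x - x) * g := by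
  have hid : cfc (fun t : ℝ => t) x = x := cfc_id' ℝ x
  have hsq : cfc (fun t : ℝ => t * t - t) x = x * x - x := by
    rw [cfc_sub _ _ x, cfc_mul _ _ x, hid]
  have hspec : ∀ t ∈ spectrum ℝ x, |t * t - t| < 2 / 9 := fun t ht =>
    lt_of_le_of_lt ((norm_cfc_le_iff (fun t : ℝ => t * t - t) x (norm_nonneg _)).1
      (by rw [hsq]) t ht) h
  -- The constant `2/9` is the value of `t - t²` at `1/3` and at `2/3`, so the spectrum stays away
  -- from the open middle third.
  have hdich : ∀ t ∈ spectrum ℝ x, |t| ≤ 1 / 3 ∨ |t - 1| ≤ 1 / 3 := fun t ht => by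
    have := abs_lt.1 (hspec t ht)
    rcases le_total t (1 / 2) with h | h
    · left; rw [abs_le]; constructor <;> nlinarith
    · right; rw [abs_le]; constructor <;> nlinarith
  set χ : ℝ → ℝ := fun t => if t ≤ 1 / 2 then 0 else 1 with hχ
  -- On the spectrum this is `(χ(t) - t) / (t² - t)` with the removable singularities at `0` and `1`
  -- filled in.
  set γ : ℝ → ℝ := fun t => if t ≤ 1 / 2 then -(t - 1)⁻¹ else -t⁻¹ with hγ
  have hne : ∀ t ∈ spectrum ℝ x, t ≠ 1 / 2 := fun t ht h0 => by
    rcases hdich t ht with h | h <;> rw [h0, abs_le] at h <;> norm_num at h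
  have hχc : ContinuousOn χ (spectrum ℝ x) := by
    refine continuousOn_of_forall_continuousAt fun t ht => ?_
    rcases lt_or_gt_of_ne (hne t ht) with h | h
    · refine (continuousAt_const (y := (0 : ℝ))).congr ?_
      filter_upwards [Iio_mem_nhds h] with s hs
      simp only [hχ, if_pos (le_of_lt (Set.mem_Iio.1 hs))]
    · refine (continuousAt_const (y := (1 : ℝ))).congr ?_
      filter_upwards [Ioi_mem_nhds h] with s hs
      simp only [hχ, if_neg (not_le.2 (Set.mem_Ioi.1 hs))]
  have hγc : ContinuousOn γ (spectrum ℝ x) := by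
    refine continuousOn_of_forall_continuousAt fun t ht => ?_
    rcases lt_or_gt_of_ne (hne t ht) with h | h
    · have : ContinuousAt (fun t : ℝ => -(t - 1)⁻¹) t := by
        refine ContinuousAt.neg (ContinuousAt.inv₀ (by fun_prop) ?_)
        linarith
      refine this.congr ?_
      filter_upwards [Iio_mem_nhds h] with s hs
      simp only [hγ, if_pos (le_of_lt (Set.mem_Iio.1 hs))]
    · have : ContinuousAt (fun t : ℝ => -t⁻¹) t := by
        refine ContinuousAt.neg (ContinuousAt.inv₀ (by fun_prop) ?_)
        linarith
      refine this.congr ?_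
      filter_upwards [Ioi_mem_nhds h] with s hs
      simp only [hγ, if_neg (not_le.2 (Set.mem_Ioi.1 hs))]
  refine ⟨cfc χ x, cfc γ x, ⟨?_, cfc_predicate χ x⟩, ?_, ?_⟩
  · rw [IsIdempotentElem, ← cfc_mul _ _ x hχc hχc]
    refine cfc_congr fun t _ => ?_
    simp only [hχ]
    split_ifs <;> simp
  · nth_rw 2 [← hid]
    rw [← cfc_sub _ _ x hχc (by fun_prop)]
    refine norm_cfc_le (by norm_num) fun t ht => ?_
    rw [Real.norm_eq_abs]
    simp only [hχ]
    split_ifs with h2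
    · rcases hdich t ht with h | h
      · rwa [zero_sub, abs_neg]
      · rw [abs_le] at h; linarith
    · rcases hdich t ht with h | h
      · rw [abs_le] at h; linarith
      · rwa [abs_sub_comm]
  · nth_rw 2 [← hid]
    rw [← hsq, ← cfc_mul _ _ x (by fun_prop) hγc,
      ← cfc_add x (fun t : ℝ => t) (fun t => (t * t - t) * γ t) (by fun_prop)
        (ContinuousOn.mul (by fun_prop) hγc)]
    refine cfc_congr fun t ht => ?_
    simp only [hχ, hγ]
    split_ifs with h2
    · have : t - 1 ≠ 0 := by linarith
      field_simp
      ring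
    · have : t ≠ 0 := by linarith
      field_simp
      ring

/-- `IsTraceOf` admits only a single square `cᴴ * c` on each side. Sums of squares collapse to one
because the positive elements form a cone. -/
theorem exists_star_mul_self_eq_sum {D κ : Type*} [NonUnitalCStarAlgebra D] (s : Finset κ)
    (z : κ → D) : ∃ c : D, star c * c = ∑ k ∈ s, star (z k) * z k := by
  let _ := CStarAlgebra.spectralOrder D
  have := CStarAlgebra.spectralOrderedRing D
  have h : 0 ≤ ∑ k ∈ s, star (z k) * z k := Finset.sum_nonneg fun k _ => star_mul_self_nonneg _
  obtain ⟨c, hc⟩ := CStarAlgebra.nonneg_iff_eq_star_mul_self.1 h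
  exact ⟨c, hc.symm⟩

end CStarAlgebra

/-! ### Projections in matrix algebras -/

namespace KTheory

open Filter Topology

section Matrix

variable {ι : Type*} [Fintype ι] {B : Type*} [CStarAlgebra B]

theorem isStarProjection_ofMatrix_iff {p : Matrix ι ι B} :
    IsStarProjection (CStarMatrix.ofMatrix p) ↔ IsStarProjection p :=
  ⟨fun h => ⟨h.1, h.2⟩, fun h => ⟨h.1, h.2⟩⟩

variable [DecidableEq ι]

/-- Matrices carry the product topology here. The map to `CStarMatrix` is continuous, so the norm
estimate required by the C*-algebra lemma holds near `p`. -/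
theorem eventually_mvN {p : Matrix ι ι B} (hp : IsStarProjection p) :
    ∀ᶠ q in 𝓝 p, IsStarProjection q → MvN p q := by
  let _ := CStarAlgebra.spectralOrder B
  have := CStarAlgebra.spectralOrderedRing B
  let φ : Matrix ι ι B → CStarMatrix ι ι B := CStarMatrix.ofMatrix
  have hφ : Continuous φ := CStarMatrix.ofMatrixL.continuous
  have h1 : ∀ᶠ q in 𝓝 p, ‖φ p - φ q‖ < 1 := by
    refine ContinuousAt.eventually_lt (by fun_prop) (by fun_prop) ?_
    simp
  filter_upwards [h1] with q hq hqp
  obtain ⟨v, h, h'⟩ := CStarAlgebra.exists_partialIsometry_of_norm_sub_lt_one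
    (isStarProjection_ofMatrix_iff.2 hp) (isStarProjection_ofMatrix_iff.2 hqp) hq
  exact ⟨CStarMatrix.ofMatrix.symm v, h, h'⟩

/-- The distances `1/2` from `p` to `x` and `1/3` from `x` to `q` add up to less than one. The
explicit correction `(x * x - x) * g` shows that `q - x` lies in every two-sided ideal that contains
the defect of `x`. -/
theorem eventually_exists_mvN {p : Matrix ι ι B} (hp : IsStarProjection p) :
    ∀ᶠ x in 𝓝 p, IsSelfAdjoint x → ∃ q g : Matrix ι ι B, IsStarProjection q ∧ MvN p q ∧
      q = x + (x * x - x) * g := by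
  let _ := CStarAlgebra.spectralOrder B
  have := CStarAlgebra.spectralOrderedRing B
  let φ : Matrix ι ι B → CStarMatrix ι ι B := CStarMatrix.ofMatrix
  have hφ : Continuous φ := CStarMatrix.ofMatrixL.continuous
  have h1 : ∀ᶠ x in 𝓝 p, ‖φ p - φ x‖ < 1 / 2 := by
    refine ContinuousAt.eventually_lt (by fun_prop) (by fun_prop) ?_
    simp
  have h2 : ∀ᶠ x in 𝓝 p, ‖φ x * φ x - φ x‖ < 2 / 9 := by
    refine ContinuousAt.eventually_lt (by fun_prop) (by fun_prop) ?_
    have : φ p * φ p = φ p := hp.isIdempotentElem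
    rw [this]
    simp
  filter_upwards [h1, h2] with x hx hx' hsa
  obtain ⟨q, g, hq, hqx, hqg⟩ := CStarAlgebra.exists_isStarProjection_of_norm_sq_sub_lt
    (x := φ x) hsa hx'
  have hpq : ‖φ p - q‖ < 1 := by
    calc ‖φ p - q‖ = ‖(φ p - φ x) - (q - φ x)‖ := by congr 1; abel
      _ ≤ ‖φ p - φ x‖ + ‖q - φ x‖ := norm_sub_le _ _
      _ < 1 := by linarith
  obtain ⟨v, h, h'⟩ := CStarAlgebra.exists_partialIsometry_of_norm_sub_lt_one
    (isStarProjection_ofMatrix_iff.2 hp) hq hpq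
  exact ⟨CStarMatrix.ofMatrix.symm q, CStarMatrix.ofMatrix.symm g,
    isStarProjection_ofMatrix_iff.1 hq, ⟨CStarMatrix.ofMatrix.symm v, h, h'⟩, hqg⟩

theorem eventually_isUnit : ∀ᶠ y in 𝓝 (1 : Matrix ι ι B), IsUnit y := by
  let _ := CStarAlgebra.spectralOrder B
  have := CStarAlgebra.spectralOrderedRing B
  let φ : Matrix ι ι B → CStarMatrix ι ι B := CStarMatrix.ofMatrix
  have hφ : Continuous φ := CStarMatrix.ofMatrixL.continuous
  have h1 : ∀ᶠ y in 𝓝 (1 : Matrix ι ι B), IsUnit (φ y) :=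
    hφ.continuousAt.eventually (Units.isOpen.mem_nhds (isUnit_one : IsUnit (1 : CStarMatrix ι ι B)))
  filter_upwards [h1] with y hy
  obtain ⟨u, hu⟩ := hy
  have h2 := u.mul_inv
  have h3 := u.inv_mul
  rw [hu] at h2 h3
  exact ⟨⟨y, CStarMatrix.ofMatrix.symm ↑u⁻¹, h2, h3⟩, rfl⟩

end Matrix

theorem exists_sum_conjTranspose_mul_self {ι κ : Type*} [Fintype ι] {A : Type*}
    [NonUnitalCStarAlgebra A] (s : Finset κ) (z : κ → Matrix ι ι A) :
    ∃ c : Matrix ι ι A, cᴴ * c = ∑ k ∈ s, (z k)ᴴ * z k := by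
  let _ := CStarAlgebra.spectralOrder A
  have := CStarAlgebra.spectralOrderedRing A
  obtain ⟨c, hc⟩ := CStarAlgebra.exists_star_mul_self_eq_sum s
    fun k => CStarMatrix.ofMatrix (z k)
  exact ⟨CStarMatrix.ofMatrix.symm c, hc⟩

end KTheory

end

noncomputable section

/-! ### Densely defined traces and `K₀` -/

namespace KTheory

open Filter Topology

variable {A : Type*} [NonUnitalCStarAlgebra A]

/-- A densely defined trace: the square-summable elements form a dense two-sided ideal `n`, and
`L` is a linear functional that extends the trace from the positive elements `c* c` with
`c ∈ n`. -/
structure DenseTrace (τ : A → ℝ≥0∞) where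
  n : Submodule ℂ A
  mem_n : ∀ c, c ∈ n ↔ τ (star c * c) ≠ ∞
  mul_mem : ∀ a, ∀ c ∈ n, a * c ∈ n
  star_mem : ∀ c ∈ n, star c ∈ n
  dense : Dense (n : Set A)
  L : A →ₗ[ℂ] ℂ
  L_star_mul_self : ∀ c ∈ n, L (star c * c) = ((τ (star c * c)).toReal : ℂ)
  trace : ∀ c, τ (star c * c) = τ (c * star c)
  sum : ∀ (k : ℕ) (c : Fin k → A), τ (∑ j, star (c j) * c j) = ∑ j, τ (star (c j) * c j)

namespace DenseTrace

variable {τ : A → ℝ≥0∞} (T : DenseTrace τ)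

theorem mul_mem' {c : A} (hc : c ∈ T.n) (a : A) : c * a ∈ T.n := by
  have := T.star_mem _ (T.mul_mem (star a) _ (T.star_mem _ hc))
  rwa [star_mul, star_star, star_star] at this

/-- The ideal of definition of the trace. -/
def ideal : Submodule ℂ A := Submodule.span ℂ {x | ∃ y ∈ T.n, ∃ z ∈ T.n, x = star y * z}

theorem star_mul_mem_ideal {y z : A} (hy : y ∈ T.n) (hz : z ∈ T.n) : star y * z ∈ T.ideal :=
  Submodule.subset_span ⟨y, hy, z, hz, rfl⟩

theorem ideal_mul_left (a : A) {x : A} (hx : x ∈ T.ideal) : a * x ∈ T.ideal := by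
  induction hx using Submodule.span_induction with
  | mem x h =>
    obtain ⟨y, hy, z, hz, rfl⟩ := h
    have := T.star_mul_mem_ideal (T.mul_mem' hy (star a)) hz
    rwa [star_mul, star_star, mul_assoc] at this
  | zero => rw [mul_zero]; exact zero_mem _
  | add x y _ _ hx hy => rw [mul_add]; exact add_mem hx hy
  | smul c x _ hx => rw [mul_smul_comm]; exact Submodule.smul_mem _ _ hx

theorem star_mem_ideal {x : A} (hx : x ∈ T.ideal) : star x ∈ T.ideal := by
  induction hx using Submodule.span_induction with
  | mem x h =>
    obtain ⟨y, hy, z, hz, rfl⟩ := h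
    rw [star_mul, star_star]
    exact T.star_mul_mem_ideal hz hy
  | zero => rw [star_zero]; exact zero_mem _
  | add x y _ _ hx hy => rw [star_add]; exact add_mem hx hy
  | smul c x _ hx => rw [star_smul]; exact Submodule.smul_mem _ _ hx

theorem ideal_mul_right {x : A} (hx : x ∈ T.ideal) (a : A) : x * a ∈ T.ideal := by
  have := T.star_mem_ideal (T.ideal_mul_left (star a) (T.star_mem_ideal hx))
  rwa [star_mul, star_star, star_star] at this

theorem ideal_le : T.ideal ≤ T.n := by
  refine Submodule.span_le.2 ?_
  rintro _ ⟨y, -, z, hz, rfl⟩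
  exact T.mul_mem _ _ hz

/-- By density of `n` and continuity of multiplication, every product of two elements of `A` is a
limit of products from `n`. An approximate unit writes each element as a limit of products. -/
theorem dense_ideal : Dense (T.ideal : Set A) := by
  let _ := CStarAlgebra.spectralOrder A
  have := CStarAlgebra.spectralOrderedRing A
  have hcl : T.ideal.topologicalClosure = ⊤ := by
    rw [eq_top_iff]
    rintro a -
    have hmul : ∀ x y : A, x * y ∈ T.ideal.topologicalClosure := by
      intro x y
      have hx : (x, y) ∈ closure ((T.n : Set A) ×ˢ (T.n : Set A)) := by
        rw [(T.dense.prod T.dense).closure_eq]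
        trivial
      refine map_mem_closure (f := fun p : A × A => p.1 * p.2) (by fun_prop) hx ?_
      rintro ⟨p, q⟩ ⟨hp, hq⟩
      have := T.star_mul_mem_ideal (T.star_mem _ hp) hq
      rwa [star_star] at this
    have hlim := (CStarAlgebra.increasingApproximateUnit A).tendsto_mul_left a
    exact T.ideal.isClosed_topologicalClosure.mem_of_tendsto hlim
      (Eventually.of_forall fun x => hmul _ _)
  rw [dense_iff_closure_eq, ← Submodule.topologicalClosure_coe, hcl]
  rfl

theorem L_self (c : A) (hc : c ∈ T.n) : T.L (star c * c) = T.L (c * star c) := by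
  have := T.L_star_mul_self _ (T.star_mem _ hc)
  rw [star_star] at this
  rw [this, T.L_star_mul_self _ hc, T.trace]

/-- Polarization: `L_self` at `x + y` and at `x + i y` gives two relations between the mixed terms,
whose combination isolates `star x * y`. -/
theorem L_star_mul {x y : A} (hx : x ∈ T.n) (hy : y ∈ T.n) :
    T.L (star x * y) = T.L (y * star x) := by
  have h1 := T.L_self _ (T.n.add_mem hx hy)
  have h2 := T.L_self _ (T.n.add_mem hx (T.n.smul_mem Complex.I hy))
  simp only [star_add, add_mul, mul_add, map_add, star_smul, smul_mul_assoc, mul_smul_comm,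
    map_smul, T.L_self x hx, T.L_self y hy, smul_eq_mul, Complex.star_def, Complex.conj_I] at h1 h2
  linear_combination (1 / 2 : ℂ) * h1 + (-(Complex.I / 2)) * h2 +
    ((1 / 2 : ℂ) * (T.L (star x * y) - T.L (star y * x) + T.L (x * star y) - T.L (y * star x))) *
      Complex.I_sq

theorem L_mul_comm {x y : A} (hx : x ∈ T.ideal) (hy : y ∈ T.ideal) :
    T.L (x * y) = T.L (y * x) := by
  have := T.L_star_mul (T.star_mem _ (T.ideal_le hx)) (T.ideal_le hy)
  rwa [star_star] at this

/-! #### Matrices over the unitization with non-scalar part in the ideal -/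

/-- The matrices over the unitization whose non-scalar part is in the ideal of definition. -/
def IsSmooth {ι κ : Type*} (M : Matrix ι κ (Unitization ℂ A)) : Prop :=
  ∀ i j, (M i j).snd ∈ T.ideal

variable {T}

theorem snd_mul_mem {z w : Unitization ℂ A} (hz : z.snd ∈ T.ideal) (hw : w.snd ∈ T.ideal) :
    (z * w).snd ∈ T.ideal := by
  rw [Unitization.snd_mul]
  exact add_mem (add_mem (Submodule.smul_mem _ _ hw) (Submodule.smul_mem _ _ hz))
    (T.ideal_mul_left _ hw)

theorem snd_sum {ι : Type*} (s : Finset ι) (f : ι → Unitization ℂ A) :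
    (∑ i ∈ s, f i).snd = ∑ i ∈ s, (f i).snd :=
  map_sum (Unitization.sndHom ℂ ℂ A) f s

section

variable {ι κ l : Type*} [Fintype ι] [Fintype κ]

theorem IsSmooth.mul {M : Matrix l ι (Unitization ℂ A)} {N : Matrix ι κ (Unitization ℂ A)}
    (hM : T.IsSmooth M) (hN : T.IsSmooth N) : T.IsSmooth (M * N) := fun i j => by
  rw [Matrix.mul_apply, snd_sum]
  exact sum_mem fun k _ => snd_mul_mem (hM _ _) (hN _ _)

theorem IsSmooth.conjTranspose {M : Matrix ι κ (Unitization ℂ A)} (hM : T.IsSmooth M) :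
    T.IsSmooth Mᴴ := fun i j => by
  rw [conjTranspose_apply, Unitization.snd_star]
  exact T.star_mem_ideal (hM _ _)

theorem IsSmooth.add {M N : Matrix ι κ (Unitization ℂ A)} (hM : T.IsSmooth M)
    (hN : T.IsSmooth N) : T.IsSmooth (M + N) := fun i j => add_mem (hM i j) (hN i j)

theorem IsSmooth.sub {M N : Matrix ι κ (Unitization ℂ A)} (hM : T.IsSmooth M)
    (hN : T.IsSmooth N) : T.IsSmooth (M - N) := fun i j => sub_mem (hM i j) (hN i j)

theorem IsSmooth.smul {M : Matrix ι κ (Unitization ℂ A)} (c : ℂ) (hM : T.IsSmooth M) :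
    T.IsSmooth (c • M) := fun i j => Submodule.smul_mem _ c (hM i j)

theorem isSmooth_of_snd_eq_zero {M : Matrix ι κ (Unitization ℂ A)}
    (h : ∀ i j, (M i j).snd = 0) : T.IsSmooth M := fun i j => by
  rw [h]; exact zero_mem _

theorem isSmooth_one [DecidableEq ι] : T.IsSmooth (1 : Matrix ι ι (Unitization ℂ A)) :=
  isSmooth_of_snd_eq_zero fun i j => by
    rw [Matrix.one_apply]; split_ifs <;> rfl

/-- The smooth matrices with vanishing scalar part form a two-sided ideal. -/
theorem IsSmooth.mul_of_fst_eq_zero {M : Matrix l ι (Unitization ℂ A)} (hM : T.IsSmooth M)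
    (hM0 : ∀ i j, (M i j).fst = 0) (N : Matrix ι κ (Unitization ℂ A)) : T.IsSmooth (M * N) :=
  fun i j => by
    rw [Matrix.mul_apply, snd_sum]
    refine sum_mem fun k _ => ?_
    rw [Unitization.snd_mul, hM0, zero_smul, zero_add]
    exact add_mem (Submodule.smul_mem _ _ (hM _ _)) (T.ideal_mul_right (hM _ _) _)

theorem IsSmooth.mul_of_fst_eq_zero' {N : Matrix ι κ (Unitization ℂ A)} (hN : T.IsSmooth N)
    (hN0 : ∀ i j, (N i j).fst = 0) (M : Matrix l ι (Unitization ℂ A)) : T.IsSmooth (M * N) :=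
  fun i j => by
    rw [Matrix.mul_apply, snd_sum]
    refine sum_mem fun k _ => ?_
    rw [Unitization.snd_mul, hN0, zero_smul, add_zero]
    exact add_mem (Submodule.smul_mem _ _ (hN _ _)) (T.ideal_mul_left _ (hN _ _))

end

variable (A) in
/-- The scalar part, as an endomorphism of the unitization. -/
def scalarEnd : Unitization ℂ A →⋆ₐ[ℂ] Unitization ℂ A :=
  (StarAlgHom.ofId ℂ (Unitization ℂ A)).comp (scalarMap A)

variable {ι κ : Type*} [Fintype ι] [Fintype κ]

/-- With `s` denoting scalar parts, `z = s(z) + z (s(y) - y) s(z)`. The matrix `s(y) - y` is smooth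
with scalar part zero, so it stays smooth under multiplication by the arbitrary matrix `z`. -/
theorem IsSmooth.of_mul_eq_one [DecidableEq ι] {y z : Matrix ι ι (Unitization ℂ A)}
    (hy : T.IsSmooth y) (h : z * y = 1) : T.IsSmooth z := by
  have hs : (y.map (scalarEnd A)) * (z.map (scalarEnd A)) = 1 := by
    have : z.map (scalarEnd A) * y.map (scalarEnd A) = 1 := by
      rw [← Matrix.map_mul, h, Matrix.map_one _ (map_zero _) (map_one _)]
    have hfst : (y.map (scalarMap A)) * (z.map (scalarMap A)) = 1 := by
      -- Over `ℂ` a left inverse of a square matrix is also a right inverse.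
      refine mul_eq_one_comm.1 ?_
      have := congrArg (fun M => Matrix.map M (scalarMap A)) h
      simp only [Matrix.map_mul] at this
      rwa [Matrix.map_one _ (map_zero _) (map_one _)] at this
    have := congrArg (fun M => Matrix.map M (StarAlgHom.ofId ℂ (Unitization ℂ A))) hfst
    simp only [Matrix.map_mul] at this
    rwa [Matrix.map_one _ (map_zero _) (map_one _), Matrix.map_map, Matrix.map_map] at this
  have key : z = z.map (scalarEnd A) + z * ((y.map (scalarEnd A) - y) * z.map (scalarEnd A)) := by
    rw [sub_mul, hs, mul_sub, ← mul_assoc z y, h, mul_one, one_mul]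
    abel
  rw [key]
  refine IsSmooth.add (isSmooth_of_snd_eq_zero fun i j => rfl) ?_
  have h1 : T.IsSmooth (y.map (scalarEnd A) - y) :=
    IsSmooth.sub (isSmooth_of_snd_eq_zero fun i j => rfl) hy
  have h2 : ∀ i j, ((y.map (scalarEnd A) - y) i j).fst = 0 := fun i j =>
    (map_sub (scalarMap A) _ _).trans (sub_self _)
  refine IsSmooth.mul_of_fst_eq_zero' (h1.mul_of_fst_eq_zero h2 _) (fun i j => ?_) _
  rw [Matrix.mul_apply]
  refine (map_sum (scalarMap A) _ _).trans (Finset.sum_eq_zero fun k _ => ?_)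
  refine (map_mul (scalarMap A) _ _).trans ?_
  have : scalarMap A ((y.map (scalarEnd A) - y) i k) = 0 := h2 i k
  rw [this, zero_mul]

/-- Only the non-scalar entries need to move. Keeping the scalar part fixed is what later gives the
defect of an approximate projection a vanishing scalar part. -/
theorem mem_closure_smooth (T : DenseTrace τ) (V : Matrix ι κ (Unitization ℂ A)) :
    V ∈ closure {W : Matrix ι κ (Unitization ℂ A) |
      T.IsSmooth W ∧ ∀ i j, (W i j).fst = (V i j).fst} := by
  have h1 : ∀ z : Unitization ℂ A, z ∈ closure {w : Unitization ℂ A |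
      w.snd ∈ T.ideal ∧ w.fst = z.fst} := by
    intro z
    have hz : z.snd ∈ closure (T.ideal : Set A) := T.dense_ideal _
    have := map_mem_closure (f := fun a : A => (Unitization.inl z.fst + (a : Unitization ℂ A)))
      (continuous_const.add Unitization.continuous_inr) hz
      (t := {w : Unitization ℂ A | w.snd ∈ T.ideal ∧ w.fst = z.fst}) (by
        intro a ha
        refine ⟨?_, ?_⟩
        · simpa using ha
        · simp)
    rwa [Unitization.inl_fst_add_inr_snd_eq] at this
  have h2 : V ∈ closure (Set.univ.pi fun i => Set.univ.pi fun j =>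
      {w : Unitization ℂ A | w.snd ∈ T.ideal ∧ w.fst = (V i j).fst}) := by
    refine mem_closure_pi.2 fun i _ => mem_closure_pi.2 fun j _ => h1 _
  refine closure_mono ?_ h2
  intro W hW
  exact ⟨fun i j => (hW i trivial j trivial).1, fun i j => (hW i trivial j trivial).2⟩

/-- The trace, summed over the diagonal, of the non-scalar part. -/
def matTrace (T : DenseTrace τ) (M : Matrix ι ι (Unitization ℂ A)) : ℂ := ∑ i, T.L (M i i).snd

theorem matTrace_mul_comm {M : Matrix ι κ (Unitization ℂ A)} {N : Matrix κ ι (Unitization ℂ A)}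
    (hM : T.IsSmooth M) (hN : T.IsSmooth N) : T.matTrace (M * N) = T.matTrace (N * M) := by
  simp only [matTrace, Matrix.mul_apply, snd_sum, map_sum]
  rw [Finset.sum_comm]
  refine Finset.sum_congr rfl fun i _ => Finset.sum_congr rfl fun j _ => ?_
  rw [Unitization.snd_mul, Unitization.snd_mul, map_add, map_add, map_add, map_add,
    T.L_mul_comm (hM _ _) (hN _ _)]
  ring

/-- The partial isometry `v` need not be smooth, so the trace property does not apply to it
directly. Replace it by `u = q w p` with `w` smooth and close to `v`. Then `u* u + (1 - p)` and `u
u* + (1 - q)` are near `1`, hence invertible. If `z` inverts the first, then `(z u*) u = p` and `u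
(z u*) = q`; all these factors are smooth and the trace property applies. -/
theorem matTrace_eq_of_mvN [DecidableEq ι] [DecidableEq κ] {p : Matrix ι ι (Unitization ℂ A)}
    {q : Matrix κ κ (Unitization ℂ A)} (hp : IsStarProjection p) (hq : IsStarProjection q)
    (hps : T.IsSmooth p) (hqs : T.IsSmooth q) (h : MvN p q) : T.matTrace p = T.matTrace q := by
  obtain ⟨v, hv1, hv2⟩ := h
  have hp2 : p * p = p := hp.isIdempotentElem
  have hq2 : q * q = q := hq.isIdempotentElem
  have hp1 : pᴴ = p := hp.isSelfAdjoint
  have hq1 : qᴴ = q := hq.isSelfAdjoint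
  have hvp : q * v * p = v := by
    have h1 : (v * p - v)ᴴ * (v * p - v) = 0 := by
      rw [conjTranspose_sub, conjTranspose_mul, hp1]
      have e1 : p * vᴴ * (v * p) = p := by
        rw [Matrix.mul_assoc, ← Matrix.mul_assoc vᴴ, hv1, hp2, hp2]
      have e2 : p * vᴴ * v = p := by rw [Matrix.mul_assoc, hv1, hp2]
      have e3 : vᴴ * (v * p) = p := by rw [← Matrix.mul_assoc, hv1, hp2]
      rw [Matrix.sub_mul, Matrix.mul_sub, Matrix.mul_sub, e1, e2, e3, hv1]
      simp
    have h2 : v * p = v := by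
      -- The diagonal entries of `wᴴ * w` are sums of positive elements, so each summand vanishes.
      have h3 : ∀ w : Matrix κ ι (Unitization ℂ A), wᴴ * w = 0 → w = 0 := by
        intro w hw
        let _ := CStarAlgebra.spectralOrder (Unitization ℂ A)
        have := CStarAlgebra.spectralOrderedRing (Unitization ℂ A)
        ext i j : 1
        have h4 := congrFun₂ hw j j
        simp only [Matrix.mul_apply, conjTranspose_apply, Matrix.zero_apply] at h4
        have h5 := (Finset.sum_eq_zero_iff_of_nonneg
          (fun i _ => star_mul_self_nonneg (w i j))).1 h4 i (Finset.mem_univ i)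
        simpa using (CStarRing.star_mul_self_eq_zero_iff (w i j)).1 h5
      exact sub_eq_zero.1 (h3 _ h1)
    calc q * v * p = v * (vᴴ * v) * p := by rw [← hv2]; simp only [Matrix.mul_assoc]
      _ = v := by rw [hv1, h2, h2]
  have hcont : Continuous fun w : Matrix κ ι (Unitization ℂ A) =>
      (q * w * p)ᴴ * (q * w * p) + (1 - p) := by fun_prop
  have hcont' : Continuous fun w : Matrix κ ι (Unitization ℂ A) =>
      (q * w * p) * (q * w * p)ᴴ + (1 - q) := by fun_prop
  have e1 : ∀ᶠ w in 𝓝 v, IsUnit ((q * w * p)ᴴ * (q * w * p) + (1 - p)) := by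
    refine hcont.continuousAt.eventually ?_
    simp only [hvp, hv1, add_sub_cancel]
    exact eventually_isUnit
  have e2 : ∀ᶠ w in 𝓝 v, IsUnit ((q * w * p) * (q * w * p)ᴴ + (1 - q)) := by
    refine hcont'.continuousAt.eventually ?_
    simp only [hvp, hv2, add_sub_cancel]
    exact eventually_isUnit
  obtain ⟨w, ⟨hws, -⟩, hw1, hw2⟩ :=
    ((mem_closure_iff_frequently.1 (T.mem_closure_smooth v)).and_eventually (e1.and e2)).exists
  set u := q * w * p with hu
  have hus : T.IsSmooth u := (hqs.mul hws).mul hps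
  have hup : u * p = u := by rw [hu, Matrix.mul_assoc, hp2]
  have hqu : q * u = u := by rw [hu, ← Matrix.mul_assoc, ← Matrix.mul_assoc, hq2]
  have hpu : p * uᴴ = uᴴ := by
    have := congrArg Matrix.conjTranspose hup
    rwa [conjTranspose_mul, hp1] at this
  have huq : uᴴ * q = uᴴ := by
    have := congrArg Matrix.conjTranspose hqu
    rwa [conjTranspose_mul, hq1] at this
  clear_value u
  obtain ⟨⟨y, z, hyz, hzy⟩, rfl : y = _⟩ := hw1
  have hzs : T.IsSmooth z := IsSmooth.of_mul_eq_one
    ((hus.conjTranspose.mul hus).add (isSmooth_one.sub hps)) hzy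
  have hzp : z * (uᴴ * u) = p := by
    have h1 : (uᴴ * u + (1 - p)) * p = uᴴ * u := by
      rw [add_mul, Matrix.mul_assoc, hup, sub_mul, one_mul, hp2, sub_self, add_zero]
    rw [← h1, ← mul_assoc, hzy, one_mul]
  have hq' : u * (z * uᴴ) = q := by
    -- It suffices to verify the identity after multiplication by the invertible element `u u* + (1
    -- - q)`.
    have h1 : (u * (z * uᴴ) - q) * (u * uᴴ + (1 - q)) = 0 := by
      have h2 : u * (z * uᴴ) * (u * uᴴ) = u * uᴴ := by
        calc u * (z * uᴴ) * (u * uᴴ) = u * (z * (uᴴ * u)) * uᴴ := by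
              simp only [Matrix.mul_assoc]
          _ = u * uᴴ := by rw [hzp, hup]
      have h3 : u * (z * uᴴ) * q = u * (z * uᴴ) := by
        rw [Matrix.mul_assoc, Matrix.mul_assoc, huq]
      have h4 : q * (u * uᴴ) = u * uᴴ := by rw [← Matrix.mul_assoc, hqu]
      rw [mul_add, sub_mul, sub_mul, h2, h4, mul_sub, mul_sub, h3, hq2, mul_one, mul_one]
      abel
    obtain ⟨b, hb⟩ := hw2.exists_right_inv
    have := congrArg (· * b) h1
    simp only [mul_assoc, hb, mul_one, zero_mul] at this
    exact sub_eq_zero.1 this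
  rw [← hzp, ← Matrix.mul_assoc, ← hq']
  exact matTrace_mul_comm (hzs.mul hus.conjTranspose) hus

/-- Take a smooth self-adjoint `x` near `p` with the same scalar part. The scalar part of `p` is
idempotent, so `x² - x` has scalar part zero and entries in the ideal. The projection `x + (x² - x)
g` is then smooth, although nothing is known about `g`. -/
theorem exists_smooth_mvN [DecidableEq ι] (T : DenseTrace τ) {p : Matrix ι ι (Unitization ℂ A)}
    (hp : IsStarProjection p) :
    ∃ q : Matrix ι ι (Unitization ℂ A), IsStarProjection q ∧ MvN p q ∧ T.IsSmooth q := by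
  have hp1 : pᴴ = p := hp.isSelfAdjoint
  have hcont : Continuous fun w : Matrix ι ι (Unitization ℂ A) => (2⁻¹ : ℂ) • (w + wᴴ) := by
    fun_prop
  have h1 : ∀ᶠ w in 𝓝 p, IsSelfAdjoint ((2⁻¹ : ℂ) • (w + wᴴ)) →
      ∃ q g : Matrix ι ι (Unitization ℂ A), IsStarProjection q ∧ MvN p q ∧
        q = (2⁻¹ : ℂ) • (w + wᴴ) +
          ((2⁻¹ : ℂ) • (w + wᴴ) * ((2⁻¹ : ℂ) • (w + wᴴ)) - (2⁻¹ : ℂ) • (w + wᴴ)) * g := by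
    have h2 := hcont.tendsto p
    have h3 : (2⁻¹ : ℂ) • (p + pᴴ) = p := by
      rw [hp1, ← two_smul ℂ p, smul_smul]; norm_num
    simp only [h3] at h2
    exact h2.eventually (eventually_exists_mvN hp)
  obtain ⟨w, ⟨hws, hw0⟩, hw⟩ :=
    ((mem_closure_iff_frequently.1 (T.mem_closure_smooth p)).and_eventually h1).exists
  set x := (2⁻¹ : ℂ) • (w + wᴴ) with hx
  have hxs : T.IsSmooth x := (hws.add hws.conjTranspose).smul _
  have hsa : IsSelfAdjoint x := by
    rw [IsSelfAdjoint, hx, star_smul, star_eq_conjTranspose, conjTranspose_add,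
      conjTranspose_conjTranspose, add_comm]
    congr 1
    simp
  have hx0 : x.map (scalarMap A) = p.map (scalarMap A) := by
    have e1 : w.map (scalarMap A) = p.map (scalarMap A) := by
      ext i j; exact hw0 i j
    have e2 : wᴴ.map (scalarMap A) = p.map (scalarMap A) := by
      rw [Matrix.conjTranspose_map _ (map_star (scalarMap A)), e1,
        ← Matrix.conjTranspose_map _ (map_star (scalarMap A)), hp1]
    ext i j
    have := congrFun₂ e1 i j
    have h' := congrFun₂ e2 i j
    simp only [Matrix.map_apply] at this h'
    simp only [hx, Matrix.map_apply, Matrix.smul_apply, Matrix.add_apply, map_smul, map_add,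
      this, h', smul_eq_mul]
    ring
  obtain ⟨q, g, hq, hpq, hqg⟩ := hw hsa
  refine ⟨q, hq, hpq, ?_⟩
  rw [hqg]
  refine hxs.add (IsSmooth.mul_of_fst_eq_zero ((hxs.mul hxs).sub hxs) (fun i j => ?_) _)
  have : (x * x - x).map (scalarMap A) = 0 := by
    rw [Matrix.map_sub _ (map_sub _), Matrix.map_mul, hx0, ← Matrix.map_mul,
      hp.isIdempotentElem.eq, sub_self]
  exact congrFun₂ this i j

end DenseTrace

end KTheory

end

/-! ### The homomorphism on `K₀` induced by a densely defined trace. -/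

noncomputable section

namespace KTheory

section

variable {B : Type*} [Ring B] [StarRing B]

theorem K0.exists_eq_sub (x : K0 B) : ∃ a b : Proj B, x = K0.cls a - K0.cls b := by
  obtain ⟨⟨u, v⟩, h⟩ := (AddLocalization.addMonoidOf (⊤ : AddSubmonoid (ProjClass B))).surj x
  obtain ⟨v, hv⟩ := v
  induction u using ProjClass.ind with | h a =>
  induction v using ProjClass.ind with | h b =>
  exact ⟨a, b, eq_sub_of_add_eq h⟩

theorem K0.hom_ext {G : Type*} [AddCommGroup G] {φ ψ : K0 B →+ G}
    (h : ∀ p, φ (K0.cls p) = ψ (K0.cls p)) : φ = ψ := by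
  ext x
  obtain ⟨a, b, rfl⟩ := K0.exists_eq_sub x
  rw [map_sub, map_sub, h, h]

variable (B) in
/-- The unit matrix of size `k`. -/
def Proj.one (k : ℕ) : Proj B := ⟨k, 1, IsStarProjection.one _⟩

/-- The complementary projection. -/
def Proj.compl (p : Proj B) : Proj B := ⟨p.size, 1 - p.mat, p.isProj.one_sub⟩

theorem mvN_fromBlocks_one_sub {ι : Type*} [Fintype ι] [DecidableEq ι] {p : Matrix ι ι B}
    (hp : IsStarProjection p) : MvN (fromBlocks p 0 0 (1 - p)) (1 : Matrix ι ι B) := by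
  have h1 : pᴴ = p := hp.isSelfAdjoint
  have h2 : p * p = p := hp.isIdempotentElem
  refine ⟨fromCols p (1 - p), ?_, ?_⟩
  · rw [conjTranspose_fromCols_eq_fromRows_conjTranspose, fromRows_mul_fromCols]
    simp only [h1, conjTranspose_sub, conjTranspose_one, mul_sub, sub_mul, one_mul,
      mul_one, h2, sub_self, sub_zero]
  · rw [conjTranspose_fromCols_eq_fromRows_conjTranspose, fromCols_mul_fromRows]
    simp only [h1, conjTranspose_sub, conjTranspose_one, mul_sub, sub_mul, one_mul,
      mul_one, h2, sub_self, sub_zero, add_sub_cancel]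

theorem K0.cls_add_cls_compl (p : Proj B) :
    K0.cls p + K0.cls p.compl = K0.cls (Proj.one B p.size) := by
  rw [← K0.cls_sum]
  exact K0.cls_eq (MvN.trans (Proj.isProj _) (Proj.isProj _) (p.sum_mvN p.compl).symm
    (mvN_fromBlocks_one_sub p.isProj))

end

variable {A : Type*} [NonUnitalCStarAlgebra A]

theorem cls_scalarPart (p : Proj (Unitization ℂ A)) :
    K0.cls (scalarPart p) =
      K0.map (StarAlgHom.ofId ℂ (Unitization ℂ A)) (K0.map (scalarMap A) (K0.cls p)) := by
  rw [K0.map_cls, K0.map_cls]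
  rfl

theorem cls_scalarPart_one (k : ℕ) :
    K0.cls (scalarPart (Proj.one (Unitization ℂ A) k)) = K0.cls (Proj.one _ k) := by
  refine congrArg K0.cls ?_
  simp only [scalarPart, Proj.one, Proj.mk.injEq, heq_eq_eq, true_and]
  exact Matrix.map_one _ rfl rfl

/-- Every class in `K₀(A)` is of the form `[p] - [s(p)]`. -/
theorem K0NonUnital.exists_eq_sub (x : K0NonUnital A) : ∃ p : Proj (Unitization ℂ A),
    (x : K0 (Unitization ℂ A)) = K0.cls p - K0.cls (scalarPart p) := by
  obtain ⟨x, hx⟩ := x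
  obtain ⟨a, b, rfl⟩ := K0.exists_eq_sub x
  -- Rewrite `[a] - [b]` as `[a ⊕ (1 - b)] - [1]`. As the class dies under the scalar map, `[1]` is
  -- the class of the scalar part of `a ⊕ (1 - b)`.
  have hb := K0.cls_add_cls_compl b
  have hsum : K0.cls (a.sum b.compl) =
      (K0.cls a - K0.cls b) + K0.cls (Proj.one _ b.size) := by
    rw [K0.cls_sum, ← hb]; abel
  refine ⟨a.sum b.compl, ?_⟩
  rw [cls_scalarPart, hsum, map_add, AddMonoidHom.mem_ker.1 hx, zero_add, ← cls_scalarPart,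
    cls_scalarPart_one]
  simp

namespace DenseTrace

variable {τ : A → ℝ≥0∞} (T : DenseTrace τ)

/-- The trace of a smooth representative of the Murray–von Neumann class. -/
def projTrace (p : Proj (Unitization ℂ A)) : ℝ :=
  (T.matTrace (T.exists_smooth_mvN p.isProj).choose).re

/-- The value does not depend on the chosen smooth representative, since any two are equivalent to
each other and `matTrace_eq_of_mvN` applies. -/
theorem projTrace_eq {κ : Type*} [Fintype κ] [DecidableEq κ] (p : Proj (Unitization ℂ A))
    {q : Matrix κ κ (Unitization ℂ A)} (hq : IsStarProjection q) (hs : T.IsSmooth q)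
    (h : MvN p.mat q) : T.projTrace p = (T.matTrace q).re := by
  obtain ⟨h1, h2, h3⟩ := (T.exists_smooth_mvN p.isProj).choose_spec
  exact congrArg Complex.re (matTrace_eq_of_mvN h1 hq h3 hs (MvN.trans h1 hq h2.symm h))

/-- The homomorphism on `K₀` of the unitization induced by a densely defined trace. -/
def k0 : K0 (Unitization ℂ A) →+ ℝ :=
  K0.lift T.projTrace
    (fun p q h => by
      obtain ⟨h1, h2, h3⟩ := (T.exists_smooth_mvN q.isProj).choose_spec
      exact T.projTrace_eq p h1 h3 (MvN.trans p.isProj h1 h h2))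
    (by
      rw [T.projTrace_eq Proj.zero Proj.zero.isProj (fun i => i.elim0) (MvN.refl Proj.zero.isProj)]
      exact congrArg Complex.re (Finset.sum_empty (ι := Fin 0)))
    (fun p q => by
      obtain ⟨p', hp1, hp2, hp3⟩ := T.exists_smooth_mvN p.isProj
      obtain ⟨q', hq1, hq2, hq3⟩ := T.exists_smooth_mvN q.isProj
      have h0 := isStarProjection_fromBlocks hp1 hq1
      rw [T.projTrace_eq p hp1 hp3 hp2, T.projTrace_eq q hq1 hq3 hq2,
        T.projTrace_eq (p.sum q) h0 ?_ (MvN.trans (Proj.isProj _) h0 (p.sum_mvN q).symm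
          (MvN.fromBlocks hp2 hq2))]
      · simp [matTrace]
      · rintro (i | i) (j | j)
        · exact hp3 i j
        · exact zero_mem _
        · exact zero_mem _
        · exact hq3 i j)

theorem k0_cls {p : Proj (Unitization ℂ A)} (hp : T.IsSmooth p.mat) :
    T.k0 (K0.cls p) = (T.matTrace p.mat).re :=
  (K0.lift_cls _ _ _ _ p).trans (T.projTrace_eq p p.isProj hp (MvN.refl p.isProj))

theorem k0_cls_scalarPart (p : Proj (Unitization ℂ A)) : T.k0 (K0.cls (scalarPart p)) = 0 := by
  have h : ∀ i j, ((scalarPart p).mat i j).snd = 0 := fun i j => rfl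
  rw [T.k0_cls (isSmooth_of_snd_eq_zero h)]
  simp [matTrace, h]

variable {ι : Type*} [Fintype ι]

theorem sum_univ (T : DenseTrace τ) (c : ι → A) : τ (∑ j, star (c j) * c j) = ∑ j, τ (star (c j) * c j) := by
  have := T.sum _ (fun j => c ((Fintype.equivFin ι).symm j))
  rwa [(Fintype.equivFin ι).symm.sum_comp (fun j => star (c j) * c j),
    (Fintype.equivFin ι).symm.sum_comp (fun j => τ (star (c j) * c j))] at this

theorem sum_trace_diag (T : DenseTrace τ) (c : Matrix ι ι A) :
    ∑ i, τ ((cᴴ * c) i i) = ∑ i, ∑ j, τ (star (c j i) * c j i) := by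
  refine Finset.sum_congr rfl fun i _ => ?_
  simp only [Matrix.mul_apply, conjTranspose_apply]
  exact T.sum_univ fun j => c j i

/-- Additivity of `τ` on squares turns the diagonal sum into the sum of `τ (star (c j i) * c j i)`
over all entries, which is finite exactly when each term is. -/
theorem sum_trace_diag_ne_top_iff (c : Matrix ι ι A) :
    ∑ i, τ ((cᴴ * c) i i) ≠ ∞ ↔ ∀ i j, c i j ∈ T.n := by
  simp only [T.sum_trace_diag, ne_eq, ENNReal.sum_eq_top, not_exists, T.mem_n, Finset.mem_univ,
    true_and]
  exact ⟨fun h i j => h j i, fun h i j => h j i⟩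

theorem sum_L_diag {c : Matrix ι ι A} (hc : ∀ i j, c i j ∈ T.n) :
    ∑ i, T.L ((cᴴ * c) i i) = ((∑ i, τ ((cᴴ * c) i i)).toReal : ℂ) := by
  rw [T.sum_trace_diag, ENNReal.toReal_sum]
  · push_cast
    refine Finset.sum_congr rfl fun i _ => ?_
    rw [ENNReal.toReal_sum fun j _ => (T.mem_n _).1 (hc _ _)]
    push_cast
    simp only [Matrix.mul_apply, conjTranspose_apply, map_sum]
    exact Finset.sum_congr rfl fun j _ => T.L_star_mul_self _ (hc _ _)
  · intro i _
    exact ENNReal.sum_ne_top.2 fun j _ => (T.mem_n _).1 (hc _ _)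

theorem conjTranspose_mul_mem_ideal {c d : Matrix ι ι A} (hc : ∀ i j, c i j ∈ T.n)
    (hd : ∀ i j, d i j ∈ T.n) (i j : ι) : (cᴴ * d) i j ∈ T.ideal := by
  rw [Matrix.mul_apply]
  exact sum_mem fun k _ => T.star_mul_mem_ideal (hc _ _) (hd _ _)

/-- Differences of positive matrices of finite trace. -/
def IsPosDiff (M : Matrix ι ι A) : Prop :=
  ∃ c d : Matrix ι ι A, (∀ i j, c i j ∈ T.n) ∧ (∀ i j, d i j ∈ T.n) ∧ M = cᴴ * c - dᴴ * d

variable {T}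

theorem exists_conjTranspose_mul_self_add {c d : Matrix ι ι A} (hc : ∀ i j, c i j ∈ T.n)
    (hd : ∀ i j, d i j ∈ T.n) :
    ∃ e : Matrix ι ι A, (∀ i j, e i j ∈ T.n) ∧ eᴴ * e = cᴴ * c + dᴴ * d := by
  obtain ⟨e, he⟩ := exists_sum_conjTranspose_mul_self (Finset.univ : Finset Bool)
    (fun b => if b then c else d)
  simp only [Fintype.sum_bool, if_true, Bool.false_eq_true, if_false] at he
  refine ⟨e, (T.sum_trace_diag_ne_top_iff e).1 ?_, he⟩
  have h : ∀ i, τ ((eᴴ * e) i i) = τ ((cᴴ * c) i i) + τ ((dᴴ * d) i i) := fun i => by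
    have := T.sum_univ (Sum.elim (fun j => c j i) (fun j => d j i))
    simp only [Fintype.sum_sum_type, Sum.elim_inl, Sum.elim_inr] at this
    rw [← T.sum_univ, ← T.sum_univ] at this
    rw [he]
    simpa [Matrix.mul_apply] using this
  simp only [h, Finset.sum_add_distrib]
  exact ENNReal.add_ne_top.2 ⟨(T.sum_trace_diag_ne_top_iff c).2 hc,
    (T.sum_trace_diag_ne_top_iff d).2 hd⟩

theorem isPosDiff_zero : T.IsPosDiff (0 : Matrix ι ι A) :=
  ⟨0, 0, fun _ _ => zero_mem _, fun _ _ => zero_mem _, by simp⟩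

theorem IsPosDiff.add {M N : Matrix ι ι A} (hM : T.IsPosDiff M) (hN : T.IsPosDiff N) :
    T.IsPosDiff (M + N) := by
  obtain ⟨c, d, hc, hd, rfl⟩ := hM
  obtain ⟨c', d', hc', hd', rfl⟩ := hN
  obtain ⟨e, he, h⟩ := exists_conjTranspose_mul_self_add hc hc'
  obtain ⟨e', he', h'⟩ := exists_conjTranspose_mul_self_add hd hd'
  exact ⟨e, e', he, he', by rw [h, h']; abel⟩

theorem isPosDiff_sum {κ : Type*} (s : Finset κ) {M : κ → Matrix ι ι A}
    (h : ∀ k ∈ s, T.IsPosDiff (M k)) : T.IsPosDiff (∑ k ∈ s, M k) :=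
  Finset.sum_induction _ T.IsPosDiff (fun _ _ => IsPosDiff.add) isPosDiff_zero h

/-- The expression equals `(c + d)ᴴ (c + d) - (cᴴ c + dᴴ d)`. This algebraic decomposition keeps
every factor in `n`, with no need for positive and negative parts. -/
theorem isPosDiff_conjTranspose_mul_add {c d : Matrix ι ι A} (hc : ∀ i j, c i j ∈ T.n)
    (hd : ∀ i j, d i j ∈ T.n) : T.IsPosDiff (cᴴ * d + (cᴴ * d)ᴴ) := by
  obtain ⟨e, he, h⟩ := exists_conjTranspose_mul_self_add hc hd
  refine ⟨c + d, e, fun i j => add_mem (hc i j) (hd i j), he, ?_⟩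
  rw [h, conjTranspose_add, conjTranspose_mul, conjTranspose_conjTranspose]
  simp only [Matrix.add_mul, Matrix.mul_add]
  abel

theorem isPosDiff_single_add [DecidableEq ι] (i j : ι) {x : A} (hx : x ∈ T.ideal) :
    T.IsPosDiff (single i j x + (single i j x)ᴴ) := by
  have hs : ∀ (k l : ι) {y : A}, y ∈ T.n → ∀ k' l', single k l y k' l' ∈ T.n := by
    intro k l y hy k' l'
    rw [single_apply]
    split_ifs
    exacts [hy, zero_mem _]
  -- The scalar is built into the induction because the symmetrization `x + x*` is not complex
  -- linear in `x`.
  suffices h : ∀ c : ℂ, T.IsPosDiff (single i j (c • x) + (single i j (c • x))ᴴ) by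
    simpa using h 1
  induction hx using Submodule.span_induction with
  | mem x h =>
    obtain ⟨y, hy, z, hz, rfl⟩ := h
    intro c
    have h1 := isPosDiff_conjTranspose_mul_add (hs i i hy) (hs i j (T.n.smul_mem c hz))
    rwa [conjTranspose_single, single_mul_single_same, mul_smul_comm] at h1
  | zero => intro c; simpa using isPosDiff_zero
  | add x y _ _ hx hy =>
    intro c
    have := (hx c).add (hy c)
    rw [smul_add, single_add, conjTranspose_add]
    convert this using 1
    abel
  | smul a x _ hx =>
    intro c
    rw [smul_smul]
    exact hx _

/-- A self-adjoint `M` is the sum of the symmetrizations of its halved entries, each placed alone in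
a matrix. -/
theorem isPosDiff_of_isSelfAdjoint {M : Matrix ι ι A} (hM : Mᴴ = M)
    (h : ∀ i j, M i j ∈ T.ideal) : T.IsPosDiff M := by
  classical
  have h1 : T.IsPosDiff (∑ i, ∑ j, (single i j ((2⁻¹ : ℂ) • M i j) +
      (single i j ((2⁻¹ : ℂ) • M i j))ᴴ)) :=
    isPosDiff_sum _ fun i _ => isPosDiff_sum _ fun j _ =>
      isPosDiff_single_add i j (Submodule.smul_mem _ _ (h i j))
  convert h1 using 1
  simp only [Finset.sum_add_distrib, ← conjTranspose_sum]
  have h2 : ∑ i, ∑ j, single i j ((2⁻¹ : ℂ) • M i j) = (2⁻¹ : ℂ) • M :=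
    (matrix_eq_sum_single ((2⁻¹ : ℂ) • M)).symm
  rw [h2, conjTranspose_smul, hM, ← add_smul]
  norm_num

variable (T)

/-- From left to right this is independence of the representation: finiteness of the traces forces
`p` to be smooth, and on a smooth projection `k0` is the sum of `L` over the diagonal. From right to
left it is existence: a smooth representative has a self-adjoint non-scalar part over the ideal,
hence a difference of squares. -/
theorem isTraceOf_iff (x : K0NonUnital A) (r : ℝ) :
    IsTraceOf τ x r ↔ T.k0 (x : K0 (Unitization ℂ A)) = r := by
  constructor
  · rintro ⟨p, c, d, hx, hp, hc, hd, rfl⟩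
    rw [T.sum_trace_diag_ne_top_iff] at hc hd
    have h1 : ∀ i j, (p.mat i j).snd = (cᴴ * c) i j - (dᴴ * d) i j := fun i j => by
      have := congrArg Prod.snd (congrArg Unitization.toProd (congrFun₂ hp i j))
      exact this.trans (zero_add _)
    have hs : T.IsSmooth p.mat := fun i j => by
      rw [h1]
      exact sub_mem (T.conjTranspose_mul_mem_ideal hc hc _ _)
        (T.conjTranspose_mul_mem_ideal hd hd _ _)
    rw [hx, map_sub, T.k0_cls_scalarPart, T.k0_cls hs, sub_zero, matTrace]
    simp only [h1, map_sub, Finset.sum_sub_distrib, T.sum_L_diag hc, T.sum_L_diag hd]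
    simp
  · rintro rfl
    obtain ⟨p', hx⟩ := K0NonUnital.exists_eq_sub x
    obtain ⟨q, hq, hpq, hqs⟩ := T.exists_smooth_mvN p'.isProj
    let p : Proj (Unitization ℂ A) := ⟨p'.size, q, hq⟩
    have hcls : K0.cls p' = K0.cls p := K0.cls_eq hpq
    rw [cls_scalarPart, hcls, ← cls_scalarPart] at hx
    have hqsa : qᴴ = q := hq.isSelfAdjoint
    obtain ⟨c, d, hc, hd, hcd⟩ := isPosDiff_of_isSelfAdjoint (T := T)
      (M := Matrix.of fun i j => (q i j).snd) (by
        ext i j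
        have := congrArg Prod.snd (congrArg Unitization.toProd (congrFun₂ hqsa i j))
        simpa using this) hqs
    refine ⟨p, c, d, hx, ?_, (T.sum_trace_diag_ne_top_iff c).2 hc,
      (T.sum_trace_diag_ne_top_iff d).2 hd, ?_⟩
    · rw [← hcd]
      refine Matrix.ext fun i j => ?_
      exact (Unitization.inl_fst_add_inr_snd_eq _).symm
    · rw [hx, map_sub, T.k0_cls_scalarPart, T.k0_cls hqs, sub_zero, matTrace]
      have h1 : ∑ i, T.L (p.mat i i).snd = ∑ i, (T.L ((cᴴ * c) i i) - T.L ((dᴴ * d) i i)) :=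
        Finset.sum_congr rfl fun i _ =>
          (congrArg T.L (congrFun₂ hcd i i)).trans (map_sub T.L _ _)
      rw [h1, Finset.sum_sub_distrib, T.sum_L_diag hc, T.sum_L_diag hd]
      simp
      rfl

theorem k0_ofProj (e : A) (he : IsStarProjection e) (hfin : τ e ≠ ∞) :
    T.k0 (K0NonUnital.ofProj e he : K0 (Unitization ℂ A)) = (τ e).toReal := by
  have h1 : star e * e = e := by rw [he.isSelfAdjoint.star_eq, he.isIdempotentElem.eq]
  have hn : e ∈ T.n := (T.mem_n e).2 (by rwa [h1])
  have h2 := T.L_star_mul_self e hn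
  rw [h1] at h2
  refine (T.k0_cls (p := Proj.single (e : Unitization ℂ A) _) fun i j => ?_).trans ?_
  · have := T.star_mul_mem_ideal hn hn
    rwa [h1] at this
  · have : T.matTrace (Proj.single (e : Unitization ℂ A)
        (he.map (Unitization.inrNonUnitalStarAlgHom ℂ A))).mat = T.L e :=
      Fin.sum_univ_one (fun _ : Fin 1 => T.L e)
    rw [this, h2, Complex.ofReal_re]

end DenseTrace

end KTheory

end

open scoped Pointwise
noncomputable section

/-! ### The crossed product -/

namespace CrossedProduct

open Filter Topology

variable {n : ℕ} {X : Type*} [TopologicalSpace X] [CompactSpace X] [AddAction (Euc n) X]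
  [ContinuousVAdd (Euc n) X]

/-- The representation of the crossed product that belongs to a covariant representation. -/
def CovariantRep.rep (π : CovariantRep n X) : CStarCrossed n X →⋆ₙₐ[ℂ] (π.H →L[ℂ] π.H) where
  toFun a := a.toFamily π
  map_smul' _ _ := rfl
  map_zero' := rfl
  map_add' _ _ := rfl
  map_mul' _ _ := rfl
  map_star' _ := rfl

theorem CovariantRep.rep_ofCc (π : CovariantRep n X) (a : C_c(Euc n, C(X, ℂ))) :
    π.rep (ofCc a) = π.integrated a := rfl

theorem CovariantRep.integrated_apply (π : CovariantRep n X) (a : C_c(Euc n, C(X, ℂ))) (ξ : π.H) :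
    π.integrated a ξ = ∫ s, π.ρ (a s) (π.U s ξ) := rfl

theorem CovariantRep.norm_rep_le (π : CovariantRep n X) (a : CStarCrossed n X) :
    ‖π.rep a‖ ≤ ‖a‖ := NonUnitalStarAlgHom.norm_apply_le π.rep a

theorem CovariantRep.continuous_rep (π : CovariantRep n X) : Continuous π.rep :=
  AddMonoidHomClass.continuous_of_bound π.rep 1 fun a => by simpa using π.norm_rep_le a

theorem CStarCrossed.ext {a b : CStarCrossed n X}
    (h : ∀ π : CovariantRep n X, π.rep a = π.rep b) : a = b :=
  Subtype.ext (Subtype.ext (funext h))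

/-- The crossed product is the closure of the *-algebra generated by the image of `C_c`, so products
and stars appear as separate cases and the convolution structure on `C_c` is not needed. -/
theorem CStarCrossed.induction {P : CStarCrossed n X → Prop} (ofCc : ∀ a, P (ofCc a))
    (add : ∀ a b, P a → P b → P (a + b)) (mul : ∀ a b, P a → P b → P (a * b))
    (smul : ∀ (c : ℂ) a, P a → P (c • a)) (star : ∀ a, P a → P (star a))
    (closed : IsClosed {a | P a}) (a : CStarCrossed n X) : P a := by
  have h1 : ∀ (x : BoundedFamilies n X) (hx : x ∈ NonUnitalStarAlgebra.adjoin ℂ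
      (Set.range (universal (n := n) (X := X)))),
      P (⟨x, NonUnitalStarSubalgebra.le_topologicalClosure _ hx⟩ : universalClosure n X) := by
    intro x hx
    induction hx using NonUnitalStarAlgebra.adjoin_induction with
    | mem x h =>
      obtain ⟨a, rfl⟩ := h
      exact ofCc a
    | add x y _ _ hx hy => exact add _ _ hx hy
    | zero =>
      have := smul 0 _ (ofCc 0)
      rw [zero_smul] at this
      exact this
    | mul x y _ _ hx hy => exact mul _ _ hx hy
    | smul c x _ hx => exact smul c _ hx
    | star x hx' hx =>
      exact star (show CStarCrossed n X from
        ⟨x, NonUnitalStarSubalgebra.le_topologicalClosure _ hx'⟩) hx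
  have h2 : a.1 ∈ closure ((NonUnitalStarAlgebra.adjoin ℂ
      (Set.range (universal (n := n) (X := X))) : Set (BoundedFamilies n X))) := a.2
  have h3 : a ∈ closure {a | P a} := by
    refine Metric.mem_closure_iff.2 fun ε hε => ?_
    obtain ⟨x, hx, hd⟩ := Metric.mem_closure_iff.1 h2 ε hε
    exact ⟨_, h1 x hx, hd⟩
  rwa [closed.closure_eq] at h3

theorem ofCc_add (a b : C_c(Euc n, C(X, ℂ))) : ofCc (a + b) = ofCc a + ofCc b := by
  refine CStarCrossed.ext fun π => ?_
  rw [map_add]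
  ext ξ
  simp only [CovariantRep.rep_ofCc, _root_.add_apply, CovariantRep.integrated_apply]
  rw [← integral_add (π.integrable a ξ) (π.integrable b ξ)]
  simp

theorem ofCc_smul (c : ℂ) (a : C_c(Euc n, C(X, ℂ))) : ofCc (c • a) = c • ofCc a := by
  refine CStarCrossed.ext fun π => ?_
  rw [map_smul]
  ext ξ
  simp only [CovariantRep.rep_ofCc, _root_.smul_apply, CovariantRep.integrated_apply]
  rw [← integral_smul]
  simp

/-- Strong continuity yields joint continuity because the operators `U r` are isometric, hence
equicontinuous. -/
theorem CovariantRep.continuous_U_apply (π : CovariantRep n X) {Y : Type*} [TopologicalSpace Y]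
    {f : Y → Euc n} {g : Y → π.H} (hf : Continuous f) (hg : Continuous g) :
    Continuous fun y => π.U (f y) (g y) := by
  refine continuous_iff_continuousAt.2 fun y₀ => tendsto_iff_norm_sub_tendsto_zero.2 ?_
  have h1 : Tendsto (fun y => ‖g y - g y₀‖ + ‖π.U (f y) (g y₀) - π.U (f y₀) (g y₀)‖) (𝓝 y₀)
      (𝓝 0) := by
    have hc : Continuous fun y => ‖g y - g y₀‖ + ‖π.U (f y) (g y₀) - π.U (f y₀) (g y₀)‖ := by
      have := (π.U_cont (g y₀)).comp hf
      simp only [Function.comp_def] at this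
      fun_prop
    have := hc.tendsto y₀
    simpa using this
  refine squeeze_zero (fun _ => norm_nonneg _) (fun y => ?_) h1
  calc ‖π.U (f y) (g y) - π.U (f y₀) (g y₀)‖
      = ‖π.U (f y) (g y - g y₀) + (π.U (f y) (g y₀) - π.U (f y₀) (g y₀))‖ := by
        rw [map_sub]; congr 1; abel
    _ ≤ _ := (norm_add_le _ _).trans (by rw [LinearIsometry.norm_map])

/-- The orbit map of a representation, as a continuous linear map. -/
def CovariantRep.ρApply (π : CovariantRep n X) (ξ : π.H) : C(X, ℂ) →L[ℂ] π.H where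
  toFun g := π.ρ g ξ
  map_add' g h := by simp
  map_smul' c g := by simp
  cont := π.continuous_ρ.clm_apply continuous_const

/-- In every covariant representation, covariance moves `U r` past `ρ (b (s - r))`. The substitution
`s ↦ s - r` and Fubini then turn the product of integrated forms into the integrated form of the
convolution. Requiring the convolution formula only pointwise for a given `c` reduces each
application to an explicit integral. -/
theorem ofCc_mul {a b c : C_c(Euc n, C(X, ℂ))}
    (h : ∀ s y, c s y = ∫ r, a r y * b (s - r) (-r +ᵥ y)) : ofCc a * ofCc b = ofCc c := by
  refine CStarCrossed.ext fun π => ?_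
  rw [map_mul]
  ext ξ
  simp only [CovariantRep.rep_ofCc, mul_apply_eq_comp, CovariantRep.integrated_apply]
  set F : Euc n → Euc n → π.H := fun r s => π.ρ (a r) (π.U r (π.ρ (b (s - r)) (π.U (s - r) ξ)))
    with hF
  have hFc : Continuous (Function.uncurry F) := by
    refine (π.continuous_ρ.comp (a.continuous.comp continuous_fst)).clm_apply
      (π.continuous_U_apply continuous_fst ?_)
    refine (π.continuous_ρ.comp (b.continuous.comp (by fun_prop))).clm_apply
      ((π.U_cont ξ).comp (by fun_prop))
  have hFs : HasCompactSupport (Function.uncurry F) := by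
    refine HasCompactSupport.intro (K := tsupport a ×ˢ (tsupport a + tsupport b))
      (a.hasCompactSupport.isCompact.prod
        (a.hasCompactSupport.isCompact.add b.hasCompactSupport.isCompact)) ?_
    rintro ⟨r, s⟩ hrs
    by_cases hr : r ∈ tsupport a
    · have hs : s - r ∉ tsupport b := fun hs => hrs ⟨hr, r, hr, s - r, hs, add_sub_cancel _ _⟩
      simp [hF, image_eq_zero_of_notMem_tsupport hs]
    · simp [hF, image_eq_zero_of_notMem_tsupport hr]
  have hFi : Integrable (Function.uncurry F) (volume.prod volume) :=
    hFc.integrable_of_hasCompactSupport hFs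
  have h1 : ∀ r, π.ρ (a r) (π.U r (∫ q, π.ρ (b q) (π.U q ξ))) = ∫ s, F r s := fun r => by
    have := (π.ρ (a r) ∘L (π.U r).toContinuousLinearMap).integral_comp_comm (π.integrable b ξ)
    refine this.symm.trans ?_
    exact (integral_sub_right_eq_self (fun q => π.ρ (a r) (π.U r (π.ρ (b q) (π.U q ξ)))) r).symm
  simp only [h1]
  rw [integral_integral_swap hFi]
  refine integral_congr_ae (.of_forall fun s => ?_)
  -- The convolution integrand as a continuous `C(X)`-valued function: its integral commutes both
  -- with evaluation at `y`, which identifies it with `c s`, and with `ρ`.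
  set G : Euc n → C(X, ℂ) := fun r => a r * shift r (b (s - r)) with hG
  have hGc : Continuous G := by
    refine a.continuous.mul (ContinuousMap.continuous_of_continuous_uncurry _ ?_)
    change Continuous fun p : Euc n × X => b (s - p.1) (-p.1 +ᵥ p.2)
    have hb := b.continuous
    exact (hb.comp (by fun_prop : Continuous fun p : Euc n × X => s - p.1)).eval (by fun_prop)
  have hGi : Integrable G := hGc.integrable_of_hasCompactSupport
    (a.hasCompactSupport.mono fun r hr => by
      contrapose! hr
      simp only [Function.mem_support, not_not] at hr
      simp [hG, hr])
  have hc : c s = ∫ r, G r := by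
    ext y
    have := (ContinuousMap.evalCLM ℂ y).integral_comp_comm hGi
    refine (h s y).trans (Eq.trans ?_ this)
    rfl
  have h2 := (π.ρApply (π.U s ξ)).integral_comp_comm hGi
  rw [← hc] at h2
  refine Eq.trans (integral_congr_ae (.of_forall fun r => ?_)) h2
  simp only [hF, hG, CovariantRep.ρApply, ContinuousLinearMap.coe_mk', LinearMap.coe_mk,
    AddHom.coe_mk]
  rw [π.covariant, ← π.U_add, add_sub_cancel, map_mul]
  rfl

theorem CovariantRep.inner_U_left (π : CovariantRep n X) (s : Euc n) (ξ η : π.H) :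
    Inner.inner ℂ (π.U s ξ) η = Inner.inner ℂ ξ (π.U (-s) η) := by
  rw [← (π.U s).inner_map_map ξ, ← π.U_add, add_neg_cancel, π.U_zero]

theorem CovariantRep.inner_ρ_left (π : CovariantRep n X) (g : C(X, ℂ)) (ξ η : π.H) :
    Inner.inner ℂ (π.ρ (star g) ξ) η = Inner.inner ℂ ξ (π.ρ g η) := by
  rw [map_star, ContinuousLinearMap.star_eq_adjoint, ContinuousLinearMap.adjoint_inner_left]

/-- The adjoint of `ρ(a(s)) U_s` is `U_{-s} ρ(a(s)*)`; covariance and the substitution `s ↦ -s`,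
which preserves Lebesgue measure, bring it into the form of an integrated form. -/
theorem star_ofCc {a b : C_c(Euc n, C(X, ℂ))}
    (h : ∀ s y, b s y = star (a (-s) (-s +ᵥ y))) : star (ofCc a) = ofCc b := by
  refine CStarCrossed.ext fun π => ?_
  rw [map_star, ContinuousLinearMap.star_eq_adjoint, eq_comm, ContinuousLinearMap.eq_adjoint_iff]
  intro ξ η
  simp only [CovariantRep.rep_ofCc, CovariantRep.integrated_apply]
  rw [← integral_inner (π.integrable a η), ← inner_conj_symm, ← integral_inner (π.integrable b ξ),
    ← integral_conj, ← integral_neg_eq_self]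
  refine integral_congr_ae (.of_forall fun s => ?_)
  have hb : b (-s) = shift (-s) (star (a s)) := by
    ext y
    rw [h]
    simp [shift]
  simp only [inner_conj_symm]
  rw [hb, ← π.covariant, π.inner_U_left, π.inner_ρ_left, neg_neg]

end CrossedProduct

end

open scoped Pointwise
noncomputable section

/-! ### The map on `K₀` induced by a non-unital *-homomorphism -/

namespace KTheory

section

variable {B : Type*} [Ring B] [StarRing B] [Algebra ℂ B] {C : Type*} [Ring C] [StarRing C]
  [Algebra ℂ C]

/-- The image of a projection under a non-unital *-homomorphism, applied entrywise. -/
def Proj.mapₙ (φ : B →⋆ₙₐ[ℂ] C) (p : Proj B) : Proj C where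
  size := p.size
  mat := p.mat.map φ
  isProj := by
    have h : p.matᴴ = p.mat := p.isProj.isSelfAdjoint
    have h' : p.mat * p.mat = p.mat := p.isProj.isIdempotentElem
    refine ⟨?_, ?_⟩
    · rw [IsIdempotentElem, ← Matrix.map_mul, h']
    · rw [IsSelfAdjoint, star_eq_conjTranspose, ← Matrix.conjTranspose_map _ (map_star φ), h]

theorem MvN.mapₙ {ι κ : Type*} [Fintype ι] [Fintype κ] {p : Matrix ι ι B} {q : Matrix κ κ B}
    (h : MvN p q) (φ : B →⋆ₙₐ[ℂ] C) : MvN (p.map φ) (q.map φ) := by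
  obtain ⟨v, h1, h2⟩ := h
  refine ⟨v.map φ, ?_, ?_⟩
  · rw [← Matrix.conjTranspose_map _ (map_star φ), ← Matrix.map_mul, h1]
  · rw [← Matrix.conjTranspose_map _ (map_star φ), ← Matrix.map_mul, h2]

/-- The homomorphism on `K₀` induced by a non-unital *-homomorphism of unital algebras. -/
def K0.mapₙ (φ : B →⋆ₙₐ[ℂ] C) : K0 B →+ K0 C :=
  K0.lift (fun p => K0.cls (p.mapₙ φ))
    (fun _ _ h => K0.cls_eq (h.mapₙ φ))
    (by
      rw [← K0.cls_zero]
      refine congrArg K0.cls ?_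
      simp only [Proj.mapₙ, Proj.zero, Proj.mk.injEq, heq_eq_eq, true_and]
      ext i
      exact i.elim0)
    (fun p q => by
      rw [← K0.cls_sum]
      refine congrArg K0.cls ?_
      simp only [Proj.mapₙ, Proj.sum, Proj.mk.injEq, heq_eq_eq, true_and]
      rw [← Matrix.submatrix_map, fromBlocks_map, Matrix.map_zero _ (map_zero φ),
        Matrix.map_zero _ (map_zero φ)]
      rfl)

theorem K0.mapₙ_cls (φ : B →⋆ₙₐ[ℂ] C) (p : Proj B) :
    K0.mapₙ φ (K0.cls p) = K0.cls (p.mapₙ φ) :=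
  K0.lift_cls _ _ _ _ p

variable {A : Type*} [NonUnitalCStarAlgebra A]

/-- The homomorphism `K₀(B) → K₀(A)` induced by a *-homomorphism from a unital algebra. -/
def K0.toNonUnital (φ : B →⋆ₙₐ[ℂ] A) : K0 B →+ K0NonUnital A :=
  (K0.mapₙ ((Unitization.inrNonUnitalStarAlgHom ℂ A).comp φ)).codRestrict _ fun x => by
    rw [K0NonUnital, AddMonoidHom.mem_ker]
    obtain ⟨a, b, rfl⟩ := x.exists_eq_sub
    have h : ∀ p : Proj B, K0.map (scalarMap A)
        (K0.mapₙ ((Unitization.inrNonUnitalStarAlgHom ℂ A).comp φ) (K0.cls p)) = 0 := fun p => by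
      rw [K0.mapₙ_cls, K0.map_cls, ← K0.cls_zero]
      refine K0.cls_eq ⟨0, ?_, ?_⟩
      · rw [Matrix.mul_zero]
        ext i j
        exact (Unitization.fst_inr ℂ (φ (p.mat i j))).symm
      · ext i j
        exact i.elim0
    rw [map_sub, map_sub, h, h, sub_zero]

theorem K0.toNonUnital_single (φ : B →⋆ₙₐ[ℂ] A) (b : B) (hb : IsStarProjection b)
    (h : IsStarProjection (φ b)) :
    K0.toNonUnital φ (K0.cls (Proj.single b hb)) = K0NonUnital.ofProj (φ b) h :=
  Subtype.ext (K0.mapₙ_cls _ _)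

end

end KTheory

/-! ### The projections `e_U` -/

namespace CrossedProduct

open Filter Topology

variable {n : ℕ}

variable (n) in
/-- The centre of the unit cube. -/
def center : Euc n := WithLp.toLp 2 fun _ => 1 / 2

/-- The vector of integer parts. -/
def floorVec (t : Euc n) : Fin n → ℤ := fun i => ⌊t i⌋

theorem int_vadd_apply (m : Fin n → ℤ) (t : Euc n) (i : Fin n) : (m +ᵥ t) i = m i + t i := rfl

theorem neg_floorVec_vadd_apply (t : Euc n) (i : Fin n) :
    (-floorVec t +ᵥ t) i = Int.fract (t i) := by
  rw [int_vadd_apply, Int.fract, Pi.neg_apply, floorVec]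
  push_cast
  ring

theorem floorVec_vadd (m : Fin n → ℤ) (t : Euc n) : floorVec (m +ᵥ t) = m + floorVec t := by
  funext i
  simp [floorVec, int_vadd_apply]

variable {f : Euc n → ℝ}

theorem abs_sub_half_le (hsupp : ∀ t, f t ≠ 0 → ∀ i, |t i| ≤ 1 / 8) {u : Euc n}
    (hu : f (u - center n) ≠ 0) (i : Fin n) : |u i - 1 / 2| ≤ 1 / 8 := hsupp _ hu i

theorem hasCompactSupport_of_supp (hsupp : ∀ t, f t ≠ 0 → ∀ i, |t i| ≤ 1 / 8) :
    HasCompactSupport f := by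
  refine HasCompactSupport.intro (K := (EuclideanSpace.equiv (Fin n) ℝ).toHomeomorph ⁻¹'
    (Set.univ.pi fun _ => Set.Icc (-(1 / 8)) (1 / 8))) ?_ fun t ht => ?_
  · rw [Homeomorph.isCompact_preimage]
    exact isCompact_univ_pi fun _ => isCompact_Icc
  · by_contra h0
    exact ht fun i _ => abs_le.1 (hsupp t h0 i)

variable {S : Type*} [TopologicalSpace S] [AddAction (Fin n → ℤ) S]

/-- The function `e_g` on the orbit of the unit cube. -/
def bumpFun (f : Euc n → ℝ) (g : C(S, ℂ)) (m : Fin n → ℤ) (s : Euc n) (p : S × Euc n) : ℂ :=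
  g (m +ᵥ p.1) * f ((m +ᵥ p.2) - center n) * f ((m +ᵥ p.2) - center n - s)

/-- If `m` is not the translation into the unit cube, the two translates of the point differ by at
least one in some coordinate. Since `7/8 + 1/8 = 1`, neither of them can then lie in the support of
`f(· - c)`, and both values are zero. The range `7/8` is larger than the cube, which leaves room to
cross its faces. -/
theorem bumpFun_floorVec (hsupp : ∀ t, f t ≠ 0 → ∀ i, |t i| ≤ 1 / 8) (g : C(S, ℂ))
    {m : Fin n → ℤ} (s : Euc n) {p : S × Euc n} (h : ∀ i, |(m +ᵥ p.2) i - 1 / 2| < 7 / 8) :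
    bumpFun f g (-floorVec p.2) s p = bumpFun f g m s p := by
  by_cases hm : m = -floorVec p.2
  · rw [hm]
  obtain ⟨i, hi⟩ := Function.ne_iff.1 hm
  have hj : 1 ≤ |m i + ⌊p.2 i⌋| := Int.one_le_abs fun h0 => hi (by
    rw [Pi.neg_apply, floorVec]; linarith)
  have hj' : (1 : ℝ) ≤ |(m i : ℝ) + ⌊p.2 i⌋| := by exact_mod_cast hj
  have hm' : (m +ᵥ p.2) i = ((m i : ℝ) + ⌊p.2 i⌋) + Int.fract (p.2 i) := by
    rw [int_vadd_apply, add_assoc, Int.floor_add_fract]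
  have h0 := Int.fract_nonneg (p.2 i)
  have h1 := Int.fract_lt_one (p.2 i)
  have e1 : f ((-floorVec p.2 +ᵥ p.2) - center n) = 0 := by
    by_contra hne
    have h2 := abs_sub_half_le hsupp hne i
    rw [neg_floorVec_vadd_apply] at h2
    have h3 := h i
    rw [hm'] at h3
    rw [abs_le] at h2
    rw [abs_lt] at h3
    rcases le_abs.1 hj' with h4 | h4 <;> linarith
  have e2 : f ((m +ᵥ p.2) - center n) = 0 := by
    by_contra hne
    have h2 := abs_sub_half_le hsupp hne i
    rw [hm', abs_le] at h2
    rcases le_abs.1 hj' with h4 | h4 <;> linarith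
  simp [bumpFun, e1, e2]

variable [ContinuousConstVAdd (Fin n → ℤ) S]

/-- The floor jumps at the faces of the cube. Near a given point, however, the integer vector of
that point remains admissible in `bumpFun_floorVec`, so the function agrees locally with a
manifestly continuous one. -/
theorem continuous_bumpFun (hf : Continuous f) (hsupp : ∀ t, f t ≠ 0 → ∀ i, |t i| ≤ 1 / 8)
    (g : C(S, ℂ)) :
    Continuous fun q : Euc n × (S × Euc n) => bumpFun f g (-floorVec q.2.2) q.1 q.2 := by
  refine continuous_iff_continuousAt.2 fun q₀ => ?_
  have hg := g.continuous
  have hc : Continuous fun q : Euc n × (S × Euc n) =>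
      bumpFun f g (-floorVec q₀.2.2) q.1 q.2 := by
    simp only [bumpFun, int_vadd_def]
    have h1 : Continuous fun q : Euc n × (S × Euc n) => -floorVec q₀.2.2 +ᵥ q.2.1 :=
      (continuous_fst.comp continuous_snd).const_vadd _
    fun_prop
  refine hc.continuousAt.congr ?_
  have hev : ∀ᶠ q : Euc n × (S × Euc n) in 𝓝 q₀,
      ∀ i, |(-floorVec q₀.2.2 +ᵥ q.2.2) i - 1 / 2| < 7 / 8 := by
    refine eventually_all.2 fun i => ContinuousAt.eventually_lt ?_ continuousAt_const ?_
    · simp only [int_vadd_apply]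
      fun_prop
    · rw [neg_floorVec_vadd_apply, abs_lt]
      have h0 := Int.fract_nonneg (q₀.2.2 i)
      have h1 := Int.fract_lt_one (q₀.2.2 i)
      constructor <;> linarith
  filter_upwards [hev] with q hq
  exact (bumpFun_floorVec hsupp g q.1 hq).symm

/-- A quotient map times an identity need not be a quotient map; here it is one because the orbit
map is open. -/
theorem continuous_suspension_lift {Y : Type*} [TopologicalSpace Y]
    {F : Y × Suspension n S → ℂ} (h : Continuous fun p : Y × (S × Euc n) =>
      F (p.1, Suspension.mk p.2.1 p.2.2)) : Continuous F := by
  have hq : IsOpenQuotientMap fun p : S × Euc n => Suspension.mk p.1 p.2 :=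
    AddAction.isOpenQuotientMap_quotientMk
  exact ((IsOpenQuotientMap.id (X := Y)).prodMap hq).isQuotientMap.continuous_iff.2 h

/-- The function `e_g` on `ℝⁿ × X`. -/
def bumpLift (f : Euc n → ℝ) (g : C(S, ℂ)) (s : Euc n) : Suspension n S → ℂ :=
  Quotient.lift (fun p => bumpFun f g (-floorVec p.2) s p) (by
    rintro _ p ⟨m, rfl⟩
    change bumpFun f g (-floorVec (m +ᵥ p.2)) s (m +ᵥ p.1, m +ᵥ p.2) = _
    simp only [bumpFun, floorVec_vadd, vadd_vadd, neg_add_rev, neg_add_cancel_right])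

/-- The element `e_g` of `C_c(ℝⁿ, C(X))` for a continuous function `g` on `Σ`. -/
def bump [CompactSpace S] (hf : Continuous f) (hsupp : ∀ t, f t ≠ 0 → ∀ i, |t i| ≤ 1 / 8)
    (g : C(S, ℂ)) : C_c(Euc n, C(Suspension n S, ℂ)) where
  toContinuousMap := ContinuousMap.curry ⟨fun p => bumpLift f g p.1 p.2,
    continuous_suspension_lift (continuous_bumpFun hf hsupp g)⟩
  hasCompactSupport' := by
    have hc := (hasCompactSupport_of_supp hsupp).isCompact
    refine HasCompactSupport.intro (hc.add hc.neg) fun s hs => ?_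
    ext y
    obtain ⟨p, rfl⟩ := Quotient.exists_rep y
    change bumpFun f g (-floorVec p.2) s p = 0
    rw [bumpFun]
    set u := (-floorVec p.2 +ᵥ p.2) - center n
    by_cases h1 : u ∈ tsupport f
    · have h2 : u - s ∉ tsupport f := fun h2 => hs
        ⟨u, h1, -(u - s), Set.neg_mem_neg.2 h2, by simp⟩
      simp [image_eq_zero_of_notMem_tsupport h2]
    · simp [image_eq_zero_of_notMem_tsupport h1]

variable [CompactSpace S] (hf : Continuous f) (hsupp : ∀ t, f t ≠ 0 → ∀ i, |t i| ≤ 1 / 8)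

theorem bump_apply_floorVec (g : C(S, ℂ)) (s : Euc n) (x : S) (t : Euc n) :
    bump hf hsupp g s (Suspension.mk x t) = bumpFun f g (-floorVec t) s (x, t) := rfl

theorem bump_apply_int (g : C(S, ℂ)) (s : Euc n) (x : S) (t : Euc n) (m : Fin n → ℤ)
    (h : ∀ i, |(m +ᵥ t) i - 1 / 2| < 7 / 8) :
    bump hf hsupp g s (Suspension.mk x t) =
      g (m +ᵥ x) * f ((m +ᵥ t) - center n) * f ((m +ᵥ t) - center n - s) :=
  bumpFun_floorVec hsupp g s h

theorem bump_apply (g : C(S, ℂ)) (s : Euc n) (x : S) (t : Euc n)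
    (h : ∀ i, |t i - 1 / 2| < 7 / 8) :
    bump hf hsupp g s (Suspension.mk x t) = g x * f (t - center n) * f (t - center n - s) := by
  have := bump_apply_int hf hsupp g s x t 0 (by simpa only [zero_vadd] using h)
  rwa [zero_vadd, zero_vadd] at this

theorem abs_sub_half_of_mem_unitCube {t : Euc n} (ht : t ∈ unitCube n) (i : Fin n) :
    |t i - 1 / 2| < 7 / 8 := by
  rw [abs_lt]
  have := ht i
  constructor <;> linarith [this.1, this.2]

theorem bump_apply_of_ne_zero {g : C(S, ℂ)} {s : Euc n} {x : S} {t : Euc n}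
    (h : bump hf hsupp g s (Suspension.mk x t) ≠ 0) :
    ∃ m : Fin n → ℤ, f ((m +ᵥ t) - center n) ≠ 0 ∧ f ((m +ᵥ t) - center n - s) ≠ 0 := by
  refine ⟨-floorVec t, ?_, ?_⟩
  · intro h0; apply h; rw [bump_apply_floorVec]; simp [bumpFun, h0]
  · intro h0; apply h; rw [bump_apply_floorVec]; simp [bumpFun, h0]

/-- At most one integer translate meets the support: `|m i| < 7/8 + 1/8 = 1`. This excludes
contributions from neighbouring cubes. -/
theorem eq_zero_of_vadd {t : Euc n} {m : Fin n → ℤ} (h : ∀ i, |t i - 1 / 2| < 7 / 8)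
    (h' : ∀ i, |(m +ᵥ t) i - 1 / 2| ≤ 1 / 8) : m = 0 := by
  funext i
  have h1 := h i
  have h2 := h' i
  rw [int_vadd_apply, abs_le] at h2
  rw [abs_lt] at h1
  have h3 : (m i : ℝ) < 1 := by linarith
  have h4 : (-1 : ℝ) < m i := by linarith
  have h5 : m i < 1 := by exact_mod_cast h3
  have h6 : -1 < m i := by exact_mod_cast h4
  change m i = 0
  omega

theorem bump_add (g h : C(S, ℂ)) : bump hf hsupp (g + h) = bump hf hsupp g + bump hf hsupp h := by
  ext s y
  obtain ⟨x, t, ht, rfl⟩ := y.exists_mk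
  have h7 := abs_sub_half_of_mem_unitCube ht
  simp only [CompactlySupportedContinuousMap.coe_add, Pi.add_apply, ContinuousMap.add_apply,
    bump_apply hf hsupp _ s x t h7]
  ring

theorem bump_smul (c : ℂ) (g : C(S, ℂ)) : bump hf hsupp (c • g) = c • bump hf hsupp g := by
  ext s y
  obtain ⟨x, t, ht, rfl⟩ := y.exists_mk
  have h7 := abs_sub_half_of_mem_unitCube ht
  simp only [CompactlySupportedContinuousMap.coe_smul, Pi.smul_apply, ContinuousMap.smul_apply,
    bump_apply hf hsupp _ s x t h7, smul_eq_mul]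
  ring

/-- The convolution variable `r` enters only through `f(t - c - r)²`, whose integral is one. -/
theorem ofCc_bump_mul (hint : ∫ t, f t ^ 2 = 1) (g h : C(S, ℂ)) :
    ofCc (bump hf hsupp g) * ofCc (bump hf hsupp h) = ofCc (bump hf hsupp (g * h)) := by
  refine ofCc_mul fun s y => ?_
  obtain ⟨x, t, ht, rfl⟩ := y.exists_mk
  have h7 := abs_sub_half_of_mem_unitCube ht
  have h1 : ∀ r, bump hf hsupp g r (Suspension.mk x t) *
      bump hf hsupp h (s - r) (-r +ᵥ Suspension.mk x t) =
      (g x * h x * f (t - center n) * f (t - center n - s)) *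
        ((f (t - center n - r) ^ 2 : ℝ) : ℂ) := by
    intro r
    rw [bump_apply hf hsupp g r x t h7, Suspension.vadd_mk]
    by_cases h0 : f (t - center n - r) = 0
    · simp [h0]
    -- If `f(t - c - r) ≠ 0`, the point `t - r` is within `1/8` of the centre, so the formula for
    -- `bump` applies there without an integer shift.
    · have e1 : t + -r - center n = t - center n - r := by abel
      have e2 : t - center n - r - (s - r) = t - center n - s := by abel
      have h8 : ∀ i, |(t + -r) i - 1 / 2| < 7 / 8 := fun i =>
        lt_of_le_of_lt (abs_sub_half_le hsupp (u := t + -r) (by rwa [e1]) i) (by norm_num)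
      rw [bump_apply hf hsupp h (s - r) x (t + -r) h8, e1, e2]
      push_cast
      ring
  simp only [h1]
  rw [integral_const_mul, integral_complex_ofReal,
    integral_sub_left_eq_self (fun u => f u ^ 2) volume (t - center n), hint,
    bump_apply hf hsupp _ s x t h7]
  simp

theorem star_ofCc_bump (g : C(S, ℂ)) :
    star (ofCc (bump hf hsupp g)) = ofCc (bump hf hsupp (star g)) := by
  refine star_ofCc fun s y => ?_
  obtain ⟨x, t, ht, rfl⟩ := y.exists_mk
  have h7 := abs_sub_half_of_mem_unitCube ht
  rw [bump_apply hf hsupp _ s x t h7, Suspension.vadd_mk]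
  have e1 : t + -s - center n = t - center n - s := by abel
  by_cases h0 : f (t - center n - s) = 0
  · rw [h0]
    simp only [Complex.ofReal_zero, mul_zero]
    -- The point `t - s` may lie in another cube. A nonzero value there would come from a translate
    -- `m` that also puts `t` in the support, which forces `m = 0` and contradicts `h0`.
    by_contra hne
    have hne' : bump hf hsupp g (-s) (Suspension.mk x (t + -s)) ≠ 0 := fun h => hne (by simp [h])
    obtain ⟨m, hm1, hm2⟩ := bump_apply_of_ne_zero hf hsupp hne'
    have e2 : (m +ᵥ (t + -s)) - center n - -s = (m +ᵥ t) - center n := by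
      simp only [int_vadd_def]; abel
    rw [e2] at hm2
    have hm := eq_zero_of_vadd h7 (abs_sub_half_le hsupp hm2)
    rw [hm, zero_vadd, e1] at hm1
    exact hm1 h0
  · have h8 : ∀ i, |(t + -s) i - 1 / 2| < 7 / 8 := fun i =>
      lt_of_le_of_lt (abs_sub_half_le hsupp (u := t + -s) (by rwa [e1]) i) (by norm_num)
    rw [bump_apply hf hsupp g (-s) x (t + -s) h8, e1, sub_neg_eq_add, sub_add_cancel]
    simp
    ring

/-- The *-homomorphism `C(Σ) → C(X) ⋊ ℝⁿ`, `g ↦ e_g`. -/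
def bumpHom (hint : ∫ t, f t ^ 2 = 1) : C(S, ℂ) →⋆ₙₐ[ℂ] CStarCrossed n (Suspension n S) where
  toFun g := ofCc (bump hf hsupp g)
  map_smul' c g := by rw [bump_smul, ofCc_smul]; rfl
  map_zero' := by
    have := bump_smul hf hsupp 0 (0 : C(S, ℂ))
    rw [zero_smul] at this
    rw [this, ofCc_smul, zero_smul]
  map_add' g h := by rw [bump_add, ofCc_add]
  map_mul' g h := (ofCc_bump_mul hf hsupp hint g h).symm
  map_star' g := (star_ofCc_bump hf hsupp g).symm

end CrossedProduct

end

noncomputable section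

/-! ### `K₀(C(Σ))` is generated by the classes of clopen sets -/

namespace KTheory

open Filter Topology TopologicalSpace

theorem isStarProjection_diagonal {B : Type*} [Ring B] [StarRing B] {ι : Type*} [Fintype ι]
    [DecidableEq ι] {b : ι → B} (hb : ∀ i, IsStarProjection (b i)) :
    IsStarProjection (diagonal b) := by
  refine ⟨?_, ?_⟩
  · rw [IsIdempotentElem, diagonal_mul_diagonal]
    exact congrArg diagonal (funext fun i => (hb i).isIdempotentElem)
  · rw [IsSelfAdjoint, star_eq_conjTranspose, diagonal_conjTranspose]
    exact congrArg diagonal (funext fun i => (hb i).isSelfAdjoint)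

theorem diagonal_eq_submatrix_fromBlocks {B : Type*} [Zero B] {k : ℕ} (b : Fin (k + 1) → B) :
    diagonal b = (fromBlocks (diagonal fun i => b (Fin.castSucc i)) 0 0
      (Matrix.of fun _ _ : Fin 1 => b (Fin.last k))).submatrix
        finSumFinEquiv.symm finSumFinEquiv.symm := by
  ext i j
  obtain ⟨i, rfl⟩ := (finSumFinEquiv (m := k) (n := 1)).surjective i
  obtain ⟨j, rfl⟩ := (finSumFinEquiv (m := k) (n := 1)).surjective j
  rw [submatrix_apply, Equiv.symm_apply_apply, Equiv.symm_apply_apply, diagonal_apply]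
  simp only [finSumFinEquiv.injective.eq_iff]
  rcases i with i | i <;> rcases j with j | j
  · by_cases h : i = j
    · subst h; simp; rfl
    · simp [h]
  · simp
  · simp
  · have hi := Subsingleton.elim i 0
    have hj := Subsingleton.elim j 0
    subst hi hj
    simp
    rfl

theorem K0.cls_diagonal {B : Type*} [Ring B] [StarRing B] (k : ℕ) (b : Fin k → B)
    (hb : ∀ i, IsStarProjection (b i)) :
    K0.cls ⟨k, diagonal b, isStarProjection_diagonal hb⟩ =
      ∑ i, K0.cls (Proj.single (b i) (hb i)) := by
  induction k with
  | zero =>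
    rw [Finset.univ_eq_empty, Finset.sum_empty, ← K0.cls_zero]
    refine congrArg K0.cls ?_
    simp only [Proj.zero, Proj.mk.injEq, heq_eq_eq, true_and]
    ext i
    exact i.elim0
  | succ k ih =>
    rw [Fin.sum_univ_castSucc, ← ih (fun i => b i.castSucc) (fun i => hb _), ← K0.cls_sum]
    refine congrArg K0.cls ?_
    simp only [Proj.sum, Proj.single, Proj.mk.injEq, heq_eq_eq, true_and]
    exact diagonal_eq_submatrix_fromBlocks b

theorem exists_diagonalization {ι : Type*} [Fintype ι] [DecidableEq ι] {M : Matrix ι ι ℂ}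
    (hM : IsStarProjection M) :
    ∃ (v : Matrix ι ι ℂ) (d : ι → ℂ), vᴴ * v = M ∧ v * vᴴ = diagonal d ∧ ∀ i, d i = 0 ∨ d i = 1 := by
  have h1 : Mᴴ = M := hM.isSelfAdjoint
  have h2 : M * M = M := hM.isIdempotentElem
  have hH : M.IsHermitian := h1
  set U : Matrix ι ι ℂ := hH.eigenvectorUnitary.1 with hU
  have hU1 : U * Uᴴ = 1 := Unitary.mul_star_self_of_mem hH.eigenvectorUnitary.2
  have hD : Uᴴ * M * U = diagonal (RCLike.ofReal ∘ hH.eigenvalues) := by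
    have := hH.conjStarAlgAut_star_eigenvectorUnitary
    rw [Unitary.conjStarAlgAut_star_apply] at this
    exact this
  have e1 : (Uᴴ * M) * (Uᴴ * M)ᴴ = diagonal (RCLike.ofReal ∘ hH.eigenvalues) := by
    rw [conjTranspose_mul, conjTranspose_conjTranspose, h1, ← hD]
    calc Uᴴ * M * (M * U) = Uᴴ * (M * M) * U := by simp only [Matrix.mul_assoc]
      _ = _ := by rw [h2]
  -- The product `Uᴴ * M`, unlike `U` itself, has `M` and its diagonal form as the two squares of a
  -- partial isometry.
  refine ⟨Uᴴ * M, RCLike.ofReal ∘ hH.eigenvalues, ?_, e1, fun i => ?_⟩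
  · rw [conjTranspose_mul, conjTranspose_conjTranspose, h1]
    calc M * U * (Uᴴ * M) = M * (U * Uᴴ) * M := by simp only [Matrix.mul_assoc]
      _ = M := by rw [hU1, mul_one, h2]
  · have h3 : diagonal (RCLike.ofReal ∘ hH.eigenvalues : ι → ℂ) *
        diagonal (RCLike.ofReal ∘ hH.eigenvalues) = diagonal (RCLike.ofReal ∘ hH.eigenvalues) := by
      rw [← hD]
      calc Uᴴ * M * U * (Uᴴ * M * U) = Uᴴ * (M * (U * Uᴴ) * M) * U := by
            simp only [Matrix.mul_assoc]
        _ = _ := by rw [hU1, mul_one, h2]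
    rw [diagonal_mul_diagonal] at h3
    have h4 := congrFun (diagonal_injective h3) i
    rcases eq_or_ne ((RCLike.ofReal ∘ hH.eigenvalues : ι → ℂ) i) 0 with h | h
    · exact Or.inl h
    · exact Or.inr (mul_left_cancel₀ h (by rw [mul_one]; exact h4))

variable {S : Type*} [TopologicalSpace S] [CompactSpace S] [T2Space S] [TotallyDisconnectedSpace S]

theorem tendsto_matrix_of_norm_le {ι : Type*} [Fintype ι] {p : Matrix ι ι C(S, ℂ)}
    {q : ℕ → Matrix ι ι C(S, ℂ)}
    (h : ∀ N i j x, ‖p i j x - q N i j x‖ ≤ 1 / ((N : ℝ) + 1)) : Tendsto q atTop (𝓝 p) := by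
  refine tendsto_pi_nhds.2 fun i => tendsto_pi_nhds.2 fun j => tendsto_iff_norm_sub_tendsto_zero.2 ?_
  refine squeeze_zero (fun _ => norm_nonneg _) (fun N => ?_) tendsto_one_div_add_atTop_nhds_zero_nat
  rw [norm_sub_rev]
  exact (ContinuousMap.norm_le _ (by positivity)).2 fun x => h N i j x

/-- Projections over `C(Σ)` are close to locally constant ones. -/
theorem exists_locallyConstant_mvN {ι : Type*} [Fintype ι] [DecidableEq ι]
    {p : Matrix ι ι C(S, ℂ)} (hp : IsStarProjection p) :
    ∃ (r : S → S) (hr : IsLocallyConstant r), MvN p (Matrix.of fun i j =>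
      (⟨fun x => p i j (r x), (hr.comp (p i j)).continuous⟩ : C(S, ℂ))) := by
  let P : C(S, ι → ι → ℂ) := ⟨fun x i j => p i j x, by fun_prop⟩
  have happ : ∀ N : ℕ, ∃ (r : S → S) (_ : IsLocallyConstant r), ∀ i j x,
      ‖p i j x - p i j (r x)‖ ≤ 1 / ((N : ℝ) + 1) := by
    intro N
    have hpos : (0 : ℝ) < 1 / ((N : ℝ) + 1) := by positivity
    -- Near the diagonal of `S × S` the matrix `P` varies little. Total disconnectedness gives a map
    -- `h ∘ g` through a finite discrete set that stays in this neighbourhood of the identity, and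
    -- `r` is that map.
    have hV : {z : S × S | dist (P z.1) (P z.2) < 1 / ((N : ℝ) + 1)} ∈ nhdsSet (Set.diagonal S) := by
      rw [mem_nhdsSet_iff_forall]
      rintro ⟨x, y⟩ (rfl : x = y)
      have hc : Continuous fun z : S × S => dist (P z.1) (P z.2) := by
        have := P.continuous
        fun_prop
      refine hc.continuousAt.eventually_lt continuousAt_const ?_
      rwa [dist_self]
    obtain ⟨m, g, h, hg, hgh⟩ :=
      ContinuousMap.exists_finite_approximation_of_mem_nhds_diagonal (ContinuousMap.id S) hV
    refine ⟨h ∘ g, ((IsLocallyConstant.iff_continuous g).2 hg).comp h, fun i j x => ?_⟩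
    rw [← dist_eq_norm]
    exact ((dist_le_pi_dist (P x i) (P (h (g x)) i) j).trans
      (dist_le_pi_dist (P x) (P (h (g x))) i)).trans (hgh x).le
  choose r hr hrN using happ
  let q : ℕ → Matrix ι ι C(S, ℂ) := fun N => Matrix.of fun i j =>
    (⟨fun x => p i j (r N x), ((hr N).comp (p i j)).continuous⟩ : C(S, ℂ))
  have hq : ∀ N, IsStarProjection (q N) := by
    intro N
    refine ⟨?_, ?_⟩
    · ext i j x
      have := congrArg (fun M : Matrix ι ι C(S, ℂ) => M i j (r N x)) hp.isIdempotentElem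
      simpa [q, Matrix.mul_apply, ContinuousMap.sum_apply] using this
    · ext i j x
      have := congrArg (fun M : Matrix ι ι C(S, ℂ) => M i j (r N x)) hp.isSelfAdjoint
      simpa [q, Matrix.star_apply] using this
  have hlim : Tendsto q atTop (𝓝 p) := tendsto_matrix_of_norm_le fun N i j x => hrN N i j x
  obtain ⟨N, hN⟩ := (hlim.eventually (eventually_mvN hp)).exists
  exact ⟨r N, hr N, hN (hq N)⟩

theorem K0.exists_cls_eq_sum_clopen (p : Proj C(S, ℂ)) :
    ∃ U : Fin p.size → Clopens S, K0.cls p = ∑ i, K0.clopen (U i) := by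
  obtain ⟨r, hr, hpq⟩ := exists_locallyConstant_mvN p.isProj
  have hP : ∀ x : S, IsStarProjection (Matrix.of fun i j => p.mat i j x) := by
    intro x
    refine ⟨?_, ?_⟩
    · ext i j
      have := congrArg (fun M : Matrix _ _ C(S, ℂ) => M i j x) p.isProj.isIdempotentElem
      simpa [Matrix.mul_apply, ContinuousMap.sum_apply] using this
    · ext i j
      have := congrArg (fun M : Matrix _ _ C(S, ℂ) => M i j x) p.isProj.isSelfAdjoint
      simpa [Matrix.star_apply] using this
  -- The diagonalizations are chosen pointwise, with no continuity. Evaluating them at `r x` makes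
  -- them locally constant in `x`, hence continuous.
  choose v d hv1 hv2 hd using fun x => exists_diagonalization (hP x)
  let U : Fin p.size → Clopens S := fun i =>
    ⟨{x | d (r x) i = 1}, (hr.comp fun y => d y i).isClopen_fiber 1⟩
  refine ⟨U, ?_⟩
  have hind : ∀ i x, clopenIndicator (U i) x = d (r x) i := by
    intro i x
    rcases hd (r x) i with h | h
    · have : x ∉ (U i : Set S) := fun hx => by
        have hx' : d (r x) i = 1 := hx
        rw [h] at hx'
        exact zero_ne_one hx'
      simp [clopenIndicator, this, h]
    · have : x ∈ (U i : Set S) := h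
      simp [clopenIndicator, this, h]
  let V : Matrix (Fin p.size) (Fin p.size) C(S, ℂ) := Matrix.of fun i j =>
    ⟨fun x => v (r x) i j, (hr.comp fun y => v y i j).continuous⟩
  have hb := fun i => isStarProjection_clopenIndicator (U i)
  rw [show ∑ i, K0.clopen (U i) = _ from (K0.cls_diagonal p.size _ hb).symm]
  have hVV : V * Vᴴ = diagonal fun i => clopenIndicator (U i) := by
    ext i j x
    have := congrFun₂ (hv2 (r x)) i j
    by_cases hij : i = j
    · subst hij
      rw [diagonal_apply_eq] at this
      rw [diagonal_apply_eq, hind, ← this]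
      simp [V, Matrix.mul_apply, ContinuousMap.sum_apply]
    · rw [diagonal_apply_ne _ hij] at this
      rw [diagonal_apply_ne _ hij]
      simpa [V, Matrix.mul_apply, ContinuousMap.sum_apply] using this
  refine K0.cls_eq (MvN.trans p.isProj (isStarProjection_diagonal hb) hpq ⟨V, ?_, hVV⟩)
  ext i j x
  have := congrFun₂ (hv1 (r x)) i j
  simpa [V, Matrix.mul_apply, ContinuousMap.sum_apply] using this

theorem K0.hom_ext_clopen {G : Type*} [AddCommGroup G] {φ ψ : K0 C(S, ℂ) →+ G}
    (h : ∀ U, φ (K0.clopen U) = ψ (K0.clopen U)) : φ = ψ := by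
  refine K0.hom_ext fun p => ?_
  obtain ⟨U, hU⟩ := K0.exists_cls_eq_sum_clopen p
  rw [hU, map_sum, map_sum]
  exact Finset.sum_congr rfl fun i _ => h _

end KTheory

end

noncomputable section

/-! ### Hilbert–Schmidt norms -/

namespace CrossedProduct

section HilbertSchmidt

open ContinuousLinearMap (adjoint_inner_left adjoint_inner_right)

variable {ι H : Type*} [NormedAddCommGroup H] [InnerProductSpace ℂ H] [CompleteSpace H]
  (b : HilbertBasis ι ℂ H)

theorem tsum_enorm_inner_sq (x : H) : ∑' i, ‖inner ℂ (b i) x‖ₑ ^ 2 = ‖x‖ₑ ^ 2 := by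
  have h1 := b.hasSum_inner_mul_inner x x
  have h2 : HasSum (fun i => ‖inner ℂ (b i) x‖ ^ 2) (‖x‖ ^ 2) := by
    have h3 := Complex.hasSum_re h1
    simp only [inner_self_eq_norm_sq_to_K] at h3
    convert h3 using 1
    · funext i
      rw [← inner_conj_symm x, ← Complex.normSq_eq_conj_mul_self, Complex.normSq_eq_norm_sq]
      exact (Complex.ofReal_re _).symm
    · norm_cast
  have h4 := ENNReal.ofReal_tsum_of_nonneg (fun i => sq_nonneg ‖inner ℂ (b i) x‖) h2.summable
  rw [h2.tsum_eq] at h4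
  simp only [ENNReal.ofReal_pow (norm_nonneg _), ofReal_norm] at h4
  exact h4.symm

/-- The square of the Hilbert–Schmidt norm of an operator. -/
def hs (T : H →L[ℂ] H) : ℝ≥0∞ := ∑' i, ‖T (b i)‖ₑ ^ 2

theorem hs_eq_tsum_inner (T : H →L[ℂ] H) :
    hs b T = ∑' i, ∑' j, ‖inner ℂ (b j) (T (b i))‖ₑ ^ 2 := by
  simp only [tsum_enorm_inner_sq, hs]

/-- The double sum of squared matrix entries is symmetric under transposition and conjugation. -/
theorem hs_star (T : H →L[ℂ] H) : hs b (star T) = hs b T := by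
  rw [hs_eq_tsum_inner, hs_eq_tsum_inner, ENNReal.tsum_comm]
  refine tsum_congr fun i => tsum_congr fun j => ?_
  rw [ContinuousLinearMap.star_eq_adjoint, adjoint_inner_right, ← inner_conj_symm]
  congr 1
  exact RCLike.enorm_conj _

theorem hs_mul_le (A T : H →L[ℂ] H) : hs b (A * T) ≤ ‖A‖ₑ ^ 2 * hs b T := by
  rw [hs, hs, ← ENNReal.tsum_mul_left]
  refine ENNReal.tsum_le_tsum fun i => ?_
  rw [← mul_pow]
  gcongr
  exact A.le_opENorm _

theorem hs_add_le (A T : H →L[ℂ] H) : hs b (A + T) ≤ 2 * hs b A + 2 * hs b T := by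
  rw [hs, hs, hs, ← ENNReal.tsum_mul_left, ← ENNReal.tsum_mul_left, ← ENNReal.tsum_add]
  refine ENNReal.tsum_le_tsum fun i => ?_
  have h := parallelogram_law_with_norm ℂ (A (b i)) (T (b i))
  have h2 : ‖(A + T) (b i)‖ ^ 2 ≤ 2 * ‖A (b i)‖ ^ 2 + 2 * ‖T (b i)‖ ^ 2 := by
    rw [_root_.add_apply]
    nlinarith [mul_self_nonneg ‖A (b i) - T (b i)‖]
  have h3 := ENNReal.ofReal_le_ofReal h2
  rw [ENNReal.ofReal_add (by positivity) (by positivity), ENNReal.ofReal_mul (by norm_num),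
    ENNReal.ofReal_mul (by norm_num)] at h3
  simpa only [ENNReal.ofReal_pow (norm_nonneg _), ofReal_norm, ENNReal.ofReal_ofNat] using h3

theorem hs_smul (c : ℂ) (T : H →L[ℂ] H) : hs b (c • T) = ‖c‖ₑ ^ 2 * hs b T := by
  simp only [hs, _root_.smul_apply, enorm_smul, mul_pow, ENNReal.tsum_mul_left]

end HilbertSchmidt

theorem posTrace_sum_star_mul_self {H : Type*} [NormedAddCommGroup H] [InnerProductSpace ℂ H]
    [CompleteSpace H] {k : ℕ} (T : Fin k → H →L[ℂ] H) :
    posTrace (∑ j, star (T j) * T j) =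
      ∑ j, hs (exists_hilbertBasis ℂ H).choose_spec.choose (T j) := by
  simp only [posTrace, hs]
  rw [← Summable.tsum_finsetSum fun _ _ => ENNReal.summable]
  refine tsum_congr fun i => ?_
  rw [ContinuousLinearMap.sum_apply, inner_sum, map_sum, ENNReal.ofReal_sum_of_nonneg]
  · refine Finset.sum_congr rfl fun j _ => ?_
    rw [mul_apply_eq_comp, ContinuousLinearMap.star_eq_adjoint,
      ContinuousLinearMap.adjoint_inner_right, inner_self_eq_norm_sq,
      ENNReal.ofReal_pow (norm_nonneg _), ofReal_norm]
  · intro j _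
    rw [mul_apply_eq_comp, ContinuousLinearMap.star_eq_adjoint,
      ContinuousLinearMap.adjoint_inner_right]
    exact inner_self_nonneg

/-- Basis vectors are `√2` apart, so the balls of radius `1/2` around them are disjoint.
Countability is what permits exchanging sums over the basis with integrals and measurability. -/
theorem countable_of_hilbertBasis {ι H : Type*} [NormedAddCommGroup H] [InnerProductSpace ℂ H]
    [TopologicalSpace.SeparableSpace H] (b : HilbertBasis ι ℂ H) : Countable ι := by
  have hd : Pairwise (Function.onFun Disjoint fun i => Metric.ball (b i) (1 / 2)) := by
    intro i j hij
    refine Metric.ball_disjoint_ball ?_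
    have h1 : ‖b i - b j‖ ^ 2 = 2 := by
      rw [@norm_sub_sq ℂ, b.orthonormal.1, b.orthonormal.1, b.orthonormal.2 hij]
      norm_num
    rw [dist_eq_norm]
    nlinarith [norm_nonneg (b i - b j)]
  have := Set.PairwiseDisjoint.countable_of_isOpen (a := Set.univ) (fun i _ j _ hij => hd hij)
    (fun i _ => Metric.isOpen_ball) (fun i _ => ⟨b i, Metric.mem_ball_self (by norm_num)⟩)
  exact Set.countable_univ_iff.1 this

variable {n : ℕ}

variable (n) in
/-- The Hilbert basis of `L²(ℝⁿ)` in which traces are computed. -/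
def L2basis : HilbertBasis (exists_hilbertBasis ℂ (L2 n)).choose ℂ (L2 n) :=
  (exists_hilbertBasis ℂ (L2 n)).choose_spec.choose

instance : Countable (exists_hilbertBasis ℂ (L2 n)).choose :=
  haveI : Fact ((2 : ℝ≥0∞) ≠ ∞) := ⟨by norm_num⟩
  countable_of_hilbertBasis (L2basis n)

theorem coeFn_cubeProj (ξ : L2 n) :
    cubeProj n ξ =ᵐ[volume] fun t => (unitCube n).indicator (fun _ => (1 : ℂ)) t * ξ t :=
  coeFn_mulOp _ _ _

theorem measurableSet_unitCube : MeasurableSet (unitCube n) := by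
  have : unitCube n = ⋂ i, (fun t : Euc n => t i) ⁻¹' Set.Ico (0 : ℝ) 1 := by
    ext t; simp [unitCube]
  rw [this]
  exact MeasurableSet.iInter fun i =>
    (by fun_prop : Continuous fun t : Euc n => t i).measurable measurableSet_Ico

theorem isStarProjection_cubeProj : IsStarProjection (cubeProj n) := by
  refine ⟨ContinuousLinearMap.ext fun ξ => Lp.ext ?_, ?_⟩
  · rw [mul_apply_eq_comp]
    filter_upwards [coeFn_cubeProj (cubeProj n ξ), coeFn_cubeProj ξ] with t h1 h2
    rw [h1, h2]
    by_cases h : t ∈ unitCube n <;> simp [h]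
  · refine ((ContinuousLinearMap.eq_adjoint_iff _ _).2 fun ξ η => ?_).symm
    rw [L2.inner_def, L2.inner_def]
    refine integral_congr_ae ?_
    filter_upwards [coeFn_cubeProj ξ, coeFn_cubeProj η] with t h1 h2
    rw [h1, h2]
    by_cases h : t ∈ unitCube n <;> simp [h]

end CrossedProduct

end

noncomputable section

/-! ### The trace property -/

namespace CrossedProduct

open Filter Topology

section General

variable {n : ℕ} {X : Type*} [TopologicalSpace X] [CompactSpace X] [AddAction (Euc n) X]
  [ContinuousVAdd (Euc n) X]

theorem orbitOp_zero (y : X) : orbitOp (0 : CStarCrossed n X) y = 0 := rfl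

theorem orbitOp_add (a b : CStarCrossed n X) (y : X) :
    orbitOp (a + b) y = orbitOp a y + orbitOp b y := rfl

theorem orbitOp_mul (a b : CStarCrossed n X) (y : X) :
    orbitOp (a * b) y = orbitOp a y * orbitOp b y := rfl

theorem orbitOp_smul (c : ℂ) (a : CStarCrossed n X) (y : X) :
    orbitOp (c • a) y = c • orbitOp a y := rfl

theorem orbitOp_star (a : CStarCrossed n X) (y : X) :
    orbitOp (star a) y = star (orbitOp a y) := rfl

theorem norm_orbitOp_le (a : CStarCrossed n X) (y : X) : ‖orbitOp a y‖ ≤ ‖a‖ :=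
  (regularRep y).norm_rep_le a

theorem continuous_orbitOp (y : X) : Continuous fun a : CStarCrossed n X => orbitOp a y :=
  (regularRep y).continuous_rep

theorem orbitOp_ofCc_apply (a : C_c(Euc n, C(X, ℂ))) (y : X) (ξ : L2 n) :
    orbitOp (ofCc a) y ξ =
      ∫ s, mulOp (fun t => a s (t +ᵥ y)) (memLp_orbit (a s) y) (translation s ξ) := rfl

theorem inner_orbitOp_ofCc (a : C_c(Euc n, C(X, ℂ))) (y : X) (ξ η : L2 n) :
    inner ℂ ξ (orbitOp (ofCc a) y η) =
      ∫ s, ∫ t, star (ξ t) * (a s (t +ᵥ y) * translation s η t) := by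
  rw [orbitOp_ofCc_apply]
  refine (integral_inner ((regularRep y).integrable a η) ξ).symm.trans ?_
  refine integral_congr_ae (.of_forall fun s => ?_)
  change inner ℂ ξ (mulOp _ (memLp_orbit (a s) y) (translation s η)) = _
  rw [L2.inner_def]
  refine integral_congr_ae ?_
  filter_upwards [coeFn_mulOp _ (memLp_orbit (a s) y) (translation s η)] with t h
  rw [h, RCLike.inner_apply, mul_comm]
  rfl

theorem integrable_star_mul (ξ η : L2 n) : Integrable fun t => ‖ξ t‖ * ‖η t‖ := by
  have h := (L2.integrable_inner (𝕜 := ℂ) ξ η).norm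
  refine h.congr (.of_forall fun t => ?_)
  simp [RCLike.inner_apply, mul_comm]

/-- Dominated convergence is applied twice: in `t` with bound `‖a s‖ |ξ| |U_s η|`, and in `s` with
bound `‖a s‖ ‖ξ‖ ‖η‖`. -/
theorem continuous_inner_orbitOp_ofCc {Y : Type*} [TopologicalSpace Y] [FirstCountableTopology Y]
    {φ : Y → X} (hφ : Continuous φ) (a : C_c(Euc n, C(X, ℂ))) (ξ η : L2 n) :
    Continuous fun x => inner ℂ ξ (orbitOp (ofCc a) (φ x) η) := by
  simp only [inner_orbitOp_ofCc]
  have hb : ∀ s x t, ‖star (ξ t) * (a s (t +ᵥ φ x) * translation s η t)‖ ≤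
      ‖a s‖ * (‖ξ t‖ * ‖translation s η t‖) := fun s x t => by
    rw [norm_mul, norm_mul, norm_star]
    calc ‖ξ t‖ * (‖a s (t +ᵥ φ x)‖ * ‖translation s η t‖)
        ≤ ‖ξ t‖ * (‖a s‖ * ‖translation s η t‖) := by
          gcongr
          exact (a s).norm_coe_le_norm _
      _ = _ := by ring
  have hm : ∀ s x, AEStronglyMeasurable
      (fun t => star (ξ t) * (a s (t +ᵥ φ x) * translation s η t)) volume := fun s x =>
    (Lp.stronglyMeasurable ξ).aestronglyMeasurable.star.mul
      ((continuous_orbit (a s) (φ x)).aestronglyMeasurable.mul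
        (Lp.stronglyMeasurable _).aestronglyMeasurable)
  have hc : ∀ s, Continuous fun x => ∫ t, star (ξ t) * (a s (t +ᵥ φ x) * translation s η t) :=
    fun s => by
    refine continuous_of_dominated (hm s) (fun x => .of_forall (hb s x))
      ((integrable_star_mul ξ _).const_mul _) (.of_forall fun t => ?_)
    have := (a s).continuous.comp (hφ.const_vadd t)
    simp only [Function.comp_def] at this
    fun_prop
  refine continuous_of_dominated (bound := fun s => ‖a s‖ * (‖ξ‖ * ‖η‖)) (fun x => ?_)
    (fun x => .of_forall fun s => ?_) ((integrable_norm a).mul_const _) (.of_forall hc)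
  · have h := ((regularRep (φ x)).integrable a η).aestronglyMeasurable
    have h2 := (continuous_const.inner continuous_id :
      Continuous fun ζ : L2 n => inner ℂ ξ ζ).comp_aestronglyMeasurable h
    refine h2.congr (.of_forall fun s => ?_)
    change inner ℂ ξ (mulOp _ (memLp_orbit (a s) (φ x)) (translation s η)) = _
    rw [L2.inner_def]
    refine integral_congr_ae ?_
    filter_upwards [coeFn_mulOp _ (memLp_orbit (a s) (φ x)) (translation s η)] with t h
    rw [h, RCLike.inner_apply, mul_comm]
    rfl
  · have h : ∫ t, star (ξ t) * (a s (t +ᵥ φ x) * translation s η t) =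
        inner ℂ ξ ((regularRep (φ x)).ρ (a s) ((regularRep (φ x)).U s η)) := by
      change _ = inner ℂ ξ (mulOp _ (memLp_orbit (a s) (φ x)) (translation s η))
      rw [L2.inner_def]
      refine integral_congr_ae ?_
      filter_upwards [coeFn_mulOp _ (memLp_orbit (a s) (φ x)) (translation s η)] with t h
      rw [h, RCLike.inner_apply, mul_comm]
      rfl
    rw [h]
    calc _ ≤ ‖ξ‖ * ‖(regularRep (φ x)).ρ (a s) ((regularRep (φ x)).U s η)‖ := norm_inner_le_norm _ _
      _ ≤ ‖ξ‖ * (‖a s‖ * ‖η‖) := by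
        gcongr
        exact (regularRep (φ x)).norm_integrand_le a η s
      _ = _ := by ring

/-- Measurability, unlike continuity, passes to pointwise limits. It therefore survives the
countable expansion of products over a basis and the passage to the norm closure. -/
theorem measurable_inner_orbitOp {Y : Type*} [TopologicalSpace Y] [FirstCountableTopology Y]
    [MeasurableSpace Y] [OpensMeasurableSpace Y] {φ : Y → X} (hφ : Continuous φ)
    (a : CStarCrossed n X) : ∀ ξ η : L2 n, Measurable fun x => inner ℂ ξ (orbitOp a (φ x) η) := by
  induction a using CStarCrossed.induction with
  | ofCc a => exact fun ξ η => (continuous_inner_orbitOp_ofCc hφ a ξ η).measurable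
  | add a b ha hb =>
    intro ξ η
    simp only [orbitOp_add, _root_.add_apply, inner_add_right]
    exact (ha ξ η).add (hb ξ η)
  | mul a b ha hb =>
    intro ξ η
    have h : ∀ x, HasSum (fun i => inner ℂ ξ (orbitOp a (φ x) (L2basis n i)) *
        inner ℂ (L2basis n i) (orbitOp b (φ x) η)) (inner ℂ ξ (orbitOp (a * b) (φ x) η)) := by
      intro x
      have := (L2basis n).hasSum_inner_mul_inner
        (ContinuousLinearMap.adjoint (orbitOp a (φ x)) ξ) (orbitOp b (φ x) η)
      simp only [ContinuousLinearMap.adjoint_inner_left] at this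
      exact this
    refine measurable_of_tendsto_metrizable' atTop
      (f := fun (s : Finset (exists_hilbertBasis ℂ (L2 n)).choose) x =>
        ∑ i ∈ s, inner ℂ ξ (orbitOp a (φ x) (L2basis n i)) *
          inner ℂ (L2basis n i) (orbitOp b (φ x) η)) (fun s => ?_)
      (tendsto_pi_nhds.2 h)
    exact Finset.measurable_fun_sum _ fun i _ => (ha _ _).mul (hb _ _)
  | smul c a ha =>
    intro ξ η
    simp only [orbitOp_smul, _root_.smul_apply, inner_smul_right]
    exact (ha ξ η).const_mul c
  | star a ha =>
    intro ξ η
    have := Complex.continuous_conj.measurable.comp (ha η ξ)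
    convert this using 1
    funext x
    rw [Function.comp_apply, inner_conj_symm, orbitOp_star, ContinuousLinearMap.star_eq_adjoint,
      ContinuousLinearMap.adjoint_inner_right]
  | closed =>
    refine IsSeqClosed.isClosed fun u a hu hua ξ η => ?_
    refine measurable_of_tendsto_metrizable (fun k => hu k ξ η) (tendsto_pi_nhds.2 fun x => ?_)
    have h : Continuous fun b : CStarCrossed n X => inner ℂ ξ (orbitOp b (φ x) η) :=
      continuous_const.inner ((continuous_orbitOp (φ x)).clm_apply continuous_const)
    exact (h.tendsto a).comp hua

theorem measurable_hs_orbitOp {Y : Type*} [TopologicalSpace Y] [FirstCountableTopology Y]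
    [MeasurableSpace Y] [OpensMeasurableSpace Y] {φ : Y → X} (hφ : Continuous φ)
    (a : CStarCrossed n X) (A B : L2 n →L[ℂ] L2 n) :
    Measurable fun x => hs (L2basis n) (A * orbitOp a (φ x) * B) := by
  simp only [hs_eq_tsum_inner]
  refine Measurable.ennreal_tsum fun i => Measurable.ennreal_tsum fun j => ?_
  have := measurable_inner_orbitOp hφ a (ContinuousLinearMap.adjoint A (L2basis n j))
    (B (L2basis n i))
  simp only [ContinuousLinearMap.adjoint_inner_left] at this
  exact this.enorm.pow_const 2

/-- Translation as a continuous linear map. -/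
def transOp (v : Euc n) : L2 n →L[ℂ] L2 n := (translation v).toContinuousLinearMap

theorem transOp_apply (v : Euc n) (ξ : L2 n) : transOp v ξ = translation v ξ := rfl

theorem translation_zero (ξ : L2 n) : translation 0 ξ = ξ := Lp.ext <| by
  simpa using coeFn_translation 0 ξ

theorem translation_add (r s : Euc n) (ξ : L2 n) :
    translation (r + s) ξ = translation r (translation s ξ) := Lp.ext <| by
  have h := (measurePreserving_sub_right (volume : Measure (Euc n)) r).quasiMeasurePreserving
    |>.ae_eq_comp (coeFn_translation s ξ)
  filter_upwards [coeFn_translation (r + s) ξ, coeFn_translation r (translation s ξ), h]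
    with t h1 h2 h3
  rw [h1, h2]
  simp only [Function.comp_apply] at h3
  rw [h3, sub_sub]

theorem transOp_mul_neg (v : Euc n) : transOp v * transOp (-v) = 1 := by
  ext1 ξ
  refine (translation_add v (-v) ξ).symm.trans ?_
  rw [add_neg_cancel, translation_zero]
  rfl

theorem star_transOp (v : Euc n) : star (transOp v) = transOp (-v) := by
  refine ((ContinuousLinearMap.eq_adjoint_iff _ _).2 fun ξ η => ?_).symm
  have h := DFunLike.congr_fun (transOp_mul_neg v) ξ
  refine ((translation v).inner_map_map _ _).symm.trans ?_
  rw [← transOp_apply v (transOp (-v) ξ)]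
  rw [mul_apply_eq_comp] at h
  rw [h]
  rfl

theorem translation_mulOp_orbit (v : Euc n) (y : X) (g : C(X, ℂ)) (ξ : L2 n) :
    translation v (mulOp _ (memLp_orbit g (v +ᵥ y)) ξ) =
      mulOp _ (memLp_orbit g y) (translation v ξ) := Lp.ext <| by
  have h := (measurePreserving_sub_right (volume : Measure (Euc n)) v).quasiMeasurePreserving
    |>.ae_eq_comp (coeFn_mulOp _ (memLp_orbit g (v +ᵥ y)) ξ)
  filter_upwards [coeFn_translation v (mulOp _ (memLp_orbit g (v +ᵥ y)) ξ), h,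
    coeFn_translation v ξ, coeFn_mulOp _ (memLp_orbit g y) (translation v ξ)] with t h1 h2 h3 h4
  refine h1.trans (Eq.trans ?_ h4.symm)
  simp only [Function.comp_apply] at h2
  rw [h2, h3, vadd_vadd, sub_add_cancel]

/-- Translation by `v` commutes with the translations `U_s` and carries the restriction of a
function to the orbit based at `v +ᵥ y` into that based at `y`. -/
theorem transOp_mul_orbitOp (v : Euc n) (y : X) (a : CStarCrossed n X) :
    transOp v * orbitOp a (v +ᵥ y) = orbitOp a y * transOp v := by
  induction a using CStarCrossed.induction with
  | ofCc a =>
    ext1 ξ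
    simp only [mul_apply_eq_comp]
    refine ((transOp v).integral_comp_comm ((regularRep (v +ᵥ y)).integrable a ξ)).symm.trans ?_
    rw [orbitOp_ofCc_apply]
    refine integral_congr_ae (.of_forall fun s => ?_)
    refine (translation_mulOp_orbit v y (a s) (translation s ξ)).trans ?_
    simp only [transOp_apply]
    rw [← translation_add, ← translation_add, add_comm]
  | add a b ha hb => rw [orbitOp_add, orbitOp_add, mul_add, ha, hb, add_mul]
  | mul a b ha hb => rw [orbitOp_mul, orbitOp_mul, ← mul_assoc, ha, mul_assoc, hb, mul_assoc]
  | smul c a ha => rw [orbitOp_smul, orbitOp_smul, mul_smul_comm, ha, smul_mul_assoc]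
  | star a ha =>
    have h3 := congrArg star ha
    rw [star_mul, star_mul, star_transOp] at h3
    rw [orbitOp_star, orbitOp_star]
    calc transOp v * star (orbitOp a (v +ᵥ y))
        = transOp v * (star (orbitOp a (v +ᵥ y)) * transOp (-v)) * transOp v := by
          have h2 := transOp_mul_neg (-v)
          rw [neg_neg] at h2
          rw [mul_assoc, mul_assoc, h2, mul_one]
      _ = _ := by rw [h3, ← mul_assoc, transOp_mul_neg, one_mul]
  | closed =>
    refine isClosed_eq ?_ ?_
    · exact continuous_const.mul (continuous_orbitOp _)
    · exact (continuous_orbitOp _).mul continuous_const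

end General

section Cube

variable {n : ℕ}

/-- An integer vector, as a vector in `ℝⁿ`. -/
def intVec (m : Fin n → ℤ) : Euc n := WithLp.toLp 2 fun i => (m i : ℝ)

theorem intVec_neg (m : Fin n → ℤ) : intVec (-m) = -intVec m := by
  ext i
  simp [intVec]

theorem enorm_sq_L2 (ξ : L2 n) : ‖ξ‖ₑ ^ 2 = ∫⁻ t, ‖ξ t‖ₑ ^ 2 := by
  have h := eLpNorm_nnreal_pow_eq_lintegral (f := ξ) (μ := (volume : Measure (Euc n))) (p := 2)
    (by norm_num)
  rw [Lp.enorm_def]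
  simpa using h

theorem mem_unitCube_add_intVec {t : Euc n} {m : Fin n → ℤ} :
    t + intVec m ∈ unitCube n ↔ m = -floorVec t := by
  have : ∀ i, (t + intVec m) i = t i + m i := fun i => rfl
  simp only [unitCube, Set.mem_ofPred_eq, this]
  constructor
  · intro h
    funext i
    have h1 := h i
    have : ⌊t i + m i⌋ = 0 := Int.floor_eq_zero_iff.2 h1
    rw [Int.floor_add_intCast] at this
    simp only [Pi.neg_apply, floorVec]
    lia
  · rintro rfl i
    have : t i + ((-floorVec t) i : ℤ) = Int.fract (t i) := by
      simp only [Pi.neg_apply, floorVec, Int.fract]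
      push_cast
      ring
    rw [this]
    exact ⟨Int.fract_nonneg _, Int.fract_lt_one _⟩

/-- The integer translates of the half-open cube tile `ℝⁿ`: for each `t` exactly one `m`
contributes, namely `-floorVec t`. -/
theorem tsum_enorm_cubeProj_transOp (ξ : L2 n) :
    ∑' m : Fin n → ℤ, ‖cubeProj n (transOp (intVec m) ξ)‖ₑ ^ 2 = ‖ξ‖ₑ ^ 2 := by
  have h1 : ∀ m : Fin n → ℤ, ‖cubeProj n (transOp (intVec m) ξ)‖ₑ ^ 2 =
      ∫⁻ t, (unitCube n).indicator (fun _ => (1 : ℝ≥0∞)) (t + intVec m) * ‖ξ t‖ₑ ^ 2 := by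
    intro m
    refine (enorm_sq_L2 _).trans (Eq.trans ?_ (lintegral_sub_right_eq_self
      (fun t => (unitCube n).indicator (fun _ => (1 : ℝ≥0∞)) (t + intVec m) * ‖ξ t‖ₑ ^ 2)
      (intVec m)))
    refine lintegral_congr_ae ?_
    filter_upwards [coeFn_cubeProj (transOp (intVec m) ξ), coeFn_translation (intVec m) ξ]
      with t h1 h2
    rw [h1, sub_add_cancel, transOp_apply, h2]
    by_cases h : t ∈ unitCube n <;> simp [h]
  simp only [h1]
  rw [← lintegral_tsum, enorm_sq_L2]
  · refine lintegral_congr fun t => ?_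
    rw [ENNReal.tsum_mul_right, tsum_eq_single (-floorVec t), Set.indicator_of_mem, one_mul]
    · exact mem_unitCube_add_intVec.2 rfl
    · intro m hm
      exact Set.indicator_of_notMem (fun h => hm (mem_unitCube_add_intVec.1 h)) _
  · intro m
    refine AEMeasurable.mul ?_ ?_
    · exact ((measurable_const.indicator measurableSet_unitCube).comp
        (measurable_id.add_const (intVec m))).aemeasurable
    · exact ((Lp.stronglyMeasurable ξ).measurable.enorm.pow_const 2).aemeasurable

theorem hs_eq_tsum_cube {ι : Type*} (b : HilbertBasis ι ℂ (L2 n)) (T : L2 n →L[ℂ] L2 n) :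
    hs b T = ∑' m : Fin n → ℤ, hs b (cubeProj n * transOp (intVec m) * T) := by
  simp only [hs]
  rw [ENNReal.tsum_comm]
  refine tsum_congr fun i => ?_
  rw [← tsum_enorm_cubeProj_transOp]
  rfl

end Cube

end CrossedProduct

end

/-! ### The trace property for the trace given by the invariant measure. -/

noncomputable section

namespace CrossedProduct

open Filter Topology

variable {n : ℕ} {S : Type*} [TopologicalSpace S] [CompactSpace S] [AddAction (Fin n → ℤ) S]
  [ContinuousConstVAdd (Fin n → ℤ) S] [MeasurableSpace S]

/-- In the suspension `[x, m] = [-m + x, 0]`, so moving along the orbit by an integer vector is a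
move inside `Σ`. -/
theorem orbitOp_mk_int (m : Fin n → ℤ) (x : S) (a : CStarCrossed n (Suspension n S)) :
    orbitOp a (Suspension.mk x 0) * transOp (intVec m) =
      transOp (intVec m) * orbitOp a (Suspension.mk (-m +ᵥ x) 0) := by
  rw [← transOp_mul_orbitOp, Suspension.vadd_mk, ← Suspension.mk_vadd (-m) x (0 + intVec m)]
  congr 4
  rw [int_vadd_def, zero_add]
  change intVec (-m) + intVec m = 0
  rw [intVec_neg, neg_add_cancel]

variable (μ : Measure S)

/-- The operator of `a` along the orbit of `[x, 0]`, restricted to the unit cube. -/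
abbrev cubeOp (a : CStarCrossed n (Suspension n S)) (x : S) : L2 n →L[ℂ] L2 n :=
  orbitOp a (Suspension.mk x 0) * cubeProj n

theorem star_cubeOp_mul (a c : CStarCrossed n (Suspension n S)) (x : S) :
    star (cubeOp a x) * cubeOp c x =
      cubeProj n * orbitOp (star a * c) (Suspension.mk x 0) * cubeProj n := by
  rw [star_mul, isStarProjection_cubeProj.isSelfAdjoint.star_eq, orbitOp_mul, orbitOp_star]
  simp only [mul_assoc]

theorem continuous_mk_zero : Continuous fun x : S => Suspension.mk x (0 : Euc n) :=
  Suspension.continuous_mk.comp (continuous_id.prodMk continuous_const)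

theorem orbitOp_sum {ι : Type*} (s : Finset ι) (c : ι → CStarCrossed n (Suspension n S))
    (y : Suspension n S) : orbitOp (∑ j ∈ s, c j) y = ∑ j ∈ s, orbitOp (c j) y :=
  map_sum (regularRep y).rep c s

theorem suspensionTrace_sum {k : ℕ} (c : Fin k → CStarCrossed n (Suspension n S)) :
    suspensionTrace μ (∑ j, star (c j) * c j) =
      ∫⁻ x, ∑ j, hs (L2basis n) (cubeOp (c j) x) ∂μ := by
  refine lintegral_congr fun x => ?_
  rw [L2basis, ← posTrace_sum_star_mul_self]
  congr 1
  simp only [star_cubeOp_mul, orbitOp_sum, Finset.mul_sum, Finset.sum_mul]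

theorem suspensionTrace_star_mul_self (c : CStarCrossed n (Suspension n S)) :
    suspensionTrace μ (star c * c) = ∫⁻ x, hs (L2basis n) (cubeOp c x) ∂μ := by
  simpa using suspensionTrace_sum μ fun _ : Fin 1 => c

variable [FirstCountableTopology S] [BorelSpace S]

theorem measurable_hs_cubeOp (c : CStarCrossed n (Suspension n S)) (A : L2 n →L[ℂ] L2 n) :
    Measurable fun x => hs (L2basis n) (A * cubeOp c x) := by
  simpa only [cubeOp, ← mul_assoc] using measurable_hs_orbitOp continuous_mk_zero c A (cubeProj n)

theorem measurable_hs_cubeOp' (c : CStarCrossed n (Suspension n S)) :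
    Measurable fun x => hs (L2basis n) (cubeOp c x) := by
  simpa using measurable_hs_cubeOp c 1

theorem suspensionTrace_sum_eq {k : ℕ} (c : Fin k → CStarCrossed n (Suspension n S)) :
    suspensionTrace μ (∑ j, star (c j) * c j) = ∑ j, suspensionTrace μ (star (c j) * c j) := by
  simp only [suspensionTrace_sum, suspensionTrace_star_mul_self]
  exact lintegral_finsetSum _ fun j _ => measurable_hs_cubeOp' (c j)

/-- Cut the Hilbert–Schmidt norm into blocks indexed by the cubes `m`. The adjoint of the block `-m`
of `c` at the point `m +ᵥ x` is the block `m` of `star c` at `x`. Taking adjoints preserves the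
norm, and invariance of `μ` absorbs the move from `m +ᵥ x` to `x`. -/
theorem suspensionTrace_mul_star_self [VAddInvariantMeasure (Fin n → ℤ) S μ]
    (c : CStarCrossed n (Suspension n S)) :
    suspensionTrace μ (star c * c) = suspensionTrace μ (c * star c) := by
  have h0 := suspensionTrace_star_mul_self μ (star c)
  rw [star_star] at h0
  have key : ∀ (a : CStarCrossed n (Suspension n S)),
      ∫⁻ x, hs (L2basis n) (cubeOp a x) ∂μ = ∑' m : Fin n → ℤ,
        ∫⁻ x, hs (L2basis n) (cubeProj n * transOp (intVec m) * cubeOp a x) ∂μ := by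
    intro a
    rw [← lintegral_tsum fun m => (measurable_hs_cubeOp a _).aemeasurable]
    exact lintegral_congr fun x => hs_eq_tsum_cube _ _
  rw [h0, suspensionTrace_star_mul_self, key, key, ← (Equiv.neg _).tsum_eq]
  refine tsum_congr fun m => ?_
  rw [← (measurePreserving_vadd m μ).lintegral_comp (measurable_hs_cubeOp _ _)]
  refine lintegral_congr fun x => ?_
  rw [← hs_star]
  congr 1
  rw [Equiv.neg_apply, star_mul, star_mul, star_mul, star_transOp, intVec_neg, neg_neg,
    isStarProjection_cubeProj.isSelfAdjoint.star_eq, ← orbitOp_star]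
  have h := orbitOp_mk_int m (m +ᵥ x) (star c)
  rw [neg_vadd_vadd] at h
  rw [cubeOp, mul_assoc (cubeProj n) (transOp _), ← mul_assoc (transOp _), ← h]
  simp only [mul_assoc]

end CrossedProduct

end

noncomputable section

/-! ### Integral kernels -/

namespace CrossedProduct

open Filter Topology

variable {n : ℕ}

/-- For almost every `t`, Parseval applied to the conjugate of `k t` sums the squares of all basis
coefficients at once; integration over `t` gives the formula. -/
theorem hs_eq_lintegral_kernel {T : L2 n →L[ℂ] L2 n} {k : Euc n → Euc n → ℂ}
    (hk : ∀ t, MemLp (k t) 2 volume) (hT : ∀ ξ : L2 n, T ξ =ᵐ[volume] fun t => ∫ s, k t s * ξ s) :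
    hs (L2basis n) T = ∫⁻ t, ∫⁻ s, ‖k t s‖ₑ ^ 2 := by
  simp only [hs, enorm_sq_L2]
  rw [← lintegral_tsum fun i =>
    ((Lp.stronglyMeasurable (T (L2basis n i))).measurable.enorm.pow_const 2).aemeasurable]
  refine lintegral_congr_ae ?_
  filter_upwards [ae_all_iff.2 fun i => hT (L2basis n i)] with t ht
  have hk' : MemLp (fun s => star (k t s)) 2 volume := (hk t).star
  have h1 : ∀ i, inner ℂ (hk'.toLp _) (L2basis n i) = ∫ s, k t s * L2basis n i s := by
    intro i
    rw [L2.inner_def]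
    refine integral_congr_ae ?_
    filter_upwards [hk'.coeFn_toLp] with s hs
    rw [hs, RCLike.inner_apply, mul_comm]
    simp
  have h2 := tsum_enorm_inner_sq (L2basis n) (hk'.toLp _)
  rw [enorm_sq_L2] at h2
  have h3 : ∫⁻ s, ‖hk'.toLp _ s‖ₑ ^ 2 = ∫⁻ s, ‖k t s‖ₑ ^ 2 := by
    refine lintegral_congr_ae ?_
    filter_upwards [hk'.coeFn_toLp] with s hs
    rw [hs, ← ofReal_norm, norm_star, ofReal_norm]
  rw [← h3, ← h2]
  refine tsum_congr fun i => ?_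
  rw [ht i, ← h1, ← inner_conj_symm]
  congr 1
  exact RCLike.enorm_conj _

section Orbit

variable {X : Type*} [TopologicalSpace X] [CompactSpace X] [AddAction (Euc n) X]
  [ContinuousVAdd (Euc n) X]

theorem continuous_ofCc_kernel (a : C_c(Euc n, C(X, ℂ))) (y : X) :
    Continuous fun p : Euc n × Euc n => a p.2 (p.1 +ᵥ y) :=
  (a.continuous.comp continuous_snd).eval (continuous_fst.vadd continuous_const)

/-- By `xy ≤ x² + y²` the integrand is dominated by `|η|²` times `‖a‖` plus the integrand of the
convolution of `‖a‖` with `|ξ|²`, both integrable on the product. -/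
theorem integrable_orbit_prod (a : C_c(Euc n, C(X, ℂ))) (y : X) (η ξ : L2 n) :
    Integrable (fun p : Euc n × Euc n => star (η p.1) * (a p.2 (p.1 +ᵥ y) * ξ (p.1 - p.2)))
      (volume.prod volume) := by
  have h2 : ∀ ζ : L2 n, Integrable fun t => ‖ζ t‖ ^ 2 := fun ζ => by
    simpa only [sq] using integrable_star_mul ζ ζ
  have hb : Integrable (fun p : Euc n × Euc n => ‖η p.1‖ ^ 2 * ‖a p.2‖ + ‖a p.2‖ * ‖ξ (p.1 - p.2)‖ ^ 2)
      (volume.prod volume) := by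
    refine ((h2 η).mul_prod (integrable_norm a)).add ?_
    exact (integrable_norm a).convolution_integrand (ContinuousLinearMap.mul ℝ ℝ) (h2 ξ)
  refine hb.mono' ?_ (.of_forall fun p => ?_)
  · refine StronglyMeasurable.aestronglyMeasurable ?_
    exact ((Lp.stronglyMeasurable η).comp_measurable measurable_fst).star.mul
      ((continuous_ofCc_kernel a y).stronglyMeasurable.mul
        ((Lp.stronglyMeasurable ξ).comp_measurable (measurable_fst.sub measurable_snd)))
  · rw [norm_mul, norm_mul, norm_star]
    have h1 : ‖a p.2 (p.1 +ᵥ y)‖ ≤ ‖a p.2‖ := (a p.2).norm_coe_le_norm _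
    calc ‖η p.1‖ * (‖a p.2 (p.1 +ᵥ y)‖ * ‖ξ (p.1 - p.2)‖)
        ≤ ‖η p.1‖ * (‖a p.2‖ * ‖ξ (p.1 - p.2)‖) := by gcongr
      _ = ‖a p.2‖ * (‖η p.1‖ * ‖ξ (p.1 - p.2)‖) := by ring
      _ ≤ ‖a p.2‖ * (‖η p.1‖ ^ 2 + ‖ξ (p.1 - p.2)‖ ^ 2) := by
        gcongr
        nlinarith [sq_nonneg (‖η p.1‖ - ‖ξ (p.1 - p.2)‖), sq_nonneg ‖η p.1‖,
          sq_nonneg ‖ξ (p.1 - p.2)‖]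
      _ = _ := by ring

theorem inner_orbitOp_ofCc_eq (a : C_c(Euc n, C(X, ℂ))) (y : X) (η ξ : L2 n) :
    inner ℂ η (orbitOp (ofCc a) y ξ) =
      ∫ t, ∫ s, star (η t) * (a s (t +ᵥ y) * ξ (t - s)) := by
  rw [inner_orbitOp_ofCc]
  refine Eq.trans ?_ (integral_integral_swap (integrable_orbit_prod a y η ξ)).symm
  refine integral_congr_ae (.of_forall fun s => integral_congr_ae ?_)
  filter_upwards [coeFn_translation s ξ] with t h
  rw [h]

/-- The operator is defined by an `L²`-valued integral, which has no pointwise values. The two sides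
are compared by integrating over sets of finite measure, that is by pairing with indicators, where
Fubini applies. -/
theorem orbitOp_ofCc_ae (a : C_c(Euc n, C(X, ℂ))) (y : X) (ξ : L2 n) :
    orbitOp (ofCc a) y ξ =ᵐ[volume] fun t => ∫ s, a (t - s) (t +ᵥ y) * ξ s := by
  have h0 : ∀ t, ∫ s, a (t - s) (t +ᵥ y) * ξ s = ∫ s, a s (t +ᵥ y) * ξ (t - s) := fun t => by
    rw [← integral_sub_left_eq_self _ volume t]
    simp only [sub_sub_cancel]
  simp only [h0]
  have h1 : ∀ (B : Set (Euc n)) (hB : MeasurableSet B) (hμ : volume B ≠ ∞),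
      (fun t => ∫ s, star (indicatorConstLp 2 hB hμ (1 : ℂ) t) * (a s (t +ᵥ y) * ξ (t - s)))
        =ᵐ[volume] B.indicator fun t => ∫ s, a s (t +ᵥ y) * ξ (t - s) := by
    intro B hB hμ
    filter_upwards [indicatorConstLp_coeFn (p := 2) (hs := hB) (hμs := hμ) (c := (1 : ℂ))] with t h
    rw [h]
    by_cases ht : t ∈ B <;> simp [ht]
  refine ae_eq_of_forall_setIntegral_eq_of_sigmaFinite
    (fun B hB hμ => integrableOn_Lp_of_measure_ne_top _ (by norm_num) hμ.ne)
    (fun B hB hμ => ?_) (fun B hB hμ => ?_)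
  · rw [← integrable_indicator_iff hB]
    exact ((integrable_orbit_prod a y (indicatorConstLp 2 hB hμ.ne (1 : ℂ)) ξ).integral_prod_left).congr
      (h1 B hB hμ.ne)
  · rw [← L2.inner_indicatorConstLp_one (𝕜 := ℂ) hB hμ.ne, inner_orbitOp_ofCc_eq,
      integral_congr_ae (h1 B hB hμ.ne), integral_indicator hB]

theorem hs_orbitOp_ofCc (a : C_c(Euc n, C(X, ℂ))) (y : X) :
    hs (L2basis n) (orbitOp (ofCc a) y * cubeProj n) = ∫⁻ t, ∫⁻ s,
      ‖(unitCube n).indicator (fun s => a (t - s) (t +ᵥ y)) s‖ₑ ^ 2 := by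
  refine hs_eq_lintegral_kernel (fun t => ?_) fun ξ => ?_
  · refine MemLp.indicator measurableSet_unitCube ?_
    have hc : Continuous fun s : Euc n => a (t - s) (t +ᵥ y) :=
      (a.continuous.comp (by fun_prop : Continuous fun s : Euc n => t - s)).eval continuous_const
    refine hc.memLp_of_hasCompactSupport ?_
    refine (a.hasCompactSupport.comp_homeomorph (Homeomorph.subLeft t)).mono fun s hs => ?_
    contrapose! hs
    simp only [Function.mem_support, not_not, Function.comp_apply, Homeomorph.subLeft_apply] at hs ⊢
    simp [hs]
  · filter_upwards [orbitOp_ofCc_ae a y (cubeProj n ξ)] with t h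
    rw [mul_apply_eq_comp, h]
    refine integral_congr_ae ?_
    filter_upwards [coeFn_cubeProj ξ] with s hs
    rw [hs]
    by_cases h : s ∈ unitCube n <;> simp [h]

theorem volume_unitCube_ne_top : volume (unitCube n) ≠ ∞ := by
  refine ne_top_of_le_ne_top (b := volume ((EuclideanSpace.equiv (Fin n) ℝ).toHomeomorph ⁻¹'
    (Set.univ.pi fun _ => Set.Icc (0 : ℝ) 1))) ?_
    (measure_mono fun t ht i _ => Set.Ico_subset_Icc_self (ht i))
  refine IsCompact.measure_ne_top ?_
  rw [Homeomorph.isCompact_preimage]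
  exact isCompact_univ_pi fun _ => isCompact_Icc

/-- The constant `∫ ‖a‖²` times the volume of the cube does not depend on `y`. With `μ` finite, this
makes all elements of `C_c` square summable. -/
theorem exists_hs_orbitOp_ofCc_le (a : C_c(Euc n, C(X, ℂ))) :
    ∃ C : ℝ≥0∞, C ≠ ∞ ∧ ∀ y, hs (L2basis n) (orbitOp (ofCc a) y * cubeProj n) ≤ C := by
  have hf : ∫⁻ t, ‖a t‖ₑ ^ 2 ≠ ∞ := by
    have hi : Integrable fun t => ‖a t‖ ^ 2 := by
      refine (a.continuous.norm.pow 2).integrable_of_hasCompactSupport ?_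
      refine a.hasCompactSupport.mono fun s hs => ?_
      contrapose! hs
      simp only [Function.mem_support, not_not] at hs ⊢
      simp [hs]
    have := hi.lintegral_lt_top.ne
    simpa only [ENNReal.ofReal_pow (norm_nonneg _), ofReal_norm] using this
  refine ⟨(∫⁻ t, ‖a t‖ₑ ^ 2) * volume (unitCube n), ENNReal.mul_ne_top hf volume_unitCube_ne_top,
    fun y => ?_⟩
  rw [hs_orbitOp_ofCc]
  calc ∫⁻ t, ∫⁻ s, ‖(unitCube n).indicator (fun s => a (t - s) (t +ᵥ y)) s‖ₑ ^ 2
      ≤ ∫⁻ t, ∫⁻ s, (unitCube n).indicator (fun _ => 1) s * ‖a (t - s)‖ₑ ^ 2 := by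
        refine lintegral_mono fun t => lintegral_mono fun s => ?_
        by_cases h : s ∈ unitCube n
        · simp only [h, Set.indicator_of_mem, one_mul]
          gcongr
          exact enorm_le_iff_norm_le.2 ((a (t - s)).norm_coe_le_norm _)
        · simp [h]
    _ = ∫⁻ s, ∫⁻ t, (unitCube n).indicator (fun _ => 1) s * ‖a (t - s)‖ₑ ^ 2 := by
        refine lintegral_lintegral_swap (AEMeasurable.mul ?_ ?_)
        · exact ((measurable_const.indicator measurableSet_unitCube).comp
            measurable_snd).aemeasurable
        · exact ((a.continuous.comp (continuous_fst.sub continuous_snd)).enorm.measurable.pow_const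
            2).aemeasurable
    _ = ∫⁻ s, (unitCube n).indicator (fun _ => 1) s * ∫⁻ t, ‖a t‖ₑ ^ 2 := by
        refine lintegral_congr fun s => ?_
        have hm : Measurable fun t => ‖a (t - s)‖ₑ ^ 2 :=
          (a.continuous.comp (continuous_id.sub continuous_const)).enorm.measurable.pow_const 2
        rw [lintegral_const_mul _ hm, lintegral_sub_right_eq_self (fun t => ‖a t‖ₑ ^ 2) s]
    _ ≤ _ := by
        rw [lintegral_mul_const _ (measurable_const.indicator measurableSet_unitCube), mul_comm,
          lintegral_indicator_const measurableSet_unitCube, one_mul]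

end Orbit

end CrossedProduct

end

noncomputable section

/-! ### The trace on the crossed product -/

namespace CrossedProduct

open Filter Topology KTheory

theorem enorm_complex_ofReal (r : ℝ) : ‖(r : ℂ)‖ₑ = ‖r‖ₑ := by
  rw [← ofReal_norm, Complex.norm_real, ofReal_norm]

variable {n : ℕ} {S : Type*} [TopologicalSpace S] [CompactSpace S] [AddAction (Fin n → ℤ) S]
  [ContinuousConstVAdd (Fin n → ℤ) S] [MeasurableSpace S]

/-- The diagonal entry at `b i` of the operator of `a` along the orbit of `[x, 0]`, cut down to
the unit cube. -/
def diagEntry (i : (exists_hilbertBasis ℂ (L2 n)).choose) (a : CStarCrossed n (Suspension n S))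
    (x : S) : ℂ :=
  inner ℂ (cubeProj n (L2basis n i)) (orbitOp a (Suspension.mk x 0) (cubeProj n (L2basis n i)))

theorem diagEntry_add (i) (a c : CStarCrossed n (Suspension n S)) (x : S) :
    diagEntry i (a + c) x = diagEntry i a x + diagEntry i c x := by
  simp [diagEntry, orbitOp_add, inner_add_right]

theorem diagEntry_smul (i) (z : ℂ) (a : CStarCrossed n (Suspension n S)) (x : S) :
    diagEntry i (z • a) x = z * diagEntry i a x := by
  simp [diagEntry, orbitOp_smul, inner_smul_right]

theorem diagEntry_star_mul_self (i) (c : CStarCrossed n (Suspension n S)) (x : S) :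
    diagEntry i (star c * c) x = ((‖cubeOp c x (L2basis n i)‖ ^ 2 : ℝ) : ℂ) := by
  rw [diagEntry, orbitOp_mul, orbitOp_star, mul_apply_eq_comp, ContinuousLinearMap.star_eq_adjoint,
    ContinuousLinearMap.adjoint_inner_right, inner_self_eq_norm_sq_to_K]
  norm_cast

variable [FirstCountableTopology S] [BorelSpace S]

theorem measurable_diagEntry (i) (a : CStarCrossed n (Suspension n S)) :
    Measurable (diagEntry i a) :=
  measurable_inner_orbitOp continuous_mk_zero a _ _

variable (μ : Measure S)

variable (n) in
/-- The elements whose diagonal is absolutely integrable. -/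
def integrableDiag : Submodule ℂ (CStarCrossed n (Suspension n S)) where
  carrier := {a | ∑' i, ∫⁻ x, ‖diagEntry i a x‖ₑ ∂μ ≠ ∞}
  zero_mem' := by simp [diagEntry, orbitOp_zero]
  add_mem' {a c} ha hc := by
    refine ne_top_of_le_ne_top (ENNReal.add_ne_top.2 ⟨ha, hc⟩) ?_
    rw [← ENNReal.tsum_add]
    refine ENNReal.tsum_le_tsum fun i => ?_
    rw [← lintegral_add_left (measurable_diagEntry i a).enorm]
    refine lintegral_mono fun x => ?_
    rw [diagEntry_add]
    exact enorm_add_le _ _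
  smul_mem' z a ha := by
    change ∑' i, ∫⁻ x, ‖diagEntry i (z • a) x‖ₑ ∂μ ≠ ∞
    simp only [diagEntry_smul, enorm_mul]
    simp only [lintegral_const_mul _ (measurable_diagEntry _ a).enorm, ENNReal.tsum_mul_left]
    exact ENNReal.mul_ne_top enorm_ne_top ha

variable {μ}

theorem integrable_diagEntry {a : CStarCrossed n (Suspension n S)} (ha : a ∈ integrableDiag n μ)
    (i) : Integrable (diagEntry i a) μ :=
  ⟨(measurable_diagEntry i a).aestronglyMeasurable,
    lt_top_iff_ne_top.2 (ENNReal.ne_top_of_tsum_ne_top ha i)⟩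

theorem summable_integral_diagEntry {a : CStarCrossed n (Suspension n S)}
    (ha : a ∈ integrableDiag n μ) : Summable fun i => ∫ x, diagEntry i a x ∂μ := by
  refine Summable.of_norm_bounded (ENNReal.summable_toReal ha) fun i => ?_
  exact (norm_integral_le_lintegral_norm _).trans_eq (by simp only [ofReal_norm])

variable (n μ) in
/-- The trace as a linear functional on the elements with absolutely integrable diagonal. -/
def diagTrace : integrableDiag (S := S) n μ →ₗ[ℂ] ℂ where
  toFun a := ∑' i, ∫ x, diagEntry i a.1 x ∂μ
  map_add' a c := by
    rw [← (summable_integral_diagEntry a.2).tsum_add (summable_integral_diagEntry c.2)]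
    refine tsum_congr fun i => ?_
    rw [← integral_add (integrable_diagEntry a.2 i) (integrable_diagEntry c.2 i)]
    simp only [Submodule.coe_add, diagEntry_add]
  map_smul' z a := by
    simp only [Submodule.coe_smul, diagEntry_smul, integral_const_mul, tsum_mul_left,
      RingHom.id_apply, smul_eq_mul]

theorem suspensionTrace_eq_tsum (c : CStarCrossed n (Suspension n S)) :
    suspensionTrace μ (star c * c) = ∑' i, ∫⁻ x, ‖diagEntry i (star c * c) x‖ₑ ∂μ := by
  rw [suspensionTrace_star_mul_self,
    ← lintegral_tsum fun i => (measurable_diagEntry i _).enorm.aemeasurable]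
  refine lintegral_congr fun x => tsum_congr fun i => ?_
  rw [diagEntry_star_mul_self, Complex.ofReal_pow, enorm_pow, enorm_complex_ofReal, enorm_norm]

theorem diagTrace_star_mul_self {c : CStarCrossed n (Suspension n S)}
    (hc : star c * c ∈ integrableDiag n μ) :
    diagTrace n μ ⟨star c * c, hc⟩ = ((suspensionTrace μ (star c * c)).toReal : ℂ) := by
  rw [suspensionTrace_eq_tsum, ENNReal.tsum_toReal_eq (ENNReal.ne_top_of_tsum_ne_top hc),
    Complex.ofReal_tsum]
  refine tsum_congr fun i => ?_
  rw [← integral_norm_eq_lintegral_enorm (measurable_diagEntry i _).aestronglyMeasurable,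
    ← integral_complex_ofReal]
  refine integral_congr_ae (.of_forall fun x => ?_)
  simp only [diagEntry_star_mul_self]
  rw [Complex.norm_real, Real.norm_of_nonneg (sq_nonneg _)]

variable (n μ) in
/-- The elements that are square summable for the trace. -/
def squareSummable : Submodule ℂ (CStarCrossed n (Suspension n S)) where
  carrier := {c | ∫⁻ x, hs (L2basis n) (cubeOp c x) ∂μ ≠ ∞}
  zero_mem' := by simp [cubeOp, orbitOp_zero, hs]
  add_mem' {a c} ha hc := by
    refine ne_top_of_le_ne_top (ENNReal.add_ne_top.2 ⟨ENNReal.mul_ne_top (ENNReal.ofNat_ne_top (n := 2)) ha,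
      ENNReal.mul_ne_top (ENNReal.ofNat_ne_top (n := 2)) hc⟩) ?_
    rw [← lintegral_const_mul 2 (measurable_hs_cubeOp' a), ← lintegral_const_mul 2
      (measurable_hs_cubeOp' c), ← lintegral_add_left ((measurable_hs_cubeOp' a).const_mul 2)]
    refine lintegral_mono fun x => ?_
    rw [cubeOp, orbitOp_add, add_mul]
    exact hs_add_le _ _ _
  smul_mem' z a ha := by
    change ∫⁻ x, hs (L2basis n) (cubeOp (z • a) x) ∂μ ≠ ∞
    simp only [cubeOp, orbitOp_smul, smul_mul_assoc, hs_smul]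
    rw [lintegral_const_mul _ (measurable_hs_cubeOp' a)]
    exact ENNReal.mul_ne_top (ENNReal.pow_ne_top enorm_ne_top) ha

theorem mem_squareSummable {c : CStarCrossed n (Suspension n S)} :
    c ∈ squareSummable n μ ↔ suspensionTrace μ (star c * c) ≠ ∞ := by
  rw [suspensionTrace_star_mul_self]
  rfl

theorem mul_mem_squareSummable (a : CStarCrossed n (Suspension n S))
    {c : CStarCrossed n (Suspension n S)} (hc : c ∈ squareSummable n μ) :
    a * c ∈ squareSummable n μ := by
  refine ne_top_of_le_ne_top (ENNReal.mul_ne_top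
    (ENNReal.pow_ne_top (n := 2) (enorm_ne_top (x := a))) hc) ?_
  rw [← lintegral_const_mul _ (measurable_hs_cubeOp' c)]
  refine lintegral_mono fun x => ?_
  rw [cubeOp, orbitOp_mul, mul_assoc]
  refine (hs_mul_le _ _ _).trans ?_
  gcongr
  exact enorm_le_iff_norm_le.2 (norm_orbitOp_le a _)

variable [VAddInvariantMeasure (Fin n → ℤ) S μ]

theorem star_mem_squareSummable {c : CStarCrossed n (Suspension n S)}
    (hc : c ∈ squareSummable n μ) : star c ∈ squareSummable n μ := by
  rw [mem_squareSummable] at hc ⊢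
  rwa [star_star, ← suspensionTrace_mul_star_self]

theorem dense_squareSummable [IsFiniteMeasure μ] :
    Dense (squareSummable n μ : Set (CStarCrossed n (Suspension n S))) := by
  intro a
  induction a using CStarCrossed.induction with
  | ofCc a =>
    obtain ⟨C, hC, h⟩ := exists_hs_orbitOp_ofCc_le a
    refine subset_closure (ne_top_of_le_ne_top (ENNReal.mul_ne_top hC (measure_ne_top μ Set.univ))
      ((lintegral_mono fun x => h _).trans_eq (lintegral_const C)))
  | add a b ha hb => exact (squareSummable n μ).topologicalClosure.add_mem ha hb
  | mul a b ha hb =>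
    exact map_mem_closure (continuous_const.mul continuous_id) hb
      fun c hc => mul_mem_squareSummable a hc
  | smul z a ha => exact (squareSummable n μ).topologicalClosure.smul_mem z ha
  | star a ha => exact map_mem_closure continuous_star ha fun c hc => star_mem_squareSummable hc
  | closed => exact isClosed_closure

variable (n μ) in
/-- The densely defined trace on `C(X) ⋊ ℝⁿ` given by the transverse measure `μ`. -/
def suspensionDenseTrace [IsFiniteMeasure μ] :
    DenseTrace (suspensionTrace (n := n) μ) where
  n := squareSummable n μ
  mem_n _ := mem_squareSummable
  mul_mem a _ hc := mul_mem_squareSummable a hc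
  star_mem _ hc := star_mem_squareSummable hc
  dense := dense_squareSummable
  -- Any linear extension to the whole algebra will do: only its values on the squares `star c * c`
  -- of square summable elements are prescribed, and by polarization these fix it on the ideal.
  L := (diagTrace n μ).exists_extend.choose
  L_star_mul_self c hc := by
    have h1 : star c * c ∈ integrableDiag n μ := by
      have := mem_squareSummable.1 hc
      rwa [suspensionTrace_eq_tsum] at this
    exact (LinearMap.congr_fun (diagTrace n μ).exists_extend.choose_spec ⟨_, h1⟩).trans
      (diagTrace_star_mul_self h1)
  trace := suspensionTrace_mul_star_self μ
  sum _ := suspensionTrace_sum_eq μ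

/-! ### The trace of the projections `e_U` -/

section Bump

variable {f : Euc n → ℝ} (hf : Continuous f) (hsupp : ∀ t, f t ≠ 0 → ∀ i, |t i| ≤ 1 / 8)

/-- Restricted to columns `s` in the unit cube, the kernel becomes the elementary tensor `g(x) f(t -
c) f(s - c)`, including for `t` outside the cube, where both sides vanish. -/
theorem indicator_bump (g : C(S, ℂ)) (x : S) (t s : Euc n) :
    (unitCube n).indicator (fun s => bump hf hsupp g (t - s) (t +ᵥ Suspension.mk x 0)) s =
      g x * f (t - center n) * f (s - center n) := by
  rw [Suspension.vadd_mk, zero_add]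
  by_cases hs : s ∈ unitCube n
  · rw [Set.indicator_of_mem hs]
    by_cases ht : ∀ i, |t i - 1 / 2| < 7 / 8
    · rw [bump_apply hf hsupp g _ x t ht]
      rw [show t - center n - (t - s) = s - center n by abel]
    · have h0 : f (t - center n) = 0 := by
        by_contra h0
        exact ht fun i => (abs_sub_half_le hsupp h0 i).trans_lt (by norm_num)
      rw [h0]
      by_contra hne
      simp only [Complex.ofReal_zero, mul_zero, zero_mul] at hne
      obtain ⟨m, h1, h2⟩ := bump_apply_of_ne_zero hf hsupp hne
      have h3 : (m +ᵥ t) - center n - (t - s) = (m +ᵥ s) - center n := by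
        simp only [int_vadd_def]
        abel
      rw [h3] at h2
      have hm := eq_zero_of_vadd (abs_sub_half_of_mem_unitCube hs) (abs_sub_half_le hsupp h2)
      rw [hm, zero_vadd] at h1
      exact h1 h0
  · rw [Set.indicator_of_notMem hs]
    have h0 : f (s - center n) = 0 := by
      by_contra h0
      refine hs fun i => ?_
      have := abs_le.1 (abs_sub_half_le hsupp h0 i)
      constructor <;> linarith [this.1, this.2]
    simp [h0]

theorem suspensionTrace_bump (hint : ∫ t, f t ^ 2 = 1) (U : TopologicalSpace.Clopens S) :
    suspensionTrace μ (ofCc (bump hf hsupp (clopenIndicator U))) = μ U := by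
  have he : IsStarProjection (ofCc (bump hf hsupp (clopenIndicator U))) :=
    (isStarProjection_clopenIndicator U).map (bumpHom hf hsupp hint)
  have h1 : ∫⁻ t, ‖f (t - center n)‖ₑ ^ 2 = 1 := by
    rw [lintegral_sub_right_eq_self (fun t => ‖f t‖ₑ ^ 2)]
    -- A non-integrable function has integral zero by convention, which `hint` excludes.
    have hi : Integrable fun t => f t ^ 2 := by
      by_contra h
      rw [integral_undef h] at hint
      exact zero_ne_one hint
    have := ofReal_integral_eq_lintegral_ofReal hi (.of_forall fun t => sq_nonneg _)
    rw [hint, ENNReal.ofReal_one] at this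
    rw [this]
    refine lintegral_congr fun t => ?_
    rw [← ofReal_norm, ← ENNReal.ofReal_pow (norm_nonneg _), Real.norm_eq_abs, sq_abs]
  have hm : Measurable fun t => ‖f (t - center n)‖ₑ ^ 2 :=
    (hf.comp (continuous_id.sub continuous_const)).enorm.measurable.pow_const 2
  -- The kernel has squared norm `|χ_U(x)|² (∫ f²)² = χ_U(x)`.
  have h2 : ∀ x, hs (L2basis n) (cubeOp (ofCc (bump hf hsupp (clopenIndicator U))) x) =
      (U : Set S).indicator (fun _ => 1) x := by
    intro x
    rw [cubeOp, hs_orbitOp_ofCc]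
    simp only [indicator_bump, enorm_mul, mul_pow, enorm_complex_ofReal]
    simp only [lintegral_const_mul _ hm, h1, mul_one]
    by_cases hx : x ∈ (U : Set S) <;> simp [clopenIndicator, hx]
  have h3 := suspensionTrace_star_mul_self μ (ofCc (bump hf hsupp (clopenIndicator U)))
  rw [he.isSelfAdjoint.star_eq, he.isIdempotentElem.eq] at h3
  rw [h3]
  simp only [h2]
  rw [lintegral_indicator_const U.isClopen.isOpen.measurableSet, one_mul]

end Bump

end CrossedProduct

end

/-! ### Evaluation on clopen classes and the main theorem. -/

noncomputable section

namespace KTheory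

theorem K0.ofMeasure_clopen {S : Type*} [TopologicalSpace S] [CompactSpace S] [MeasurableSpace S]
    [OpensMeasurableSpace S] (μ : Measure S) [IsFiniteMeasure μ]
    (U : TopologicalSpace.Clopens S) : K0.ofMeasure μ (K0.clopen U) = μ.real U := by
  refine (K0.ofTrace_cls _ _ _).trans ((Fin.sum_univ_one _).trans ?_)
  change (∫ x, (U : Set S).indicator (fun _ => (1 : ℂ)) x ∂μ).re = _
  rw [integral_indicator_const _ U.isClopen.isOpen.measurableSet]
  simp

end KTheory

end

theorem mainTheorem6 {n : ℕ} {S : Type*} [TopologicalSpace S] [CompactSpace S]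
    [TopologicalSpace.MetrizableSpace S] [TotallyDisconnectedSpace S] [PerfectSpace S]
    [MeasurableSpace S] [BorelSpace S]
    [AddAction (Fin n → ℤ) S] [ContinuousConstVAdd (Fin n → ℤ) S]
    [AddAction.IsMinimal (Fin n → ℤ) S]
    (hfree : ∀ (m : Fin n → ℤ) (x : S), m +ᵥ x = x → m = 0)
    (μ : MeasureTheory.Measure S) [MeasureTheory.IsProbabilityMeasure μ]
    [MeasureTheory.VAddInvariantMeasure (Fin n → ℤ) S μ]
    (f : CrossedProduct.Euc n → ℝ) (hf : Continuous f)
    (hsupp : ∀ t, f t ≠ 0 → ∀ i, |t i| ≤ 1 / 8) (hint : ∫ t, f t ^ 2 = 1) :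
    ∃ e : TopologicalSpace.Clopens S →
        C_c(CrossedProduct.Euc n, C(CrossedProduct.Suspension n S, ℂ)),
      (∀ (U : TopologicalSpace.Clopens S) (x : S) (t s : CrossedProduct.Euc n),
        (∀ i, t i ∈ Set.Icc (0 : ℝ) 1) →
          e U s (CrossedProduct.Suspension.mk x t) =
            (U : Set S).indicator (fun _ => (1 : ℂ)) x *
              (f (t - WithLp.toLp 2 (fun _ => (1 / 2 : ℝ))) : ℂ) *
              (f (t - WithLp.toLp 2 (fun _ => (1 / 2 : ℝ)) - s) : ℂ)) ∧
      ∃ he : ∀ U, IsStarProjection (CrossedProduct.ofCc (e U)),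
      ∃ T : KTheory.K0NonUnital
          (CrossedProduct.CStarCrossed n (CrossedProduct.Suspension n S)) →+ ℝ,
        (∀ y r, KTheory.IsTraceOf (CrossedProduct.suspensionTrace μ) y r ↔ T y = r) ∧
        (∀ U, CrossedProduct.suspensionTrace μ (CrossedProduct.ofCc (e U)) = μ U) ∧
        (∀ U, T (KTheory.K0NonUnital.ofProj _ (he U)) = μ.real U) ∧
        ∃ α : KTheory.K0 C(S, ℂ) →+ KTheory.K0NonUnital
            (CrossedProduct.CStarCrossed n (CrossedProduct.Suspension n S)),
          (∀ U, α (KTheory.K0.clopen U) = KTheory.K0NonUnital.ofProj _ (he U)) ∧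
          (∀ α' : KTheory.K0 C(S, ℂ) →+ KTheory.K0NonUnital
              (CrossedProduct.CStarCrossed n (CrossedProduct.Suspension n S)),
            (∀ U, α' (KTheory.K0.clopen U) = KTheory.K0NonUnital.ofProj _ (he U)) → α' = α) ∧
          T.comp α = KTheory.K0.ofMeasure μ := by
  have hproj : ∀ U : TopologicalSpace.Clopens S, IsStarProjection
      (CrossedProduct.ofCc (CrossedProduct.bump hf hsupp (KTheory.clopenIndicator U))) := fun U =>
    (KTheory.isStarProjection_clopenIndicator U).map (CrossedProduct.bumpHom hf hsupp hint)
  have hμ := CrossedProduct.suspensionTrace_bump (μ := μ) hf hsupp hint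
  have hT : ∀ U, ((CrossedProduct.suspensionDenseTrace n μ).k0.comp
      (KTheory.K0NonUnital (CrossedProduct.CStarCrossed n (CrossedProduct.Suspension n S))).subtype)
      (KTheory.K0NonUnital.ofProj _ (hproj U)) = μ.real U := fun U => by
    refine ((CrossedProduct.suspensionDenseTrace n μ).k0_ofProj _ (hproj U) ?_).trans ?_
    · rw [hμ]
      exact measure_ne_top μ _
    · rw [hμ]
      rfl
  have hα : ∀ U, KTheory.K0.toNonUnital (CrossedProduct.bumpHom hf hsupp hint)
      (KTheory.K0.clopen U) = KTheory.K0NonUnital.ofProj _ (hproj U) := fun U =>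
    KTheory.K0.toNonUnital_single _ _ _ _
  refine ⟨fun U => CrossedProduct.bump hf hsupp (KTheory.clopenIndicator U), ?_, hproj, _,
    fun y r => (CrossedProduct.suspensionDenseTrace n μ).isTraceOf_iff y r, hμ, hT,
    KTheory.K0.toNonUnital (CrossedProduct.bumpHom hf hsupp hint), hα, fun α' h => ?_, ?_⟩
  · intro U x t s ht
    -- The closed cube lies within distance `1/2 < 7/8` of the centre in each coordinate, so the
    -- formula is also valid on its boundary.
    refine CrossedProduct.bump_apply hf hsupp _ s x t fun i => ?_
    rw [abs_lt]
    have := ht i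
    constructor <;> linarith [this.1, this.2]
  -- Clopen classes generate `K₀(C(Σ))`, so agreement on them settles both uniqueness and the
  -- identity `T ∘ α = μ`.
  · exact KTheory.K0.hom_ext_clopen fun U => (h U).trans (hα U).symm
  · refine KTheory.K0.hom_ext_clopen fun U => ?_
    rw [AddMonoidHom.comp_apply, hα]
    exact (hT U).trans (KTheory.K0.ofMeasure_clopen μ U).symm
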